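/- Let $0<\alpha_1<\alpha_2<1$, $c>0$, $\lambda>0$, $u_0\in\mathbb R$, and let $\alpha(t)=\alpha_2+(\alpha_1-\alpha_2)e^{-ct}$, with Laplace transform $A(s)=\frac{\alpha_1 s+\alpha_2c}{s(s+c)}$. Let $\varphi_\alpha$, continuous on $(0,\infty)$, be the inverse Laplace transform of $s^{sA(s)-1}$ (principal powers), and let ${}^SD_0^{\alpha(t)}f(t)=\int_0^t\varphi_\alpha(t-\tau)f'(\tau)\,d\tau$ be the Scarpi derivative. Consider the problem $${}^SD_0^{\alpha(t)}u(t)=-\lambda u(t)\quad(t>0),\qquad u(0)=u_0,$$ for functions $u:[0,\infty)\to\mathbb R$ that are absolutely continuous on every $[0,T]$. Put $$W(s)=\frac{s^{sA(s)-1}}{s^{sA(s)}+\lambda},\qquad s\in\mathbb C\setminus(-\infty,0],\qquad p(\rho)=\frac{\alpha_1\rho-\alpha_2c}{c-\rho},$$ and assume that the boundary values of $s^{sA(s)}+\lambda$ at $s=\rho e^{i\pi}$ do not vanish for $\rho>0$, $\rho\ne c$ (that is, apart from $-c$ and $0$ there are no singularities on the branch cut; the lower boundary values are the complex conjugates). For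 $s_0>0$ and $0<\varepsilon<R$ let $\Gamma=\Gamma_{s_0,R,\varepsilon}$ be the Bromwich contour with branch cut along the negative real axis: the vertical segment $\operatorname{Re}s=s_0$, $|\operatorname{Im}s|\le R$; the horizontal segments from $s_0\pm iR$ to $\pm iR$; the quarter circles $|s|=R$ from $\pm iR$ to $-R$; the segments from $-R$ to $-\varepsilon$ along both sides of the cut; and the circle $|s|=\varepsilon$. Then $\varphi_\alpha$ exists, the problem has exactly one solution $u$, and the Laplace transform of $u$ is $u_0W(s)$ on some right half-plane. The real parts of the poles of $W$ are bounded above. If $s_0>0$ exceeds the real parts of all the poles, then for all sufficiently large $R$ and, given $R$, all sufficiently small $\varepsilon>0$, for every $t\ge0$ $$u(t)=\frac{u_0}{2\pi i}\left(\mathfrak R-\int_0^\infty\frac{2\lambda i\,\rho^{p(\rho)}\sin(\pi p(\rho))\,e^{-\rho t}}{\rho\left(1+2\lambda\rho^{p(\rho)}\cos(\pi p(\rho))+\lambda^2\rho^{2p(\rho)}\right)}\,d\rho\right),$$ where $\mathfrak R$ is $2\pi i$ times the (absolutely convergent, possibly infinite) sum of the residues of $W(s)e^{st}$ at the poles of $W$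 inside $\Gamma$. The integral converges absolutely, and, unless $c=1$ and $\lambda e^{\alpha_2-\alpha_1}=1$, its integrand is bounded near $\rho=c$. -/

import Mathlib

open Set Filter Topology MeasureTheory

namespace Scarpi

noncomputable section

/-- The Laplace transform `∫₀^∞ e^{-st} f(t) dt` of a real function on `(0, ∞)`. -/
def laplace (f : ℝ → ℝ) (s : ℂ) : ℂ :=
  ∫ t in Ioi (0 : ℝ), Complex.exp (-s * (t : ℂ)) * (f t : ℂ)

/-- `F` is the Laplace transform of `f`: on some right half-plane the Laplace integral of `f`
converges absolutely and equals `F`. -/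
def HasLaplace (f : ℝ → ℝ) (F : ℂ → ℂ) : Prop :=
  ∃ a : ℝ, ∀ s : ℂ, a < s.re →
    IntegrableOn (fun t : ℝ => Complex.exp (-s * (t : ℂ)) * (f t : ℂ)) (Ioi 0) ∧ laplace f s = F s

/-- `f` is the inverse Laplace transform of `F`. Continuity on `(0, ∞)` makes `f` unique there;
a singularity at `0` such as that of `t ^ (-α)` is allowed. -/
def IsInverseLaplace (F : ℂ → ℂ) (f : ℝ → ℝ) : Prop :=
  ContinuousOn f (Ioi 0) ∧ HasLaplace f F

open Classical in
/-- The inverse Laplace transform (`0` when there is none). -/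
def inverseLaplace (F : ℂ → ℂ) : ℝ → ℝ :=
  if h : ∃ f, IsInverseLaplace F f then h.choose else 0

/-- The Laplace-domain kernel `s ^ (s A(s) - 1)` of the Scarpi derivative, `A` being the Laplace
transform of the transition function. -/
def kernelTransform (A : ℂ → ℂ) (s : ℂ) : ℂ :=
  s ^ (s * A s - 1)

/-- The kernel `φ_α` of the Scarpi derivative of variable order `α`. -/
def kernel (α : ℝ → ℝ) : ℝ → ℝ :=
  inverseLaplace (kernelTransform (laplace α))

/-- The Scarpi derivative `∫₀ᵗ φ_α(t - τ) f'(τ) dτ` of variable order `α`. -/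
def scarpiDeriv (α : ℝ → ℝ) (f : ℝ → ℝ) (t : ℝ) : ℝ :=
  ∫ τ in (0 : ℝ)..t, kernel α (t - τ) * deriv f τ

/-- `u` solves the relaxation equation with relaxation parameter `lam` and initial value `u₀`:
it is absolutely continuous on every `[0, T]`, takes the value `u₀` at `0`, and its Scarpi
derivative is given by a convergent integral and equals `-lam * u t` at every `t > 0`. -/
structure IsSolution (α : ℝ → ℝ) (lam u₀ : ℝ) (u : ℝ → ℝ) : Prop where
  absolutelyContinuous : ∀ T : ℝ, 0 < T → AbsolutelyContinuousOnInterval u 0 T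
  initial : u 0 = u₀
  integrable : ∀ t : ℝ, 0 < t →
    IntervalIntegrable (fun τ => kernel α (t - τ) * deriv u τ) volume 0 t
  equation : ∀ t : ℝ, 0 < t → scarpiDeriv α u t = -lam * u t

/-- The exponential transition function. -/
def expTransition (α₁ α₂ c : ℝ) (t : ℝ) : ℝ :=
  α₂ + (α₁ - α₂) * Real.exp (-c * t)

/-- The analytic expression of the Laplace transform of the exponential transition function. -/
def expA (α₁ α₂ c : ℝ) (s : ℂ) : ℂ :=
  (α₁ * s + α₂ * c) / (s * (s + c))

/-- The denominator `s ^ (s A(s)) + lam`. -/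
def denom (α₁ α₂ c lam : ℝ) (s : ℂ) : ℂ :=
  s ^ (s * expA α₁ α₂ c s) + lam

/-- The Laplace transform `s ^ (s A(s) - 1) / (s ^ (s A(s)) + lam)` of the solution with initial
value `1`, as a meromorphic function on the plane cut along `(-∞, 0]`. -/
def solutionTransform (α₁ α₂ c lam : ℝ) (s : ℂ) : ℂ :=
  kernelTransform (expA α₁ α₂ c) s / denom α₁ α₂ c lam s

/-- The poles of `solutionTransform`. -/
def poles (α₁ α₂ c lam : ℝ) : Set ℂ :=
  {s | s ∈ Complex.slitPlane ∧ denom α₁ α₂ c lam s = 0}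

/-- The interior of the contour `Γ`: to the left of the vertical line `Re s = s₀`, between the
segments `Im s = ± R` when `Re s ≥ 0`, inside the circle of radius `R` when `Re s ≤ 0`, outside
the circle of radius `ε` about `0`, and off the branch cut `(-∞, 0]`. -/
def contourInterior (s₀ R ε : ℝ) : Set ℂ :=
  {s | s ∈ Complex.slitPlane ∧ s.re < s₀ ∧ ε < ‖s‖ ∧
    (0 ≤ s.re → |s.im| < R) ∧ (s.re ≤ 0 → ‖s‖ < R)}

/-- The residue at an isolated singularity `z`: the value of `(2πi)⁻¹ ∮ f` over small positively
oriented circles about `z`. -/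
def residue (f : ℂ → ℂ) (z : ℂ) : ℂ :=
  limUnder (𝓝[>] (0 : ℝ)) fun r =>
    (2 * (Real.pi : ℂ) * Complex.I)⁻¹ * ∮ s in C(z, r), f s

/-- The residue of `solutionTransform s * e ^ (s t)` at `z`. -/
def solutionResidue (α₁ α₂ c lam t : ℝ) (z : ℂ) : ℂ :=
  residue (fun s => solutionTransform α₁ α₂ c lam s * Complex.exp (s * t)) z

/-- `2πi` times the sum of the residues inside the contour. -/
def residueTerm (α₁ α₂ c lam s₀ R ε t : ℝ) : ℂ :=
  2 * Real.pi * Complex.I *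
    ∑' z : ↥(poles α₁ α₂ c lam ∩ contourInterior s₀ R ε), solutionResidue α₁ α₂ c lam t z

/-- The exponent `(α₁ ρ - α₂ c) / (c - ρ)`. -/
def expo (α₁ α₂ c ρ : ℝ) : ℝ :=
  (α₁ * ρ - α₂ * c) / (c - ρ)

/-- The integrand of the solution formula. -/
def integrand (α₁ α₂ c lam t ρ : ℝ) : ℂ :=
  (2 * lam * Complex.I * (ρ ^ expo α₁ α₂ c ρ : ℝ) * (Real.sin (Real.pi * expo α₁ α₂ c ρ) : ℝ) *
      (Real.exp (-ρ * t) : ℝ)) /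
    (ρ * (1 + 2 * lam * ρ ^ expo α₁ α₂ c ρ * Real.cos (Real.pi * expo α₁ α₂ c ρ)
      + lam ^ 2 * ρ ^ (2 * expo α₁ α₂ c ρ)) : ℝ)

end

end Scarpi

/-!
Write `b = α₂ - α₁` and `q(s) = s A(s) = α₁ + b c / (s + c)`, so that the kernel transform is
`s ^ (q(s) - 1)` and `W(s) = s⁻¹ / (1 + λ s ^ (-q(s)))`.

*The problem itself* lives on right half-planes. There `s ^ (-q(s))` is
`s ^ (-α₁) exp (-b c log s / (s + c))`, a power times a factor that is nearly `1`; all functions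
`s ^ (-γ) exp (κ log s / (s + c))` differ from the transform of a power by a term that is integrable
along vertical lines and has a continuous inverse transform given by the Bromwich integral
(`exists_isLaplacePair_powExp`, `hasLaplaceAt_bromwich`). This yields the kernel `φ`, its partner `ψ`
with `ψ * φ = 1`, and, after expanding a geometric series to finite order, the derivative of the
solution (`exists_isLaplacePair_resolvent`, `exists_isSolution`). Uniqueness holds because
convolution with `ψ` turns the equation into the Volterra equation `u = u₀ - λ ψ * u`
(`IsSolution.volterra`, `eq_zero_of_volterra`).

*The solution formula* is not obtained by deforming the Bromwich contour. Instead the Laplace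
transform of the right-hand side is computed and found to be `u₀ W`; both sides being continuous, they
agree (`continuousOn_formula_and_hasLaplaceAt`, `IsSolution.eq_formula`). As the residue of
`W(σ) e ^ (σ t)` at `z` has the transform `(2πi)⁻¹ ∮ W(σ) / (s - σ) dσ`, and the integrand of the
formula is `e ^ (-ρ t)` times the jump of `W` across the cut (`integrand_eq_jump`), what has to be
shown is a partial fraction expansion of `W` with a Stieltjes integral over the cut
(`solutionTransform_eq_tsum`).

This expansion is the residue theorem for `W(σ) / (σ - s)` on keyhole contours (`keyhole_eq_sum`).
In the coordinate `ζ = log σ` the cut plane is the strip `|Im ζ| < π`, the two sides of the cut are its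
edges, and a keyhole contour is the boundary of a rectangle with square notches about the two points
`log c ± π i` over `-c`. On the ends of the rectangle `σ W(σ)` is exponentially close to `1` and `0`
(`exists_logTransform_ends`), so only the notches matter. At the points over `-c` the function
`Ψ = log (λ σ ^ (-q(σ)))` has simple poles (`exists_isPoleChart_logRatio`). The poles of `W`
accumulate there, being the solutions of `Ψ = (2k + 1) π i`: the `k`-th one lies at distance
`O(1/|k|)` from the pole of `Ψ`, and its residue is `O(k⁻²)`, so the residues are summable
(`exists_summable_bound`). There are arbitrarily small squares on which `Ψ` keeps a fixed distance
from all odd multiples of `π i`, by comparing the length of an interval of radii with the total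
length of the bad ones (`IsPoleChart.exists_good_radius`); on these squares `σ W(σ)` is bounded, and
the contribution of the notches tends to `0` with their size.

All the poles lie in an annulus about the origin (`exists_norm_bounds_poles`). Hence the contour
encloses every one of them once `R` is large and `ε` small, and the residue sum in the formula is the
sum over all poles.

*The integrand* is controlled by the modulus `λ ρ ^ p(ρ)`. Unless `c = 1` and `λ e ^ b = 1`, it stays
away from `1` near `ρ = c`, which bounds the integrand (`exists_norm_integrand_le_near`). In the
degenerate case its logarithm vanishes at `c` to first order while the phase `π p(ρ)` runs to
infinity. There the imaginary part of `1 / (1 + e ^ w)` is estimated by the geometric mean of bounds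
in terms of `Re w` and of the phase (`abs_im_inv_one_add_exp_le`), and the resulting majorant, with its
inverse square root singularities accumulating at `c`, is integrable
(`integrableOn_rpow_mul_inv_sqrt_abs_cos`).
-/

namespace Scarpi

noncomputable section

/-! ### The Laplace transform of complex-valued functions on `(0, ∞)` -/

/-- The Laplace integral of `f` at `s` converges absolutely and has the value `F`. -/
def HasLaplaceAt (f : ℝ → ℂ) (s F : ℂ) : Prop :=
  IntegrableOn (fun t : ℝ => Complex.exp (-s * (t : ℂ)) * f t) (Ioi 0) ∧
    ∫ t in Ioi (0 : ℝ), Complex.exp (-s * (t : ℂ)) * f t = F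

lemma norm_exp_neg_mul (s : ℂ) (t : ℝ) :
    ‖Complex.exp (-s * (t : ℂ))‖ = Real.exp (-s.re * t) := by
  rw [Complex.norm_exp]; simp

lemma HasLaplaceAt.add {f g : ℝ → ℂ} {s F G : ℂ} (hf : HasLaplaceAt f s F)
    (hg : HasLaplaceAt g s G) : HasLaplaceAt (fun t => f t + g t) s (F + G) := by
  refine ⟨?_, ?_⟩
  · simp only [mul_add]
    exact hf.1.add hg.1
  · simp only [mul_add]
    rw [integral_add hf.1 hg.1, hf.2, hg.2]

lemma HasLaplaceAt.const_mul {f : ℝ → ℂ} {s F : ℂ} (k : ℂ) (hf : HasLaplaceAt f s F) :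
    HasLaplaceAt (fun t => k * f t) s (k * F) := by
  have : ∀ t : ℝ, Complex.exp (-s * (t : ℂ)) * (k * f t) =
      k * (Complex.exp (-s * (t : ℂ)) * f t) := fun t => by ring
  refine ⟨?_, ?_⟩
  · simp only [this]
    exact hf.1.const_mul k
  · simp only [this]
    rw [integral_const_mul, hf.2]

lemma HasLaplaceAt.congr {f g : ℝ → ℂ} {s F : ℂ} (hf : HasLaplaceAt f s F)
    (h : EqOn f g (Ioi 0)) : HasLaplaceAt g s F := by
  have h' : EqOn (fun t : ℝ => Complex.exp (-s * (t : ℂ)) * f t)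
      (fun t : ℝ => Complex.exp (-s * (t : ℂ)) * g t) (Ioi 0) := fun t ht => by
    simp only [h ht]
  exact ⟨hf.1.congr_fun h' measurableSet_Ioi,
    (setIntegral_congr_fun measurableSet_Ioi h').symm.trans hf.2⟩

lemma HasLaplaceAt.sub {f g : ℝ → ℂ} {s F G : ℂ} (hf : HasLaplaceAt f s F)
    (hg : HasLaplaceAt g s G) : HasLaplaceAt (fun t => f t - g t) s (F - G) := by
  have := hf.add (hg.const_mul (-1))
  simpa [sub_eq_add_neg] using this

/-- The Laplace transform turns the convolution on `(0, ∞)` into a product. -/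
lemma HasLaplaceAt.convolution {f g : ℝ → ℂ} {s F G : ℂ} (hf : HasLaplaceAt f s F)
    (hg : HasLaplaceAt g s G) :
    HasLaplaceAt (fun t => ∫ τ in (0 : ℝ)..t, f τ * g (t - τ)) s (F * G) := by
  have key : ∀ t : ℝ, ∫ τ in (0 : ℝ)..t, (ContinuousLinearMap.mul ℝ ℂ)
      (Complex.exp (-s * (τ : ℂ)) * f τ) (Complex.exp (-s * ((t - τ : ℝ) : ℂ)) * g (t - τ)) =
      Complex.exp (-s * (t : ℂ)) * ∫ τ in (0 : ℝ)..t, f τ * g (t - τ) := by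
    intro t
    rw [← intervalIntegral.integral_const_mul]
    congr 1
    ext τ
    have : Complex.exp (-s * (t : ℂ)) =
        Complex.exp (-s * (τ : ℂ)) * Complex.exp (-s * ((t - τ : ℝ) : ℂ)) := by
      rw [← Complex.exp_add]; congr 1; push_cast; ring
    rw [this, ContinuousLinearMap.mul_apply']
    ring
  refine ⟨?_, ?_⟩
  · have := (integrable_posConvolution hf.1 hg.1 (ContinuousLinearMap.mul ℝ ℂ)).integrableOn
      (s := Ioi 0)
    refine this.congr_fun (fun t ht => ?_) measurableSet_Ioi
    simp only [posConvolution, indicator_of_mem ht]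
    exact key t
  · have := integral_posConvolution hf.1 hg.1 (ContinuousLinearMap.mul ℝ ℂ)
    rw [hf.2, hg.2, ContinuousLinearMap.mul_apply'] at this
    rw [← this]
    exact setIntegral_congr_fun measurableSet_Ioi fun t _ => (key t).symm

/-- A function whose Laplace transform vanishes on a vertical line is zero at its points of
continuity, by Fourier inversion. -/
lemma eq_zero_of_hasLaplaceAt {f : ℝ → ℂ} (a : ℝ)
    (h : ∀ s : ℂ, s.re = a → HasLaplaceAt f s 0) {t : ℝ} (ht : 0 < t) (hf : ContinuousAt f t) :
    f t = 0 := by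
  set g : ℝ → ℂ := indicator (Ioi 0) fun t => Complex.exp (-(a : ℂ) * (t : ℂ)) * f t with hg
  have hgi : Integrable g := (integrable_indicator_iff measurableSet_Ioi).2 (h a (by simp)).1
  have hF : FourierTransform.fourier g = fun _ => (0 : ℂ) := by
    ext w
    rw [Real.fourier_real_eq_integral_exp_smul]
    have : ∀ v : ℝ, Complex.exp (↑(-2 * Real.pi * v * w) * Complex.I) • g v =
        indicator (Ioi 0) (fun t : ℝ =>
          Complex.exp (-((a : ℂ) + 2 * Real.pi * w * Complex.I) * (t : ℂ)) * f t) v := by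
      intro v
      by_cases hv : v ∈ Ioi (0 : ℝ)
      · rw [hg, indicator_of_mem hv, indicator_of_mem hv, smul_eq_mul, ← mul_assoc,
          ← Complex.exp_add]
        congr 2
        push_cast; ring
      · rw [hg, indicator_of_notMem hv, indicator_of_notMem hv, smul_zero]
    simp only [this]
    rw [integral_indicator measurableSet_Ioi]
    exact (h _ (by simp)).2
  have ht' : t ∈ Ioi (0 : ℝ) := ht
  have hc : ContinuousAt g t := by
    have h1 : ContinuousAt (fun t : ℝ => Complex.exp (-(a : ℂ) * (t : ℂ)) * f t) t :=
      (by fun_prop : Continuous fun t : ℝ => Complex.exp (-(a : ℂ) * (t : ℂ))).continuousAt.mul hf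
    refine h1.congr ?_
    filter_upwards [Ioi_mem_nhds ht] with x hx
    rw [hg, indicator_of_mem hx]
  have := hgi.fourierInv_fourier_eq (by rw [hF]; exact integrable_zero _ _ _) hc
  rw [hF, Real.fourierInv_eq] at this
  simp only [smul_zero, integral_zero] at this
  rw [hg, indicator_of_mem ht'] at this
  simpa using this.symm

lemma eqOn_of_hasLaplaceAt {f g : ℝ → ℂ} (hf : ContinuousOn f (Ioi 0))
    (hg : ContinuousOn g (Ioi 0)) (a : ℝ) (F : ℂ → ℂ)
    (hfF : ∀ s : ℂ, s.re = a → HasLaplaceAt f s (F s))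
    (hgF : ∀ s : ℂ, s.re = a → HasLaplaceAt g s (F s)) : EqOn f g (Ioi 0) := fun t ht =>
  sub_eq_zero.1 <| eq_zero_of_hasLaplaceAt (f := fun t => f t - g t) a
    (fun s hs => by simpa using (hfF s hs).sub (hgF s hs)) ht
    ((hf.sub hg).continuousAt (Ioi_mem_nhds ht))

/-! ### Functions with an integrable power singularity at `0` and exponential growth -/

/-- `f` is continuous on `(0, ∞)` and bounded there by `C t ^ (γ - 1) e ^ (M t)` with
`0 < γ ≤ 1`. -/
def PowerExpBound (f : ℝ → ℝ) (γ C M : ℝ) : Prop :=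
  ContinuousOn f (Ioi 0) ∧ 0 < γ ∧ γ ≤ 1 ∧ 0 ≤ C ∧
    ∀ t : ℝ, 0 < t → |f t| ≤ C * t ^ (γ - 1) * Real.exp (M * t)

lemma PowerExpBound.integrableOn_laplace {f : ℝ → ℝ} {γ C M : ℝ} (hf : PowerExpBound f γ C M)
    {s : ℂ} (hs : M < s.re) :
    IntegrableOn (fun t : ℝ => Complex.exp (-s * (t : ℂ)) * (f t : ℂ)) (Ioi 0) := by
  obtain ⟨hc, hγ, hγ1, hC, hb⟩ := hf
  have h1 := (integrableOn_rpow_mul_exp_neg_mul_rpow (s := γ - 1) (p := 1) (b := s.re - M)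
    (by linarith) one_pos (by linarith)).const_mul C
  refine Integrable.mono' h1 ?_ ?_
  · refine ContinuousOn.aestronglyMeasurable ?_ measurableSet_Ioi
    exact (by fun_prop : Continuous fun t : ℝ => Complex.exp (-s * (t : ℂ))).continuousOn.mul
      (Complex.continuous_ofReal.comp_continuousOn hc)
  · refine (ae_restrict_iff' measurableSet_Ioi).2 (Eventually.of_forall fun t ht => ?_)
    rw [norm_mul, norm_exp_neg_mul, Complex.norm_real, Real.norm_eq_abs, Real.rpow_one]
    calc Real.exp (-s.re * t) * |f t|
        ≤ Real.exp (-s.re * t) * (C * t ^ (γ - 1) * Real.exp (M * t)) := by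
          gcongr; exact hb t ht
      _ = C * (t ^ (γ - 1) * Real.exp (-(s.re - M) * t)) := by
          rw [show -(s.re - M) * t = -s.re * t + M * t by ring, Real.exp_add]; ring

lemma PowerExpBound.mono {f : ℝ → ℝ} {γ C M γ' C' M' : ℝ} (hf : PowerExpBound f γ C M)
    (hγ' : 0 < γ') (h : γ' ≤ γ) (hC : C ≤ C') (hM : M + (γ - γ') ≤ M') :
    PowerExpBound f γ' C' M' := by
  obtain ⟨hc, hγ, hγ1, hC0, hb⟩ := hf
  refine ⟨hc, hγ', by linarith, by linarith, fun t ht => (hb t ht).trans ?_⟩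
  -- `t ^ (γ - γ') ≤ e ^ ((γ - γ') t)` since `log t ≤ t`
  have h1 : t ^ (γ - γ') ≤ Real.exp ((γ - γ') * t) := by
    rw [Real.rpow_def_of_pos ht]
    apply Real.exp_le_exp.2
    have := Real.log_le_sub_one_of_pos ht
    nlinarith
  have h2 : t ^ (γ - 1) = t ^ (γ' - 1) * t ^ (γ - γ') := by
    rw [← Real.rpow_add ht]; congr 1; ring
  have h3 : 0 < t ^ (γ' - 1) := Real.rpow_pos_of_pos ht _
  have h4 : 0 ≤ C' := hC0.trans hC
  calc C * t ^ (γ - 1) * Real.exp (M * t)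
      ≤ C' * (t ^ (γ' - 1) * Real.exp ((γ - γ') * t)) * Real.exp (M * t) := by
        rw [h2]; gcongr
    _ = C' * t ^ (γ' - 1) * Real.exp ((M + (γ - γ')) * t) := by
        rw [add_mul, Real.exp_add]; ring
    _ ≤ _ := by gcongr

lemma PowerExpBound.add {f g : ℝ → ℝ} {γ C M C' : ℝ} (hf : PowerExpBound f γ C M)
    (hg : PowerExpBound g γ C' M) : PowerExpBound (fun t => f t + g t) γ (C + C') M := by
  obtain ⟨hc, hγ, hγ1, hC0, hb⟩ := hf
  obtain ⟨hc', _, _, hC0', hb'⟩ := hg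
  refine ⟨hc.add hc', hγ, hγ1, by linarith, fun t ht => (abs_add_le _ _).trans ?_⟩
  linarith [hb t ht, hb' t ht]

lemma PowerExpBound.const_mul {f : ℝ → ℝ} {γ C M : ℝ} (k : ℝ) (hf : PowerExpBound f γ C M) :
    PowerExpBound (fun t => k * f t) γ (|k| * C) M := by
  obtain ⟨hc, hγ, hγ1, hC0, hb⟩ := hf
  refine ⟨continuousOn_const.mul hc, hγ, hγ1, by positivity, fun t ht => ?_⟩
  rw [abs_mul, mul_assoc, mul_assoc]
  gcongr
  rw [← mul_assoc]
  exact hb t ht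

lemma intervalIntegrable_beta {a b : ℝ} (ha : 0 < a) (hb : 0 < b) :
    IntervalIntegrable (fun x : ℝ => x ^ (a - 1) * (1 - x) ^ (b - 1)) volume 0 1 := by
  have h := (Complex.betaIntegral_convergent (u := a) (v := b) (by simpa) (by simpa)).norm
  rw [intervalIntegrable_iff_integrableOn_Ioo_of_le zero_le_one] at h ⊢
  refine h.congr_fun (fun x hx => ?_) measurableSet_Ioo
  have h1 : (0 : ℝ) < 1 - x := by linarith [hx.2]
  have e1 : ‖(x : ℂ) ^ ((a : ℂ) - 1)‖ = x ^ (a - 1) := by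
    rw [Complex.norm_cpow_eq_rpow_re_of_pos hx.1]; simp
  have e2 : ‖(1 - (x : ℂ)) ^ ((b : ℂ) - 1)‖ = (1 - x) ^ (b - 1) := by
    rw [show (1 - (x : ℂ)) = ((1 - x : ℝ) : ℂ) by push_cast; ring,
      Complex.norm_cpow_eq_rpow_re_of_pos h1]; simp
  simp only [norm_mul, e1, e2]

lemma PowerExpBound.abs_mul_le {f g : ℝ → ℝ} {γ C M γ' C' M' : ℝ} (hf : PowerExpBound f γ C M)
    (hg : PowerExpBound g γ' C' M') {t x : ℝ} (ht : 0 < t) (hx : x ∈ Ioo (0 : ℝ) 1) :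
    |f (t * x) * g (t * (1 - x))| ≤
      (C * C' * t ^ (γ + γ' - 2) * Real.exp ((|M| + |M'|) * t)) *
        (x ^ (γ - 1) * (1 - x) ^ (γ' - 1)) := by
  obtain ⟨hc, hγ, hγ1, hC0, hb⟩ := hf
  obtain ⟨hc', hγ', hγ1', hC0', hb'⟩ := hg
  have h1 : (0 : ℝ) < 1 - x := by linarith [hx.2]
  have h0 := hx.1
  have hx1 := hx.2
  have a1 := hb (t * x) (by positivity)
  have a2 := hb' (t * (1 - x)) (by positivity)
  rw [Real.mul_rpow ht.le h0.le] at a1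
  rw [Real.mul_rpow ht.le h1.le] at a2
  have e1 : M * (t * x) ≤ |M| * t :=
    (le_abs_self _).trans (by
      rw [abs_mul, abs_of_pos (by positivity : 0 < t * x)]
      gcongr
      nlinarith)
  have e2 : M' * (t * (1 - x)) ≤ |M'| * t :=
    (le_abs_self _).trans (by
      rw [abs_mul, abs_of_pos (by positivity : 0 < t * (1 - x))]
      gcongr
      nlinarith)
  have e3 : t ^ (γ + γ' - 2) = t ^ (γ - 1) * t ^ (γ' - 1) := by
    rw [← Real.rpow_add ht]; congr 1; ring
  rw [abs_mul]
  calc |f (t * x)| * |g (t * (1 - x))|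
      ≤ (C * (t ^ (γ - 1) * x ^ (γ - 1)) * Real.exp (|M| * t)) *
        (C' * (t ^ (γ' - 1) * (1 - x) ^ (γ' - 1)) * Real.exp (|M'| * t)) := by
        gcongr
        · exact a1.trans (by gcongr)
        · exact a2.trans (by gcongr)
    _ = _ := by rw [e3, add_mul, Real.exp_add]; ring

lemma PowerExpBound.intervalIntegrable_unit {f g : ℝ → ℝ} {γ C M γ' C' M' : ℝ}
    (hf : PowerExpBound f γ C M) (hg : PowerExpBound g γ' C' M') {t : ℝ} (ht : 0 < t) :
    IntervalIntegrable (fun x => f (t * x) * g (t * (1 - x))) volume 0 1 := by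
  have hβ := (intervalIntegrable_beta hf.2.1 hg.2.1).const_mul
    (C * C' * t ^ (γ + γ' - 2) * Real.exp ((|M| + |M'|) * t))
  rw [intervalIntegrable_iff_integrableOn_Ioo_of_le zero_le_one] at hβ ⊢
  refine Integrable.mono' hβ ?_ ?_
  · refine ContinuousOn.aestronglyMeasurable ?_ measurableSet_Ioo
    refine (hf.1.comp (by fun_prop) fun x hx => ?_).mul (hg.1.comp (by fun_prop) fun x hx => ?_)
    · exact mul_pos ht hx.1
    · exact mul_pos ht (by linarith [hx.2])
  · refine (ae_restrict_iff' measurableSet_Ioo).2 (Eventually.of_forall fun x hx => ?_)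
    exact hf.abs_mul_le hg ht hx

lemma integral_convolution_eq_unit (f g : ℝ → ℝ) (t : ℝ) :
    ∫ τ in (0 : ℝ)..t, f τ * g (t - τ) = t * ∫ x in (0 : ℝ)..1, f (t * x) * g (t * (1 - x)) := by
  have := intervalIntegral.mul_integral_comp_mul_left (a := 0) (b := 1) (c := t)
    (f := fun τ => f τ * g (t - τ))
  simp only [mul_zero, mul_one] at this
  rw [← this]
  congr 2
  ext x
  rw [show t - t * x = t * (1 - x) by ring]

lemma PowerExpBound.intervalIntegrable_convolution {f g : ℝ → ℝ} {γ C M γ' C' M' : ℝ}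
    (hf : PowerExpBound f γ C M) (hg : PowerExpBound g γ' C' M') {t : ℝ} (ht : 0 < t) :
    IntervalIntegrable (fun τ => f τ * g (t - τ)) volume 0 t := by
  have h := (hf.intervalIntegrable_unit hg ht).comp_mul_left (c := t⁻¹)
  have e : (1 : ℝ) / t⁻¹ = t := by simp
  rw [zero_div, e] at h
  refine h.congr fun τ _ => ?_
  have : t * (t⁻¹ * τ) = τ := by field_simp
  simp only [this, mul_sub, mul_one]

/-- The convolution of two functions with integrable power singularities is continuous on
`(0, ∞)`: rescaled to `(0, 1)`, the integrand has a locally uniform Beta-type majorant. -/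
lemma PowerExpBound.continuousOn_convolution {f g : ℝ → ℝ} {γ C M γ' C' M' : ℝ}
    (hf : PowerExpBound f γ C M) (hg : PowerExpBound g γ' C' M') :
    ContinuousOn (fun t => ∫ τ in (0 : ℝ)..t, f τ * g (t - τ)) (Ioi 0) := by
  have h : ContinuousOn (fun t => t * ∫ x in (0 : ℝ)..1, f (t * x) * g (t * (1 - x)))
      (Ioi 0) := by
    refine continuousOn_id.mul fun t₀ ht₀ => ContinuousAt.continuousWithinAt ?_
    have ht₀ : 0 < t₀ := ht₀
    -- the factor of the majorant that depends on `t` is continuous, hence bounded near `t₀`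
    have hK : ContinuousAt
        (fun t : ℝ => C * C' * t ^ (γ + γ' - 2) * Real.exp ((|M| + |M'|) * t)) t₀ := by
      refine ContinuousAt.mul (continuousAt_const.mul ?_) (by fun_prop)
      exact Real.continuousAt_rpow_const _ _ (Or.inl ht₀.ne')
    set K := C * C' * t₀ ^ (γ + γ' - 2) * Real.exp ((|M| + |M'|) * t₀) + 1 with hKdef
    have hK1 : ∀ᶠ t in 𝓝 t₀,
        C * C' * t ^ (γ + γ' - 2) * Real.exp ((|M| + |M'|) * t) < K :=
      hK.eventually (gt_mem_nhds (by rw [hKdef]; linarith))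
    refine intervalIntegral.continuousAt_of_dominated_interval
      (bound := fun x => K * (x ^ (γ - 1) * (1 - x) ^ (γ' - 1))) ?_ ?_ ?_ ?_
    · filter_upwards [Ioi_mem_nhds ht₀] with t ht
      rw [uIoc_of_le zero_le_one]
      exact (hf.intervalIntegrable_unit hg ht).1.aestronglyMeasurable
    · filter_upwards [Ioi_mem_nhds ht₀, hK1] with t ht hKt
      have : ∀ᵐ x : ℝ, x ≠ 1 := by simp [ae_iff]
      filter_upwards [this] with x hx1 hx
      rw [uIoc_of_le zero_le_one] at hx
      have hx' : x ∈ Ioo (0 : ℝ) 1 := ⟨hx.1, lt_of_le_of_ne hx.2 hx1⟩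
      refine (hf.abs_mul_le hg ht hx').trans ?_
      have : 0 ≤ x ^ (γ - 1) * (1 - x) ^ (γ' - 1) :=
        mul_nonneg (Real.rpow_nonneg hx'.1.le _) (Real.rpow_nonneg (by linarith [hx'.2]) _)
      gcongr
    · exact (intervalIntegrable_beta hf.2.1 hg.2.1).const_mul K
    · have : ∀ᵐ x : ℝ, x ≠ 1 := by simp [ae_iff]
      filter_upwards [this] with x hx1 hx
      rw [uIoc_of_le zero_le_one] at hx
      have hx' : x ∈ Ioo (0 : ℝ) 1 := ⟨hx.1, lt_of_le_of_ne hx.2 hx1⟩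
      have c1 : ContinuousAt f (t₀ * x) := hf.1.continuousAt (Ioi_mem_nhds (mul_pos ht₀ hx'.1))
      have c2 : ContinuousAt g (t₀ * (1 - x)) :=
        hg.1.continuousAt (Ioi_mem_nhds (mul_pos ht₀ (by linarith [hx'.2])))
      exact (ContinuousAt.comp (f := fun t => t * x) c1 (by fun_prop)).mul
        (ContinuousAt.comp (f := fun t => t * (1 - x)) c2 (by fun_prop))
  exact h.congr fun t _ => integral_convolution_eq_unit f g t

/-! ### Laplace transforms of powers -/

lemma powerExpBound_rpow {γ : ℝ} (hγ : 0 < γ) :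
    PowerExpBound (fun t => t ^ (γ - 1)) (min γ 1) 1 γ := by
  refine ⟨?_, by positivity, min_le_right _ _, zero_le_one, fun t ht => ?_⟩
  · exact fun t ht => (Real.continuousAt_rpow_const _ _ (Or.inl (ne_of_gt ht))).continuousWithinAt
  · rw [abs_of_pos (Real.rpow_pos_of_pos ht _), one_mul]
    have h1 : t ^ (γ - min γ 1) ≤ Real.exp (γ * t) := by
      rw [Real.rpow_def_of_pos ht]
      apply Real.exp_le_exp.2
      have := Real.log_le_sub_one_of_pos ht
      have h3 : 0 ≤ γ - min γ 1 := by linarith [min_le_left γ 1]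
      have h4 : 0 ≤ min γ 1 := by positivity
      nlinarith
    calc t ^ (γ - 1) = t ^ (min γ 1 - 1) * t ^ (γ - min γ 1) := by
          rw [← Real.rpow_add ht]; congr 1; ring
      _ ≤ _ := by gcongr

/-- `t ^ (γ - 1)` has the Laplace transform `Γ(γ) s ^ (-γ)`: both sides are holomorphic on the
right half-plane and agree on `(0, ∞)`. -/
lemma hasLaplaceAt_rpow {γ : ℝ} (hγ : 0 < γ) {s : ℂ} (hs : 0 < s.re) :
    HasLaplaceAt (fun t => ((t ^ (γ - 1) : ℝ) : ℂ)) s (Real.Gamma γ * s ^ (-γ : ℂ)) := by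
  have hint : ∀ s : ℂ, 0 < s.re → IntegrableOn
      (fun t : ℝ => Complex.exp (-s * (t : ℂ)) * ((t ^ (γ - 1) : ℝ) : ℂ)) (Ioi 0) := by
    intro s hs
    have h1 := (integrableOn_rpow_mul_exp_neg_mul_rpow (s := γ - 1) (p := 1) (b := s.re)
      (by linarith) one_pos hs)
    refine Integrable.mono' h1 ?_ ?_
    · refine ContinuousOn.aestronglyMeasurable ?_ measurableSet_Ioi
      exact (by fun_prop : Continuous fun t : ℝ => Complex.exp (-s * (t : ℂ))).continuousOn.mul
        (Complex.continuous_ofReal.comp_continuousOn (powerExpBound_rpow hγ).1)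
    · refine (ae_restrict_iff' measurableSet_Ioi).2 (Eventually.of_forall fun t ht => ?_)
      rw [norm_mul, norm_exp_neg_mul, Complex.norm_real, Real.norm_eq_abs, Real.rpow_one,
        abs_of_pos (Real.rpow_pos_of_pos ht _), mul_comm]
  refine ⟨hint s hs, ?_⟩
  set H : Set ℂ := {s | 0 < s.re} with hH
  have hHo : IsOpen H := isOpen_lt continuous_const Complex.continuous_re
  have hHc : IsPreconnected H := (convex_halfSpace_re_gt 0).isPreconnected
  have hd1 : DifferentiableOn ℂ (fun s : ℂ => ∫ t in Ioi (0 : ℝ),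
      Complex.exp (-s * (t : ℂ)) * ((t ^ (γ - 1) : ℝ) : ℂ)) H := by
    intro s₀ hs₀
    have hs₀ : 0 < s₀.re := hs₀
    have hε : 0 < s₀.re / 2 := by positivity
    refine (HasDerivAt.differentiableAt (f' := ∫ t in Ioi (0 : ℝ),
      -((t : ℂ) * (Complex.exp (-s₀ * (t : ℂ)) * ((t ^ (γ - 1) : ℝ) : ℂ))))
      ?_).differentiableWithinAt
    refine (hasDerivAt_integral_of_dominated_loc_of_deriv_le
      (μ := volume.restrict (Ioi 0))
      (F := fun (s : ℂ) (t : ℝ) => Complex.exp (-s * (t : ℂ)) * ((t ^ (γ - 1) : ℝ) : ℂ))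
      (bound := fun t : ℝ => t ^ γ * Real.exp (-(s₀.re / 2) * t ^ (1 : ℝ)))
      (F' := fun (s : ℂ) (t : ℝ) => -((t : ℂ) * (Complex.exp (-s * (t : ℂ)) *
        ((t ^ (γ - 1) : ℝ) : ℂ)))) (Metric.ball_mem_nhds s₀ hε)
        ?_ (hint s₀ hs₀) ?_ ?_ ?_ ?_).2
    · filter_upwards [hHo.mem_nhds hs₀] with s hs
      exact (hint s hs).aestronglyMeasurable
    · refine ContinuousOn.aestronglyMeasurable ?_ measurableSet_Ioi
      refine (Complex.continuous_ofReal.continuousOn.mul (ContinuousOn.mul (by fun_prop) ?_)).neg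
      exact Complex.continuous_ofReal.comp_continuousOn (powerExpBound_rpow hγ).1
    · refine (ae_restrict_iff' measurableSet_Ioi).2 (Eventually.of_forall fun t ht s hs => ?_)
      have ht : 0 < t := ht
      rw [norm_neg, norm_mul, norm_mul, norm_exp_neg_mul, Complex.norm_real, Complex.norm_real,
        Real.norm_eq_abs, Real.norm_eq_abs, Real.rpow_one, abs_of_pos ht,
        abs_of_pos (Real.rpow_pos_of_pos ht _)]
      have h1 : t ^ γ = t * t ^ (γ - 1) := by
        nth_rewrite 2 [← Real.rpow_one t]
        rw [← Real.rpow_add ht]; congr 1; ring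
      have h2 : s₀.re / 2 ≤ s.re := by
        have := Complex.abs_re_le_norm (s - s₀)
        rw [mem_ball_iff_norm] at hs
        have h3 := (abs_lt.1 (this.trans_lt hs)).1
        simp only [Complex.sub_re] at h3
        linarith
      rw [h1, mul_assoc, mul_comm (Real.exp _)]
      gcongr
    · exact integrableOn_rpow_mul_exp_neg_mul_rpow (by linarith) one_pos hε
    · refine Eventually.of_forall fun t s _ => ?_
      have h1 : HasDerivAt (fun s : ℂ => -s * (t : ℂ)) (-(t : ℂ)) s := by
        simpa using (hasDerivAt_id s).neg.mul_const (t : ℂ)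
      refine (h1.cexp.mul_const ((t ^ (γ - 1) : ℝ) : ℂ)).congr_deriv ?_
      ring
  have hd2 : DifferentiableOn ℂ (fun s : ℂ => (Real.Gamma γ : ℂ) * s ^ (-γ : ℂ)) H := by
    intro s hs
    have : s ∈ Complex.slitPlane := Or.inl hs
    exact ((differentiableAt_id.cpow_const this).const_mul _).differentiableWithinAt
  have heq := (hd1.analyticOnNhd hHo).eqOn_of_preconnected_of_frequently_eq
    (hd2.analyticOnNhd hHo) hHc (z₀ := 1) (by simp [hH]) ?_
  · exact heq hs
  · have hreal : ∀ r : ℝ, 0 < r → (∫ t in Ioi (0 : ℝ),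
        Complex.exp (-(r : ℂ) * (t : ℂ)) * ((t ^ (γ - 1) : ℝ) : ℂ)) =
        (Real.Gamma γ : ℂ) * (r : ℂ) ^ (-γ : ℂ) := by
      intro r hr
      have h := Real.integral_rpow_mul_exp_neg_mul_Ioi hγ hr
      have h2 : ∀ t : ℝ, Complex.exp (-(r : ℂ) * (t : ℂ)) * ((t ^ (γ - 1) : ℝ) : ℂ) =
          ((t ^ (γ - 1) * Real.exp (-(r * t)) : ℝ) : ℂ) := by
        intro t; push_cast; rw [mul_comm]; congr 2; ring
      simp only [h2]
      rw [integral_complex_ofReal, h, one_div, Real.inv_rpow hr.le, ← Real.rpow_neg hr.le,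
        mul_comm]
      push_cast [Complex.ofReal_cpow hr.le]
      rfl
    have ht : Tendsto (fun n : ℕ => ((1 + 1 / ((n : ℝ) + 1) : ℝ) : ℂ)) atTop (𝓝[≠] 1) := by
      refine tendsto_nhdsWithin_iff.2 ⟨?_, Eventually.of_forall fun n => ?_⟩
      · have := (tendsto_const_nhds (x := (1 : ℝ))).add
          (tendsto_one_div_add_atTop_nhds_zero_nat (𝕜 := ℝ))
        rw [add_zero] at this
        exact_mod_cast (Complex.continuous_ofReal.tendsto 1).comp this
      · have : (0 : ℝ) < 1 / ((n : ℝ) + 1) := by positivity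
        simp only [mem_compl_iff, mem_singleton_iff]
        norm_cast
        simp
        positivity
    refine ht.frequently (Frequently.of_forall fun n => ?_)
    exact hreal _ (by positivity)

/-! ### Bromwich integrals -/

/-- The point of height `y` on the vertical line `Re s = a`. -/
def vline (a y : ℝ) : ℂ := a + y * Complex.I

@[simp] lemma vline_re (a y : ℝ) : (vline a y).re = a := by simp [vline]

@[simp] lemma vline_im (a y : ℝ) : (vline a y).im = y := by simp [vline]

@[fun_prop] lemma continuous_vline (a : ℝ) : Continuous (vline a) := by
  unfold vline; fun_prop

/-- The Bromwich integral of `F` along `Re s = a`. -/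
def bromwich (F : ℂ → ℂ) (a t : ℝ) : ℂ :=
  (2 * Real.pi : ℂ)⁻¹ * ∫ y : ℝ, F (vline a y) * Complex.exp (vline a y * t)

lemma integrable_vline {F : ℂ → ℂ} {a C δ : ℝ} (ha : 1 ≤ a) (hδ : 0 < δ)
    (hF : ∀ s : ℂ, a ≤ s.re → DifferentiableAt ℂ F s)
    (hb : ∀ s : ℂ, a ≤ s.re → ‖F s‖ ≤ C * ‖s‖ ^ (-(1 + δ))) :
    Integrable fun y : ℝ => F (vline a y) := by
  have h1 : Integrable fun y : ℝ => (1 + ‖y‖) ^ (-(1 + δ)) :=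
    integrable_one_add_norm (by simp; linarith)
  have hC : 0 ≤ C := by
    have h := (norm_nonneg _).trans (hb (a : ℂ) (by simp))
    have : 0 < ‖(a : ℂ)‖ := by simp; linarith
    exact nonneg_of_mul_nonneg_left h (Real.rpow_pos_of_pos this _)
  refine (h1.const_mul (C * 2 ^ (1 + δ))).mono' ?_ (Eventually.of_forall fun y => ?_)
  · refine Continuous.aestronglyMeasurable ?_
    exact continuous_iff_continuousAt.2 fun y =>
      ContinuousAt.comp (f := vline a) (hF _ (by simp)).continuousAt (by fun_prop)
  · refine (hb _ (by simp)).trans ?_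
    rw [mul_assoc]
    gcongr
    have h2 : 1 + ‖y‖ ≤ 2 * ‖vline a y‖ := by
      have e1 := (le_abs_self _).trans (Complex.abs_re_le_norm (vline a y))
      have e2 := Complex.abs_im_le_norm (vline a y)
      simp only [vline_re, vline_im] at e1 e2
      rw [Real.norm_eq_abs]; linarith
    have h3 : (0 : ℝ) < 1 + ‖y‖ := by positivity
    have h4 : 0 < ‖vline a y‖ := by linarith
    rw [Real.rpow_neg h3.le, Real.rpow_neg h4.le, ← div_eq_mul_inv,
      le_div_iff₀ (by positivity), inv_mul_le_iff₀ (by positivity),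
      ← Real.mul_rpow h4.le zero_le_two, mul_comm _ (2 : ℝ)]
    exact Real.rpow_le_rpow h3.le h2 (by linarith)

/-- The integral along a vertical line of a function holomorphic to its right and `O(|σ|⁻²)`
there vanishes. -/
lemma integral_vline_eq_zero {D : ℂ → ℂ} {a K ρ₀ : ℝ} (hD : DifferentiableOn ℂ D {s | a ≤ s.re})
    (hK : ∀ s : ℂ, a ≤ s.re → ρ₀ ≤ ‖s‖ → ‖D s‖ ≤ K / ‖s‖ ^ 2)
    (hi : Integrable fun y : ℝ => D (vline a y)) : ∫ y : ℝ, D (vline a y) = 0 := by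
  have hKpos : 0 ≤ K := by
    have h := (norm_nonneg _).trans
      (hK ((|a| + |ρ₀| + 1 : ℝ) : ℂ) (by simp; linarith [le_abs_self a, abs_nonneg ρ₀]) (by
      rw [Complex.norm_real, Real.norm_eq_abs, abs_of_nonneg (by positivity)]
      linarith [le_abs_self ρ₀, abs_nonneg a]))
    by_contra hneg
    push Not at hneg
    have h2 : K / ‖((|a| + |ρ₀| + 1 : ℝ) : ℂ)‖ ^ 2 < 0 := by
      apply div_neg_of_neg_of_pos hneg
      have : (0 : ℝ) < |a| + |ρ₀| + 1 := by positivity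
      rw [Complex.norm_real, Real.norm_eq_abs, abs_of_pos this]
      positivity
    linarith
  -- the sides of the rectangle `[a, a + n] × [-n, n]` other than the left one
  have hrect : ∀ n : ℕ, |ρ₀| + 2 * |a| + 1 ≤ n →
      ‖∫ y : ℝ in (-(n : ℝ))..n, D (vline a y)‖ ≤ 16 * K / n := by
    intro n hn
    have hn0 : (0 : ℝ) < n := by linarith [abs_nonneg ρ₀, abs_nonneg a]
    have hnρ : ρ₀ ≤ n := by linarith [le_abs_self ρ₀, abs_nonneg a]
    have H := Complex.integral_boundary_rect_eq_zero_of_differentiableOn D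
      ((a : ℂ) + (-(n : ℝ) : ℝ) * Complex.I) (((a + n : ℝ) : ℂ) + (n : ℝ) * Complex.I)
      (hD.mono fun s hs => by
        have := hs.1
        simp at this
        exact this.1)
    simp only [Complex.add_re, Complex.ofReal_re, Complex.mul_re, Complex.I_re, mul_zero,
      Complex.ofReal_im, Complex.I_im, mul_one, sub_self, add_zero, Complex.add_im,
      Complex.mul_im, zero_add] at H
    have b1 : ∀ s : ℂ, a ≤ s.re → (n : ℝ) / 2 ≤ ‖s‖ → ρ₀ ≤ ‖s‖ → ‖D s‖ ≤ 4 * K / (n : ℝ) ^ 2 := by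
      intro s hs hns hρs
      refine (hK s hs hρs).trans ?_
      have hs0 : 0 < ‖s‖ := by linarith
      rw [div_le_div_iff₀ (by positivity) (by positivity)]
      have : ((n : ℝ) / 2) ^ 2 ≤ ‖s‖ ^ 2 := by gcongr
      nlinarith
    have e1 : ∀ σ : ℝ, |σ| = n →
        ‖∫ x : ℝ in a..(a + n), D (x + (σ : ℂ) * Complex.I)‖ ≤ 4 * K / n := by
      intro σ hσ
      have := intervalIntegral.norm_integral_le_of_norm_le_const (a := a) (b := a + n)
        (C := 4 * K / (n : ℝ) ^ 2) (f := fun x : ℝ => D (x + (σ : ℂ) * Complex.I)) (by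
        intro x hx
        rw [uIoc_of_le (by linarith)] at hx
        have hnorm : (n : ℝ) ≤ ‖(x : ℂ) + (σ : ℂ) * Complex.I‖ := by
          have := Complex.abs_im_le_norm ((x : ℂ) + (σ : ℂ) * Complex.I)
          simp at this; linarith
        exact b1 _ (by simpa using hx.1.le) (by linarith) (by linarith))
      refine this.trans (le_of_eq ?_)
      rw [add_sub_cancel_left, abs_of_pos hn0]; field_simp
    have e2 : ‖∫ y : ℝ in (-(n : ℝ))..n, D (((a + n : ℝ) : ℂ) + y * Complex.I)‖ ≤ 8 * K / n := by
      have := intervalIntegral.norm_integral_le_of_norm_le_const (a := -(n : ℝ)) (b := n)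
        (C := 4 * K / (n : ℝ) ^ 2)
        (f := fun y : ℝ => D (((a + n : ℝ) : ℂ) + y * Complex.I)) (by
        intro y hy
        have hnorm : a + n ≤ ‖((a + n : ℝ) : ℂ) + y * Complex.I‖ := by
          have := (le_abs_self _).trans
            (Complex.abs_re_le_norm (((a + n : ℝ) : ℂ) + y * Complex.I))
          simp at this; simpa using this
        have ha : -|a| ≤ a := neg_abs_le a
        exact b1 _ (by simp) (by linarith [abs_nonneg ρ₀, abs_nonneg a])
          (by linarith [le_abs_self ρ₀, abs_nonneg a]))
      refine this.trans (le_of_eq ?_)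
      rw [sub_neg_eq_add, abs_of_pos (by positivity)]; field_simp; ring
    have e3 : ∫ y : ℝ in (-(n : ℝ))..n, D (vline a y) = ∫ y : ℝ in (-(n : ℝ))..n,
        D ((a : ℂ) + y * Complex.I) := rfl
    have e4 : ‖Complex.I • ∫ y : ℝ in (-(n : ℝ))..n, D (vline a y)‖ ≤ 16 * K / n := by
      have : Complex.I • ∫ y : ℝ in (-(n : ℝ))..n, D (vline a y) =
          (∫ x : ℝ in a..(a + n), D (x + ((-(n : ℝ) : ℝ) : ℂ) * Complex.I)) -
          (∫ x : ℝ in a..(a + n), D (x + ((n : ℝ) : ℂ) * Complex.I)) +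
          Complex.I • ∫ y : ℝ in (-(n : ℝ))..n, D (((a + n : ℝ) : ℂ) + y * Complex.I) := by
        rw [e3]; linear_combination -H
      rw [this]
      refine (norm_add_le _ _).trans ?_
      have e5 := norm_sub_le (∫ x : ℝ in a..(a + n), D (x + ((-(n : ℝ) : ℝ) : ℂ) * Complex.I))
        (∫ x : ℝ in a..(a + n), D (x + ((n : ℝ) : ℂ) * Complex.I))
      have e6 := e1 (-(n : ℝ)) (by simp)
      have e7 := e1 n (by simp)
      have e8 : ‖Complex.I • ∫ y : ℝ in (-(n : ℝ))..n, D (((a + n : ℝ) : ℂ) + y * Complex.I)‖ ≤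
          8 * K / n := by rw [norm_smul, Complex.norm_I, one_mul]; exact e2
      have : 16 * K / (n : ℝ) = 4 * K / n + 4 * K / n + 8 * K / n := by ring
      linarith
    rwa [norm_smul, Complex.norm_I, one_mul] at e4
  have hlim : Tendsto (fun n : ℕ => ∫ y : ℝ in (-(n : ℝ))..n, D (vline a y)) atTop
      (𝓝 (∫ y : ℝ, D (vline a y))) :=
    intervalIntegral_tendsto_integral hi
      (tendsto_neg_atTop_atBot.comp tendsto_natCast_atTop_atTop) tendsto_natCast_atTop_atTop
  refine tendsto_nhds_unique hlim (squeeze_zero_norm' ?_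
    (tendsto_const_div_atTop_nhds_zero_nat (16 * K)))
  filter_upwards [eventually_ge_atTop ⌈|ρ₀| + 2 * |a| + 1⌉₊] with n hn
  exact hrect n (Nat.ceil_le.1 hn)

lemma integral_poisson_kernel {x : ℝ} (hx : 0 < x) (y₀ : ℝ) :
    Integrable (fun y : ℝ => (x ^ 2 + (y - y₀) ^ 2)⁻¹) ∧
      ∫ y : ℝ, (x ^ 2 + (y - y₀) ^ 2)⁻¹ = Real.pi / x := by
  have e : ∀ u : ℝ, (x ^ 2 + u ^ 2)⁻¹ = (x ^ 2)⁻¹ * (1 + (u / x) ^ 2)⁻¹ := by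
    intro u; rw [← mul_inv]; congr 1; field_simp
  constructor
  · refine Integrable.comp_sub_right (f := fun u : ℝ => (x ^ 2 + u ^ 2)⁻¹) ?_ y₀
    simp only [e]
    exact ((integrable_comp_div_iff (fun u : ℝ => (1 + u ^ 2)⁻¹) hx.ne').2
      integrable_inv_one_add_sq).const_mul _
  · rw [integral_sub_right_eq_self (fun u : ℝ => (x ^ 2 + u ^ 2)⁻¹) y₀]
    simp only [e]
    rw [integral_const_mul, Measure.integral_comp_div (fun u : ℝ => (1 + u ^ 2)⁻¹) x,
      integral_univ_inv_one_add_sq, smul_eq_mul, abs_of_pos hx]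
    field_simp

/-- Cauchy's integral formula for a half-plane. The function `2x F(s) / (σ - b)`, where `b` is the
mirror image of `s` in the line and `x` the distance of `s` to it, has the same value at `s` as
`F`, and its Cauchy integral is that of the Poisson kernel. -/
lemma integral_cauchy_halfPlane {F : ℂ → ℂ} {a C δ : ℝ} (ha : 1 ≤ a) (hδ : 0 < δ)
    (hF : ∀ s : ℂ, a ≤ s.re → DifferentiableAt ℂ F s)
    (hb : ∀ s : ℂ, a ≤ s.re → ‖F s‖ ≤ C * ‖s‖ ^ (-(1 + δ))) {s : ℂ} (hs : a < s.re) :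
    ∫ y : ℝ, F (vline a y) / (s - vline a y) = 2 * Real.pi * F s := by
  set x : ℝ := s.re - a with hx
  have hxpos : 0 < x := by rw [hx]; linarith
  set b : ℂ := (a - x : ℝ) + s.im * Complex.I with hbdef
  have hbre : b.re = a - x := by simp [hbdef]
  have hbim : b.im = s.im := by simp [hbdef]
  have hsb : s - b = 2 * x := by
    apply Complex.ext <;> simp [hbre, hbim, hx]
    ring
  have hne_b : ∀ σ : ℂ, a ≤ σ.re → σ - b ≠ 0 := fun σ hσ h => by
    have := congrArg Complex.re h
    simp only [Complex.sub_re, hbre, Complex.zero_re] at this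
    linarith
  have hFi := integrable_vline ha hδ hF hb
  set G : ℂ → ℂ := fun σ => F σ - F s * (2 * x) / (σ - b) with hG
  have hGs : G s = 0 := by
    simp only [hG, hsb]
    have : (2 * x : ℂ) ≠ 0 := by
      have : (x : ℂ) ≠ 0 := by exact_mod_cast hxpos.ne'
      simpa using this
    rw [mul_div_cancel_right₀ _ this, sub_self]
  have hGd : DifferentiableOn ℂ G {σ | a ≤ σ.re} := fun σ hσ =>
    ((hF σ hσ).sub ((differentiableAt_const _).div (by fun_prop)
      (hne_b σ hσ))).differentiableWithinAt
  have hDd : DifferentiableOn ℂ (dslope G s) {σ | a ≤ σ.re} :=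
    (Complex.differentiableOn_dslope
      (mem_of_superset ((isOpen_lt continuous_const Complex.continuous_re).mem_nhds hs)
        fun σ (hσ : a < σ.re) => hσ.le)).2 hGd
  have hD : ∀ σ : ℂ, σ ≠ s → dslope G s σ = G σ / (σ - s) := fun σ hσ => by
    rw [dslope_of_ne _ hσ, slope_def_field, hGs, sub_zero]
  have hprod : ∀ y : ℝ, (vline a y - b) * (vline a y - s) =
      ((-(x ^ 2 + (y - s.im) ^ 2) : ℝ) : ℂ) := by
    intro y
    apply Complex.ext
    · simp only [Complex.mul_re, Complex.sub_re, Complex.sub_im, vline_re, vline_im, hbre, hbim,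
        hx, Complex.ofReal_re]
      ring
    · simp only [Complex.mul_im, Complex.sub_re, Complex.sub_im, vline_re, vline_im, hbre, hbim,
        hx, Complex.ofReal_im]
      ring
  have hvs : ∀ y : ℝ, vline a y - s ≠ 0 := fun y h => by
    have := congrArg Complex.re h
    simp at this; linarith
  have hline : ∀ y : ℝ, dslope G s (vline a y) = -(F (vline a y) / (s - vline a y)) +
      F s * (2 * x) * (((x ^ 2 + (y - s.im) ^ 2)⁻¹ : ℝ) : ℂ) := by
    intro y
    rw [hD _ (sub_ne_zero.1 (hvs y))]
    have h1 := hvs y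
    have h2 := hne_b (vline a y) (by simp)
    have h3 := hprod y
    have h4 : (((x ^ 2 + (y - s.im) ^ 2)⁻¹ : ℝ) : ℂ) =
        -((vline a y - b) * (vline a y - s))⁻¹ := by
      rw [h3]; push_cast; rw [← inv_neg]; congr 1; ring
    rw [h4, hG]
    have h5 : s - vline a y ≠ 0 := by rw [← neg_sub]; exact neg_ne_zero.2 h1
    rw [← neg_sub (vline a y) s]
    field_simp
    ring
  have hi1 : Integrable fun y : ℝ => F (vline a y) / (s - vline a y) := by
    refine (hFi.norm.div_const x).mono' ?_ (Eventually.of_forall fun y => ?_)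
    · refine hFi.aestronglyMeasurable.mul (Continuous.aestronglyMeasurable ?_)
      exact (by fun_prop : Continuous fun y => s - vline a y).inv₀ fun y h =>
        hvs y (by rw [← neg_sub, h, neg_zero])
    · rw [norm_div]
      gcongr
      have := (le_abs_self _).trans (Complex.abs_re_le_norm (s - vline a y))
      simpa [hx] using this
  have hP := integral_poisson_kernel hxpos s.im
  have hi2 : Integrable fun y : ℝ =>
      F s * (2 * x) * (((x ^ 2 + (y - s.im) ^ 2)⁻¹ : ℝ) : ℂ) := hP.1.ofReal.const_mul _
  have hzero : ∫ y : ℝ, dslope G s (vline a y) = 0 := by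
    refine integral_vline_eq_zero (K := 2 * |C| + 8 * ‖F s‖ * x)
      (ρ₀ := 2 * ‖s‖ + 2 * ‖b‖ + 1) hDd ?_ ?_
    · intro σ hσ hσn
      have hs1 : ‖σ‖ / 2 ≤ ‖σ - s‖ := by
        have := norm_sub_norm_le σ s; linarith [norm_nonneg b, norm_nonneg s]
      have hs2 : ‖σ‖ / 2 ≤ ‖σ - b‖ := by
        have := norm_sub_norm_le σ b; linarith [norm_nonneg b, norm_nonneg s]
      have h0 : 1 ≤ ‖σ‖ := by linarith [norm_nonneg b, norm_nonneg s]
      rw [hD σ (fun h => by rw [h] at hσn; linarith [norm_nonneg b, norm_nonneg s]), norm_div]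
      have hF1 : ‖F σ‖ ≤ |C| / ‖σ‖ := by
        refine (hb σ hσ).trans ?_
        have h1 : ‖σ‖ ^ (-(1 + δ)) ≤ ‖σ‖ ^ (-1 : ℝ) :=
          Real.rpow_le_rpow_of_exponent_le h0 (by linarith)
        rw [Real.rpow_neg_one] at h1
        rw [div_eq_mul_inv]
        gcongr
        exact le_abs_self C
      have hG1 : ‖G σ‖ ≤ (|C| + 4 * ‖F s‖ * x) / ‖σ‖ := by
        refine (norm_sub_le _ _).trans ?_
        rw [add_div]
        gcongr
        rw [norm_div, norm_mul, norm_mul, Complex.norm_real, Real.norm_eq_abs, abs_of_pos hxpos,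
          Complex.norm_two]
        calc ‖F s‖ * (2 * x) / ‖σ - b‖ ≤ ‖F s‖ * (2 * x) / (‖σ‖ / 2) := by gcongr
          _ = _ := by field_simp; ring
      calc ‖G σ‖ / ‖σ - s‖ ≤ ((|C| + 4 * ‖F s‖ * x) / ‖σ‖) / (‖σ‖ / 2) := by gcongr
        _ = _ := by field_simp; ring
    · simp only [hline]
      exact hi1.neg.add hi2
  simp only [hline] at hzero
  have hsum := integral_add hi1.neg hi2
  simp only [Pi.neg_apply] at hsum
  rw [hsum, integral_neg, integral_const_mul, integral_complex_ofReal, hP.2] at hzero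
  have hx0 : (x : ℂ) ≠ 0 := by exact_mod_cast hxpos.ne'
  push_cast at hzero
  field_simp at hzero
  linear_combination -hzero

/-- Inversion theorem for the Bromwich integral of a function that is holomorphic and `O(|s| ^ (-1 - δ))`
to the right of the line: by Fubini the transform is the Cauchy integral over the line. -/
lemma hasLaplaceAt_bromwich {F : ℂ → ℂ} {a C δ : ℝ} (ha : 1 ≤ a) (hδ : 0 < δ)
    (hF : ∀ s : ℂ, a ≤ s.re → DifferentiableAt ℂ F s)
    (hb : ∀ s : ℂ, a ≤ s.re → ‖F s‖ ≤ C * ‖s‖ ^ (-(1 + δ))) {s : ℂ} (hs : a < s.re) :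
    HasLaplaceAt (bromwich F a) s (F s) := by
  have hFi := integrable_vline ha hδ hF hb
  have hexp : IntegrableOn (fun t : ℝ => Real.exp (-(s.re - a) * t)) (Ioi 0) :=
    integrableOn_exp_mul_Ioi (by linarith) 0
  set H : ℝ → ℝ → ℂ := fun t y =>
    Complex.exp (-s * (t : ℂ)) * (F (vline a y) * Complex.exp (vline a y * t)) with hH
  have hHeq : ∀ t y : ℝ, H t y = Complex.exp (((vline a y - s)) * t) * F (vline a y) := by
    intro t y
    simp only [hH]
    rw [sub_mul, Complex.exp_sub, neg_mul, Complex.exp_neg]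
    field_simp
  have hint : Integrable (Function.uncurry H) ((volume.restrict (Ioi 0)).prod volume) := by
    refine (hexp.mul_prod hFi.norm).mono' ?_ (Eventually.of_forall fun p => ?_)
    · have hcF : Continuous fun p : ℝ × ℝ => F (vline a p.2) := by
        have : Continuous fun y => F (vline a y) := continuous_iff_continuousAt.2 fun y =>
          ContinuousAt.comp (f := vline a) (hF _ (by simp)).continuousAt (by fun_prop)
        exact this.comp continuous_snd
      refine Continuous.aestronglyMeasurable ?_
      simp only [Function.uncurry_def, hH]
      have hv : Continuous fun p : ℝ × ℝ => vline a p.2 := (continuous_vline a).comp continuous_snd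
      exact (by fun_prop : Continuous fun p : ℝ × ℝ => Complex.exp (-s * (p.1 : ℂ))).mul
        (hcF.mul (by fun_prop))
    · simp only [Function.uncurry_def, hHeq]
      rw [norm_mul, Complex.norm_exp]
      simp only [Complex.mul_re, Complex.sub_re, vline_re, Complex.ofReal_re, Complex.ofReal_im,
        mul_zero, sub_zero]
      rw [show -(s.re - a) * p.1 = (a - s.re) * p.1 by ring]
  have e1 : ∀ t : ℝ, Complex.exp (-s * (t : ℂ)) * bromwich F a t =
      (2 * Real.pi : ℂ)⁻¹ * ∫ y : ℝ, H t y := by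
    intro t
    rw [bromwich, hH, integral_const_mul]
    ring
  refine ⟨?_, ?_⟩
  · simp only [e1]
    exact hint.integral_prod_left.const_mul _
  · simp only [e1]
    rw [integral_const_mul, integral_integral_swap hint]
    have e2 : ∀ y : ℝ, ∫ t in Ioi (0 : ℝ), H t y = F (vline a y) / (s - vline a y) := by
      intro y
      simp only [hHeq]
      rw [integral_mul_const, integral_exp_mul_complex_Ioi (by simp; linarith)]
      simp only [Complex.ofReal_zero, mul_zero, Complex.exp_zero]
      rw [← neg_sub s (vline a y), neg_div_neg_eq]
      ring
    simp only [e2]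
    rw [integral_cauchy_halfPlane ha hδ hF hb hs]
    have : (Real.pi : ℂ) ≠ 0 := by exact_mod_cast Real.pi_ne_zero
    field_simp

lemma continuous_bromwich {F : ℂ → ℂ} {a C δ : ℝ} (ha : 1 ≤ a) (hδ : 0 < δ)
    (hF : ∀ s : ℂ, a ≤ s.re → DifferentiableAt ℂ F s)
    (hb : ∀ s : ℂ, a ≤ s.re → ‖F s‖ ≤ C * ‖s‖ ^ (-(1 + δ))) : Continuous (bromwich F a) := by
  have hFi := integrable_vline ha hδ hF hb
  refine continuous_const.mul (continuous_iff_continuousAt.2 fun t₀ => ?_)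
  refine continuousAt_of_dominated
    (bound := fun y => ‖F (vline a y)‖ * Real.exp (a * (|t₀| + 1))) ?_ ?_ ?_ ?_
  · refine Eventually.of_forall fun t => hFi.aestronglyMeasurable.mul ?_
    exact Continuous.aestronglyMeasurable (by fun_prop)
  · filter_upwards [Metric.ball_mem_nhds t₀ one_pos] with t ht
    refine Eventually.of_forall fun y => ?_
    rw [norm_mul, Complex.norm_exp]
    simp only [Complex.mul_re, vline_re, Complex.ofReal_re, Complex.ofReal_im, mul_zero, sub_zero]
    gcongr
    rw [mem_ball_iff_norm, Real.norm_eq_abs] at ht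
    linarith [(abs_lt.1 ht).2, le_abs_self t₀]
  · exact hFi.norm.mul_const _
  · exact Eventually.of_forall fun y => by fun_prop

lemma norm_bromwich_le (F : ℂ → ℂ) (a t : ℝ) :
    ‖bromwich F a t‖ ≤ (2 * Real.pi)⁻¹ * (∫ y : ℝ, ‖F (vline a y)‖) * Real.exp (a * t) := by
  rw [bromwich, norm_mul, mul_assoc]
  have e : ‖(2 * Real.pi : ℂ)⁻¹‖ = (2 * Real.pi)⁻¹ := by
    rw [norm_inv, norm_mul, Complex.norm_two, Complex.norm_real, Real.norm_eq_abs,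
      abs_of_pos Real.pi_pos]
  rw [e]
  gcongr
  refine (norm_integral_le_integral_norm _).trans (le_of_eq ?_)
  rw [← integral_mul_const]
  congr 1
  ext y
  rw [norm_mul, Complex.norm_exp]
  simp

lemma ofReal_re_bromwich {F : ℂ → ℂ} {a : ℝ}
    (hF : ∀ s : ℂ, a ≤ s.re → F ((starRingEnd ℂ) s) = (starRingEnd ℂ) (F s)) (t : ℝ) :
    ((bromwich F a t).re : ℂ) = bromwich F a t := by
  rw [← Complex.conj_eq_iff_re, bromwich, map_mul, ← integral_conj,
    ← integral_neg_eq_self (fun y : ℝ => F (vline a y) * Complex.exp (vline a y * t))]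
  congr 1
  · simp only [map_inv₀, map_mul, Complex.conj_ofReal, map_ofNat]
  · congr 1
    ext y
    have hv : vline a (-y) = (starRingEnd ℂ) (vline a y) := by
      apply Complex.ext <;> simp
    rw [hv, hF _ (by simp), map_mul, ← Complex.exp_conj]
    simp

/-! ### Inverse Laplace transforms of the kernels -/

/-- `F` is the Laplace transform of `f` on some right half-plane, and `f` is continuous on
`(0, ∞)` with at most an integrable power singularity at `0` and exponential growth at `∞`. -/
def IsLaplacePair (f : ℝ → ℝ) (F : ℂ → ℂ) : Prop :=
  ∃ γ C M : ℝ, PowerExpBound f γ C M ∧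
    ∀ s : ℂ, M < s.re → HasLaplaceAt (fun t => (f t : ℂ)) s (F s)

lemma IsLaplacePair.congr {f : ℝ → ℝ} {F G : ℂ → ℂ} (h : IsLaplacePair f F) (a : ℝ)
    (hFG : ∀ s : ℂ, a < s.re → F s = G s) : IsLaplacePair f G := by
  obtain ⟨γ, C, M, hb, hL⟩ := h
  refine ⟨γ, C, max M a, hb.mono hb.2.1 le_rfl le_rfl (by simp), fun s hs => ?_⟩
  rw [← hFG s ((le_max_right _ _).trans_lt hs)]
  exact hL s ((le_max_left _ _).trans_lt hs)

lemma IsLaplacePair.add {f g : ℝ → ℝ} {F G : ℂ → ℂ} (hf : IsLaplacePair f F)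
    (hg : IsLaplacePair g G) : IsLaplacePair (fun t => f t + g t) (fun s => F s + G s) := by
  obtain ⟨γ, C, M, hb, hL⟩ := hf
  obtain ⟨γ', C', M', hb', hL'⟩ := hg
  have h1 := hb.mono (γ' := min γ γ') (lt_min hb.2.1 hb'.2.1) (min_le_left _ _) le_rfl
    (M' := max M M' + 1)
    (by linarith [le_max_left M M', lt_min hb.2.1 hb'.2.1, hb.2.2.1])
  have h2 := hb'.mono (γ' := min γ γ') (lt_min hb.2.1 hb'.2.1) (min_le_right _ _) le_rfl
    (M' := max M M' + 1)
    (by linarith [le_max_right M M', lt_min hb.2.1 hb'.2.1, hb'.2.2.1])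
  refine ⟨_, _, _, h1.add h2, fun s hs => ?_⟩
  have := (hL s (by linarith [le_max_left M M'])).add (hL' s (by linarith [le_max_right M M']))
  simpa using this

lemma IsLaplacePair.const_mul {f : ℝ → ℝ} {F : ℂ → ℂ} (k : ℝ) (hf : IsLaplacePair f F) :
    IsLaplacePair (fun t => k * f t) (fun s => k * F s) := by
  obtain ⟨γ, C, M, hb, hL⟩ := hf
  refine ⟨_, _, _, hb.const_mul k, fun s hs => ?_⟩
  simpa using (hL s hs).const_mul (k : ℂ)

/-- A function that is holomorphic, `O(|s| ^ (-1 - δ))` and symmetric under conjugation on a right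
half-plane is the Laplace transform of a real function, its Bromwich integral. -/
lemma exists_isLaplacePair_of_decay {F : ℂ → ℂ} {a C δ : ℝ} (ha : 1 ≤ a) (hδ : 0 < δ)
    (hF : ∀ s : ℂ, a ≤ s.re → DifferentiableAt ℂ F s)
    (hb : ∀ s : ℂ, a ≤ s.re → ‖F s‖ ≤ C * ‖s‖ ^ (-(1 + δ)))
    (hconj : ∀ s : ℂ, a ≤ s.re → F ((starRingEnd ℂ) s) = (starRingEnd ℂ) (F s)) :
    ∃ f, IsLaplacePair f F := by
  refine ⟨fun t => (bromwich F a t).re, 1, (2 * Real.pi)⁻¹ * ∫ y : ℝ, ‖F (vline a y)‖, a,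
    ⟨?_, one_pos, le_rfl, ?_, fun t _ => ?_⟩, fun s hs => ?_⟩
  · exact (Complex.continuous_re.comp (continuous_bromwich ha hδ hF hb)).continuousOn
  · exact mul_nonneg (by positivity) (integral_nonneg fun _ => norm_nonneg _)
  · refine (Complex.abs_re_le_norm _).trans ?_
    simpa using norm_bromwich_le F a t
  · simp only [ofReal_re_bromwich hconj]
    exact hasLaplaceAt_bromwich ha hδ hF hb hs

/-- The function `s ^ (-γ) exp (κ log s / (s + c))`, of which the Scarpi kernel and the transform of
its Sonine partner are special cases. -/
def powExp (γ κ c : ℝ) (s : ℂ) : ℂ :=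
  Complex.exp (-γ * Complex.log s + κ * Complex.log s / (s + c))

lemma powExp_mul (γ κ γ' κ' c : ℝ) (s : ℂ) :
    powExp γ κ c s * powExp γ' κ' c s = powExp (γ + γ') (κ + κ') c s := by
  rw [powExp, powExp, powExp, ← Complex.exp_add]
  congr 1
  push_cast
  ring

lemma powExp_pow (γ κ c : ℝ) (n : ℕ) (s : ℂ) :
    powExp γ κ c s ^ n = powExp (n * γ) (n * κ) c s := by
  rw [powExp, powExp, ← Complex.exp_nat_mul]
  congr 1
  push_cast
  ring

lemma powExp_conj (γ κ c : ℝ) {s : ℂ} (hs : 0 < s.re) :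
    powExp γ κ c ((starRingEnd ℂ) s) = (starRingEnd ℂ) (powExp γ κ c s) := by
  have h : s.arg ≠ Real.pi := fun h => by
    rw [Complex.arg_eq_pi_iff] at h; linarith [h.1]
  rw [powExp, powExp, ← Complex.exp_conj, Complex.log_conj _ h]
  simp

lemma differentiableAt_powExp (γ κ : ℝ) {c : ℝ} (hc : 0 < c) {s : ℂ} (hs : 0 < s.re) :
    DifferentiableAt ℂ (powExp γ κ c) s := by
  have h1 : s ∈ Complex.slitPlane := Or.inl hs
  have h2 : s + c ≠ 0 := fun h => by
    have := congrArg Complex.re h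
    simp at this; linarith
  unfold powExp
  exact (((Complex.differentiableAt_log h1).const_mul _).add
    (((Complex.differentiableAt_log h1).const_mul _).div (by fun_prop) h2)).cexp

lemma norm_exp_neg_mul_log (γ : ℝ) {s : ℂ} (hs : s ≠ 0) :
    ‖Complex.exp (-γ * Complex.log s)‖ = ‖s‖ ^ (-γ) := by
  rw [Complex.norm_exp, Real.rpow_def_of_pos (norm_pos_iff.2 hs)]
  congr 1
  simp [Complex.log_re]
  ring

lemma norm_log_le (s : ℂ) : ‖Complex.log s‖ ≤ |Real.log ‖s‖| + Real.pi := by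
  refine (Complex.norm_le_abs_re_add_abs_im _).trans ?_
  rw [Complex.log_re, Complex.log_im]
  gcongr
  exact Complex.abs_arg_le_pi s

/-- The exponent `κ log s / (s + c)` is `O(|s| ^ (η - 1))` on the right half-plane. -/
lemma norm_log_div_le (κ : ℝ) {c η : ℝ} (hc : 0 < c) (hη : 0 < η) {s : ℂ} (hs : 1 ≤ s.re) :
    ‖κ * Complex.log s / (s + c)‖ ≤ |κ| * (1 / η + Real.pi) * ‖s‖ ^ (η - 1) := by
  have h1 : 1 ≤ ‖s‖ := hs.trans ((le_abs_self _).trans (Complex.abs_re_le_norm s))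
  have h0 : 0 < ‖s‖ := by linarith
  have h2 : ‖s‖ ≤ ‖s + c‖ := by
    rw [Complex.norm_def, Complex.norm_def]
    apply Real.sqrt_le_sqrt
    simp [Complex.normSq_apply]
    nlinarith
  have h3 : ‖Complex.log s‖ ≤ (1 / η + Real.pi) * ‖s‖ ^ η := by
    refine (norm_log_le s).trans ?_
    rw [abs_of_nonneg (Real.log_nonneg h1), add_mul]
    have e1 := Real.log_le_rpow_div h0.le hη
    have e2 : 1 ≤ ‖s‖ ^ η := Real.one_le_rpow h1 hη.le
    have e3 : 1 / η * ‖s‖ ^ η = ‖s‖ ^ η / η := by ring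
    nlinarith [Real.pi_pos]
  rw [norm_div, norm_mul, Complex.norm_real, Real.norm_eq_abs]
  calc |κ| * ‖Complex.log s‖ / ‖s + c‖ ≤ |κ| * ((1 / η + Real.pi) * ‖s‖ ^ η) / ‖s‖ := by gcongr
    _ = _ := by rw [Real.rpow_sub_one h0.ne']; ring

/-- The factor `exp (κ log s / (s + c))` is `1 + O(|s| ^ (η - 1))` for every `η > 0`; here `η ≤ γ / 2`
and `η ≤ 1 / 2`. -/
lemma exists_powExp_sub_le {γ : ℝ} (hγ : 0 < γ) (κ : ℝ) {c : ℝ} (hc : 0 < c) :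
    ∃ a C : ℝ, 1 ≤ a ∧ ∀ s : ℂ, a ≤ s.re →
      ‖powExp γ κ c s - Complex.exp (-γ * Complex.log s)‖ ≤ C * ‖s‖ ^ (-(1 + γ / 2)) ∧
      ‖powExp γ κ c s‖ ≤ 3 * ‖s‖ ^ (-γ) := by
  set η : ℝ := min γ 1 / 2 with hηdef
  have hη : 0 < η := by positivity
  have hη1 : η ≤ 1 / 2 := by rw [hηdef]; linarith [min_le_right γ 1]
  have hη2 : η ≤ γ / 2 := by rw [hηdef]; linarith [min_le_left γ 1]
  set K : ℝ := |κ| * (1 / η + Real.pi) with hK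
  have hK0 : 0 ≤ K := by have := Real.pi_pos; positivity
  have hlim : Tendsto (fun x : ℝ => K * x ^ (η - 1)) atTop (𝓝 0) := by
    have := (tendsto_rpow_neg_atTop (y := 1 - η) (by linarith)).const_mul K
    rw [mul_zero] at this
    simpa using this
  obtain ⟨a₀, ha₀⟩ := (hlim.eventually (ge_mem_nhds one_pos)).exists_forall_of_atTop
  refine ⟨max a₀ 1, 2 * K, le_max_right _ _, fun s hs => ?_⟩
  have hs1 : 1 ≤ s.re := (le_max_right _ _).trans hs
  have hsn : s.re ≤ ‖s‖ := (le_abs_self _).trans (Complex.abs_re_le_norm s)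
  have h0 : 0 < ‖s‖ := by linarith
  have hne : s ≠ 0 := norm_pos_iff.1 h0
  have hw := norm_log_div_le κ hc hη hs1
  rw [← hK] at hw
  have hw1 := hw.trans (ha₀ ‖s‖ (((le_max_left _ _).trans hs).trans hsn))
  have hE := (Complex.norm_exp_sub_one_le hw1)
  constructor
  · rw [powExp, Complex.exp_add, ← mul_sub_one, norm_mul, norm_exp_neg_mul_log γ hne]
    calc ‖s‖ ^ (-γ) * ‖Complex.exp (κ * Complex.log s / (s + c)) - 1‖
        ≤ ‖s‖ ^ (-γ) * (2 * (K * ‖s‖ ^ (η - 1))) := by gcongr; linarith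
      _ = 2 * K * ‖s‖ ^ (-γ + (η - 1)) := by rw [Real.rpow_add h0]; ring
      _ ≤ 2 * K * ‖s‖ ^ (-(1 + γ / 2)) := by
          gcongr
          · linarith
          · linarith
  · rw [powExp, Complex.exp_add, norm_mul, norm_exp_neg_mul_log γ hne, mul_comm]
    gcongr
    have := norm_sub_norm_le (Complex.exp (κ * Complex.log s / (s + c))) 1
    rw [norm_one] at this
    linarith

/-- `powExp γ κ c` differs from the transform `s ^ (-γ)` of a power by an `O(|s| ^ (-1 - γ / 2))`
term, to which Bromwich inversion applies. -/
lemma exists_isLaplacePair_powExp {γ : ℝ} (hγ : 0 < γ) (κ : ℝ) {c : ℝ} (hc : 0 < c) :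
    ∃ f, IsLaplacePair f (powExp γ κ c) := by
  obtain ⟨a, C, ha, hb⟩ := exists_powExp_sub_le hγ κ hc
  have hslit : ∀ s : ℂ, a ≤ s.re → s ∈ Complex.slitPlane := fun s hs =>
    Or.inl (by linarith)
  obtain ⟨f, hf⟩ := exists_isLaplacePair_of_decay
    (F := fun s => powExp γ κ c s - Complex.exp (-γ * Complex.log s)) ha
    (δ := γ / 2) (by positivity)
    (fun s hs => (differentiableAt_powExp γ κ hc (by linarith)).sub
      (((Complex.differentiableAt_log (hslit s hs)).const_mul _).cexp))
    (fun s hs => (hb s hs).1)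
    (fun s hs => by
      have h : s.arg ≠ Real.pi := fun h => by
        rw [Complex.arg_eq_pi_iff] at h; linarith [h.1]
      rw [powExp_conj γ κ c (by linarith), map_sub, ← Complex.exp_conj, Complex.log_conj _ h]
      simp)
  have hp : IsLaplacePair (fun t => t ^ (γ - 1)) (fun s => Real.Gamma γ * s ^ (-γ : ℂ)) :=
    ⟨_, _, _, powerExpBound_rpow hγ, fun s hs => hasLaplaceAt_rpow hγ (by linarith)⟩
  refine ⟨_, (hf.add (hp.const_mul (Real.Gamma γ)⁻¹)).congr 0 fun s hs => ?_⟩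
  have hs0 : s ≠ 0 := fun h => by rw [h] at hs; simp at hs
  have hG : (Real.Gamma γ : ℂ) ≠ 0 := by exact_mod_cast (Real.Gamma_pos_of_pos hγ).ne'
  rw [Complex.cpow_def_of_ne_zero hs0]
  push_cast
  rw [← mul_assoc, inv_mul_cancel₀ hG, one_mul, mul_comm (Complex.log s)]
  ring

lemma exists_isLaplacePair_sum {ι : Type*} (s : Finset ι) (F : ι → ℂ → ℂ)
    (h : ∀ i ∈ s, ∃ f, IsLaplacePair f (F i)) :
    ∃ f, IsLaplacePair f (fun z => ∑ i ∈ s, F i z) := by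
  classical
  induction s using Finset.induction_on with
  | empty =>
    refine ⟨fun _ => 0, 1, 0, 0, ⟨continuousOn_const, one_pos, le_rfl, le_rfl, by simp⟩, ?_⟩
    intro s _
    simp [HasLaplaceAt]
  | insert i s hi ih =>
    obtain ⟨f, hf⟩ := ih fun j hj => h j (Finset.mem_insert_of_mem hj)
    obtain ⟨g, hg⟩ := h i (Finset.mem_insert_self _ _)
    refine ⟨_, (hg.add hf).congr 0 fun z _ => ?_⟩
    rw [Finset.sum_insert hi]

/-- The resolvent transform `X / (1 + λ X)` for `X = powExp γ κ c`: a finite geometric sum of the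
powers `X ^ k`, which are again of the form `powExp`, and an `O(|s|⁻²)` remainder. -/
lemma exists_isLaplacePair_resolvent {γ : ℝ} (hγ : 0 < γ) (κ : ℝ) {c : ℝ} (hc : 0 < c)
    (lam : ℝ) :
    ∃ f, IsLaplacePair f (fun s => powExp γ κ c s / (1 + lam * powExp γ κ c s)) := by
  obtain ⟨a, _, ha, hb⟩ := exists_powExp_sub_le hγ κ hc
  have hlim : Tendsto (fun x : ℝ => |lam| * (3 * x ^ (-γ))) atTop (𝓝 0) := by
    simpa using ((tendsto_rpow_neg_atTop hγ).const_mul 3).const_mul |lam|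
  obtain ⟨a₀, ha₀⟩ := (hlim.eventually (ge_mem_nhds one_half_pos)).exists_forall_of_atTop
  set a₁ := max a a₀ with ha₁
  have hsmall : ∀ s : ℂ, a₁ ≤ s.re → ‖(lam : ℂ) * powExp γ κ c s‖ ≤ 1 / 2 := by
    intro s hs
    have hsn : s.re ≤ ‖s‖ := (le_abs_self _).trans (Complex.abs_re_le_norm s)
    rw [norm_mul, Complex.norm_real, Real.norm_eq_abs]
    refine le_trans ?_ (ha₀ ‖s‖ (((le_max_right _ _).trans hs).trans hsn))
    gcongr
    exact (hb s ((le_max_left _ _).trans hs)).2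
  have hden : ∀ s : ℂ, a₁ ≤ s.re → 1 / 2 ≤ ‖1 + (lam : ℂ) * powExp γ κ c s‖ := by
    intro s hs
    have := norm_sub_le_norm_add (1 : ℂ) ((lam : ℂ) * powExp γ κ c s)
    rw [norm_one] at this
    linarith [hsmall s hs]
  have hden0 : ∀ s : ℂ, a₁ ≤ s.re → 1 + (lam : ℂ) * powExp γ κ c s ≠ 0 := fun s hs h => by
    have := hden s hs
    rw [h, norm_zero] at this
    linarith
  obtain ⟨n, hn⟩ := exists_nat_ge (2 / γ)
  have hn2 : 2 ≤ n * γ := by rwa [div_le_iff₀ hγ] at hn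
  obtain ⟨f, hf⟩ := exists_isLaplacePair_sum (Finset.range n)
    (fun k s => ((-lam) ^ k : ℝ) * powExp (((k + 1 : ℕ) : ℝ) * γ) (((k + 1 : ℕ) : ℝ) * κ) c s)
    (fun k _ => by
      obtain ⟨f, hf⟩ := exists_isLaplacePair_powExp (γ := ((k + 1 : ℕ) : ℝ) * γ) (by positivity)
        (((k + 1 : ℕ) : ℝ) * κ) hc
      exact ⟨_, hf.const_mul _⟩)
  have ha1 : 1 ≤ a₁ := ha.trans (le_max_left _ _)
  obtain ⟨g, hg⟩ := exists_isLaplacePair_of_decay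
    (F := fun s => ((-lam) ^ n : ℝ) * powExp γ κ c s ^ (n + 1) / (1 + lam * powExp γ κ c s))
    (a := a₁) (δ := 1) (C := |lam| ^ n * 3 ^ (n + 1) * 2) ha1 one_pos
    (fun s hs => by
      have h1 := differentiableAt_powExp γ κ hc (s := s) (by linarith)
      exact ((h1.pow (n + 1)).const_mul _).div ((h1.const_mul _).const_add _) (hden0 s hs))
    (fun s hs => by
      have hsn : s.re ≤ ‖s‖ := (le_abs_self _).trans (Complex.abs_re_le_norm s)
      have h0 : 0 < ‖s‖ := by linarith
      have h1 : ‖powExp γ κ c s ^ (n + 1)‖ ≤ 3 ^ (n + 1) * ‖s‖ ^ (-(1 + 1) : ℝ) := by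
        rw [norm_pow]
        calc ‖powExp γ κ c s‖ ^ (n + 1) ≤ (3 * ‖s‖ ^ (-γ)) ^ (n + 1) := by
              gcongr; exact (hb s ((le_max_left _ _).trans hs)).2
          _ = 3 ^ (n + 1) * ‖s‖ ^ (-γ * (n + 1 : ℕ)) := by
              rw [mul_pow, Real.rpow_mul_natCast h0.le]
          _ ≤ _ := by
              gcongr
              · linarith
              · push_cast; nlinarith
      rw [norm_div, norm_mul, Complex.norm_real, Real.norm_eq_abs, abs_pow, abs_neg,
        div_le_iff₀ (by linarith [hden s hs])]
      have h2 : 0 ≤ ‖s‖ ^ (-(1 + 1) : ℝ) := Real.rpow_nonneg h0.le _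
      calc |lam| ^ n * ‖powExp γ κ c s ^ (n + 1)‖
          ≤ |lam| ^ n * (3 ^ (n + 1) * ‖s‖ ^ (-(1 + 1) : ℝ)) := by gcongr
        _ = |lam| ^ n * 3 ^ (n + 1) * 2 * ‖s‖ ^ (-(1 + 1) : ℝ) * (1 / 2) := by ring
        _ ≤ _ := by gcongr; exact hden s hs)
    (fun s hs => by
      rw [powExp_conj γ κ c (by linarith)]
      simp)
  refine ⟨_, (hf.add hg).congr a₁ fun s hs => ?_⟩
  have h1 := hden0 s hs.le
  have h2 : ∀ k : ℕ, powExp (((k + 1 : ℕ) : ℝ) * γ) (((k + 1 : ℕ) : ℝ) * κ) c s =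
      powExp γ κ c s ^ (k + 1) := fun k => (powExp_pow γ κ c (k + 1) s).symm
  simp only [h2]
  set X := powExp γ κ c s with hX
  have h3 := mul_neg_geom_sum (-(lam : ℂ) * X) n
  have h4 : ∑ k ∈ Finset.range n, (((-lam) ^ k : ℝ) : ℂ) * X ^ (k + 1) =
      X * ∑ k ∈ Finset.range n, (-(lam : ℂ) * X) ^ k := by
    rw [Finset.mul_sum]
    refine Finset.sum_congr rfl fun k _ => ?_
    push_cast; rw [mul_pow]; ring
  have h5 : (((-lam) ^ n : ℝ) : ℂ) = (-(lam : ℂ)) ^ n := by push_cast; rfl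
  rw [h4, eq_div_iff h1, add_mul, div_mul_cancel₀ _ h1, h5]
  rw [mul_pow] at h3
  linear_combination X * h3

/-! ### The transforms of the relaxation problem on the right half-plane -/

lemma hasLaplaceAt_one {s : ℂ} (hs : 0 < s.re) : HasLaplaceAt (fun _ => 1) s s⁻¹ := by
  have := hasLaplaceAt_rpow one_pos hs
  simpa [Complex.cpow_neg_one] using this

lemma laplace_expTransition (α₁ α₂ : ℝ) {c : ℝ} (hc : 0 < c) {s : ℂ} (hs : 0 < s.re) :
    laplace (expTransition α₁ α₂ c) s = expA α₁ α₂ c s := by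
  have hs0 : s ≠ 0 := fun h => by simp [h] at hs
  have hsc : s + c ≠ 0 := fun h => by
    have := congrArg Complex.re h
    simp at this; linarith
  have h1 : ∀ t : ℝ, Complex.exp (-s * (t : ℂ)) * (expTransition α₁ α₂ c t : ℂ) =
      α₂ * Complex.exp (-s * (t : ℂ)) + (α₁ - α₂) * Complex.exp (-(s + c) * (t : ℂ)) := by
    intro t
    rw [expTransition, neg_add, add_mul, Complex.exp_add]
    push_cast
    ring
  have i1 : IntegrableOn (fun t : ℝ => Complex.exp (-s * (t : ℂ))) (Ioi 0) :=
    integrableOn_exp_mul_complex_Ioi (by simpa) 0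
  have i2 : IntegrableOn (fun t : ℝ => Complex.exp (-(s + c) * (t : ℂ))) (Ioi 0) :=
    integrableOn_exp_mul_complex_Ioi (by simp; linarith) 0
  rw [laplace]
  simp only [h1]
  rw [integral_add (i1.const_mul _) (i2.const_mul _), integral_const_mul, integral_const_mul,
    integral_exp_mul_complex_Ioi (by simpa), integral_exp_mul_complex_Ioi (by simp; linarith),
    expA]
  simp only [Complex.ofReal_zero, mul_zero, Complex.exp_zero]
  field_simp
  ring

lemma mul_expA (α₁ α₂ c : ℝ) {s : ℂ} (hs0 : s ≠ 0) (hsc : s + c ≠ 0) :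
    s * expA α₁ α₂ c s = α₁ + ((α₂ - α₁) * c : ℝ) / (s + c) := by
  rw [expA]
  push_cast
  field_simp
  ring

lemma cpow_mul_expA (α₁ α₂ c : ℝ) {s : ℂ} (hs0 : s ≠ 0) (hsc : s + c ≠ 0) :
    s ^ (s * expA α₁ α₂ c s) = powExp (-α₁) ((α₂ - α₁) * c) c s := by
  rw [Complex.cpow_def_of_ne_zero hs0, mul_expA α₁ α₂ c hs0 hsc, powExp]
  congr 1
  push_cast
  ring

lemma kernelTransform_expA (α₁ α₂ c : ℝ) {s : ℂ} (hs0 : s ≠ 0) (hsc : s + c ≠ 0) :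
    kernelTransform (expA α₁ α₂ c) s = powExp (1 - α₁) ((α₂ - α₁) * c) c s := by
  rw [kernelTransform, Complex.cpow_def_of_ne_zero hs0, mul_expA α₁ α₂ c hs0 hsc, powExp]
  congr 1
  push_cast
  ring

lemma powExp_one_zero (c : ℝ) {s : ℂ} (hs0 : s ≠ 0) : powExp 1 0 c s = s⁻¹ := by
  rw [powExp]
  simp [Complex.exp_neg, Complex.exp_log hs0]

lemma powExp_neg_neg (γ κ c : ℝ) (s : ℂ) : powExp (-γ) (-κ) c s = (powExp γ κ c s)⁻¹ := by
  rw [powExp, powExp, ← Complex.exp_neg]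
  congr 1
  push_cast
  ring

lemma powExp_ne_zero (γ κ c : ℝ) (s : ℂ) : powExp γ κ c s ≠ 0 := Complex.exp_ne_zero _

lemma solutionTransform_eq (α₁ α₂ c lam : ℝ) {s : ℂ} (hs0 : s ≠ 0) (hsc : s + c ≠ 0) :
    solutionTransform α₁ α₂ c lam s =
      s⁻¹ / (1 + lam * powExp α₁ (-((α₂ - α₁) * c)) c s) := by
  have h1 : powExp (1 - α₁) ((α₂ - α₁) * c) c s =
      s⁻¹ * (powExp α₁ (-((α₂ - α₁) * c)) c s)⁻¹ := by
    rw [← powExp_neg_neg, ← powExp_one_zero c hs0, powExp_mul]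
    congr 1
    ring
  have h2 : powExp (-α₁) ((α₂ - α₁) * c) c s = (powExp α₁ (-((α₂ - α₁) * c)) c s)⁻¹ := by
    rw [← powExp_neg_neg, neg_neg]
  rw [solutionTransform, kernelTransform_expA α₁ α₂ c hs0 hsc, denom,
    cpow_mul_expA α₁ α₂ c hs0 hsc, h1, h2]
  have h3 := powExp_ne_zero α₁ (-((α₂ - α₁) * c)) c s
  set X := powExp α₁ (-((α₂ - α₁) * c)) c s
  have h4 : X⁻¹ + lam = X⁻¹ * (1 + lam * X) := by field_simp
  rw [h4, mul_comm s⁻¹, mul_div_mul_left _ _ (inv_ne_zero h3)]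

lemma ne_zero_of_re_pos {s : ℂ} (hs : 0 < s.re) : s ≠ 0 := fun h => by simp [h] at hs

lemma add_ne_zero_of_re_pos {c : ℝ} (hc : 0 < c) {s : ℂ} (hs : 0 < s.re) : s + c ≠ 0 := fun h => by
  have := congrArg Complex.re h
  simp at this; linarith

/-! ### The Scarpi kernel -/

section Kernel

variable {α₁ α₂ c : ℝ}

lemma isInverseLaplace_of_isLaplacePair (hc : 0 < c) {f : ℝ → ℝ}
    (hf : IsLaplacePair f (powExp (1 - α₁) ((α₂ - α₁) * c) c)) :
    IsInverseLaplace (kernelTransform (laplace (expTransition α₁ α₂ c))) f := by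
  obtain ⟨γ, C, M, hb, hL⟩ := hf
  refine ⟨hb.1, max M 0, fun s hs => ?_⟩
  have hs0 : 0 < s.re := (le_max_right _ _).trans_lt hs
  have h := hL s ((le_max_left _ _).trans_lt hs)
  refine ⟨h.1, h.2.trans ?_⟩
  rw [← kernelTransform_expA α₁ α₂ c (ne_zero_of_re_pos hs0) (add_ne_zero_of_re_pos hc hs0),
    kernelTransform, kernelTransform, laplace_expTransition α₁ α₂ hc hs0]

lemma isInverseLaplace_kernel (hα₁ : α₁ < 1) (hc : 0 < c) :
    IsInverseLaplace (kernelTransform (laplace (expTransition α₁ α₂ c)))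
      (kernel (expTransition α₁ α₂ c)) := by
  obtain ⟨f, hf⟩ := exists_isLaplacePair_powExp (sub_pos.2 hα₁) ((α₂ - α₁) * c) hc
  have h : ∃ f, IsInverseLaplace (kernelTransform (laplace (expTransition α₁ α₂ c))) f :=
    ⟨f, isInverseLaplace_of_isLaplacePair hc hf⟩
  rw [kernel, inverseLaplace, dif_pos h]
  exact h.choose_spec

lemma IsInverseLaplace.eqOn {F : ℂ → ℂ} {f g : ℝ → ℝ} (hf : IsInverseLaplace F f)
    (hg : IsInverseLaplace F g) : EqOn f g (Ioi 0) := by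
  obtain ⟨hfc, a, ha⟩ := hf
  obtain ⟨hgc, b, hb⟩ := hg
  have := eqOn_of_hasLaplaceAt (Complex.continuous_ofReal.comp_continuousOn hfc)
    (Complex.continuous_ofReal.comp_continuousOn hgc) (max a b + 1) F
    (fun s hs => ha s (by linarith [le_max_left a b]))
    (fun s hs => hb s (by linarith [le_max_right a b]))
  exact fun t ht => Complex.ofReal_injective (this ht)

lemma IsLaplacePair.congr_fun {f g : ℝ → ℝ} {F : ℂ → ℂ} (hf : IsLaplacePair f F)
    (h : EqOn f g (Ioi 0)) : IsLaplacePair g F := by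
  obtain ⟨γ, C, M, ⟨hc, hγ, hγ1, hC, hb⟩, hL⟩ := hf
  refine ⟨γ, C, M, ⟨hc.congr h.symm, hγ, hγ1, hC, fun t ht => h ht ▸ hb t ht⟩,
    fun s hs => (hL s hs).congr fun t ht => by simp only [h ht]⟩

lemma isLaplacePair_kernel (hα₁ : α₁ < 1) (hc : 0 < c) :
    IsLaplacePair (kernel (expTransition α₁ α₂ c)) (powExp (1 - α₁) ((α₂ - α₁) * c) c) := by
  obtain ⟨f, hf⟩ := exists_isLaplacePair_powExp (sub_pos.2 hα₁) ((α₂ - α₁) * c) hc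
  exact hf.congr_fun
    ((isInverseLaplace_of_isLaplacePair hc hf).eqOn (isInverseLaplace_kernel hα₁ hc))

end Kernel

/-! ### Existence of the solution -/

lemma powerExpBound_one : PowerExpBound (fun _ => 1) 1 1 0 :=
  ⟨continuousOn_const, one_pos, le_rfl, zero_le_one, fun t _ => by simp⟩

lemma PowerExpBound.intervalIntegrable {f : ℝ → ℝ} {γ C M : ℝ} (hf : PowerExpBound f γ C M)
    {T : ℝ} (hT : 0 < T) : IntervalIntegrable f volume 0 T := by
  simpa using hf.intervalIntegrable_convolution powerExpBound_one hT

lemma hasLaplaceAt_ofReal_convolution {f g : ℝ → ℝ} {s F G : ℂ}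
    (hf : HasLaplaceAt (fun t => (f t : ℂ)) s F) (hg : HasLaplaceAt (fun t => (g t : ℂ)) s G) :
    HasLaplaceAt (fun t => ((∫ τ in (0 : ℝ)..t, f τ * g (t - τ) : ℝ) : ℂ)) s (F * G) := by
  have := hf.convolution hg
  simpa only [← Complex.ofReal_mul, intervalIntegral.integral_ofReal] using this

/-- The solution is `u₀ + ∫₀ᵗ v`, where `v` has the Laplace transform `-λ u₀ / (s ^ (s A(s)) + λ)`;
the equation is checked in the Laplace domain. -/
lemma exists_isSolution {α₁ α₂ c lam : ℝ} (u₀ : ℝ) (hα₁ : 0 < α₁) (hα₁' : α₁ < 1) (hc : 0 < c)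
    (hlam : 0 < lam) :
    ∃ u : ℝ → ℝ, IsSolution (expTransition α₁ α₂ c) lam u₀ u ∧
      HasLaplace u (fun s => u₀ * solutionTransform α₁ α₂ c lam s) := by
  set X : ℂ → ℂ := powExp α₁ (-((α₂ - α₁) * c)) c with hX
  obtain ⟨v₀, hv₀⟩ := exists_isLaplacePair_resolvent hα₁ (-((α₂ - α₁) * c)) hc lam
  obtain ⟨v, γ, C, M, hv, hvL⟩ : ∃ v, IsLaplacePair v
      (fun s => (-lam * u₀ : ℝ) * (X s / (1 + lam * X s))) := ⟨_, hv₀.const_mul (-lam * u₀)⟩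
  obtain ⟨γ', C', M', hk, hkL⟩ := isLaplacePair_kernel (α₂ := α₂) hα₁' hc
  obtain ⟨γ₀, C₀, M₀, hr, -⟩ := id hv₀
  set k := kernel (expTransition α₁ α₂ c) with hkdef
  set u : ℝ → ℝ := fun t => u₀ + ∫ τ in (0 : ℝ)..t, v τ with hu
  -- the denominators `1 + λ X` do not vanish far to the right
  obtain ⟨a₀, ha₀⟩ : ∃ a : ℝ, ∀ s : ℂ, a < s.re → 1 + (lam : ℂ) * X s ≠ 0 := by
    obtain ⟨a, C, ha, hb⟩ := exists_powExp_sub_le hα₁ (-((α₂ - α₁) * c)) hc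
    have hlim : Tendsto (fun x : ℝ => lam * (3 * x ^ (-α₁))) atTop (𝓝 0) := by
      simpa using ((tendsto_rpow_neg_atTop hα₁).const_mul 3).const_mul lam
    obtain ⟨a₁, ha₁⟩ := (hlim.eventually (gt_mem_nhds one_pos)).exists_forall_of_atTop
    refine ⟨max a a₁, fun s hs h => ?_⟩
    have hsn : s.re ≤ ‖s‖ := (le_abs_self _).trans (Complex.abs_re_le_norm s)
    have h1 := (hb s ((le_max_left _ _).trans hs.le)).2
    have h2 := ha₁ ‖s‖ (((le_max_right _ _).trans hs.le).trans hsn)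
    have h3 : ‖(lam : ℂ) * X s‖ < 1 := by
      rw [norm_mul, Complex.norm_real, Real.norm_eq_abs, abs_of_pos hlam]
      exact (mul_le_mul_of_nonneg_left h1 hlam.le).trans_lt h2
    have h4 : (lam : ℂ) * X s = -1 := by linear_combination h
    rw [h4, norm_neg, norm_one] at h3
    exact lt_irrefl _ h3
  set a := max (max M M') (max a₀ 0) with ha
  have hM : ∀ s : ℂ, a < s.re → M < s.re := fun s hs =>
    ((le_max_left _ _).trans (le_max_left _ _)).trans_lt hs
  have hM' : ∀ s : ℂ, a < s.re → M' < s.re := fun s hs =>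
    ((le_max_right _ _).trans (le_max_left _ _)).trans_lt hs
  have hA₀ : ∀ s : ℂ, a < s.re → a₀ < s.re := fun s hs =>
    ((le_max_left _ _).trans (le_max_right _ _)).trans_lt hs
  have h0 : ∀ s : ℂ, a < s.re → 0 < s.re := fun s hs =>
    ((le_max_right _ _).trans (le_max_right _ _)).trans_lt hs
  have huL : ∀ s : ℂ, a < s.re → HasLaplaceAt (fun t => (u t : ℂ)) s
      (u₀ * solutionTransform α₁ α₂ c lam s) := by
    intro s hs
    have hs0 := ne_zero_of_re_pos (h0 s hs)
    have h1 := (hasLaplaceAt_one (h0 s hs)).const_mul (u₀ : ℂ)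
    have h2 := hasLaplaceAt_ofReal_convolution (g := fun _ => 1) (hvL s (hM s hs))
      (by simpa using hasLaplaceAt_one (h0 s hs))
    have h3 := h1.add h2
    simp only [mul_one] at h3
    have h4 : (u₀ : ℂ) * solutionTransform α₁ α₂ c lam s =
        u₀ * s⁻¹ + (-lam * u₀ : ℝ) * (X s / (1 + lam * X s)) * s⁻¹ := by
      rw [solutionTransform_eq α₁ α₂ c lam hs0 (add_ne_zero_of_re_pos hc (h0 s hs)), ← hX]
      have := ha₀ s (hA₀ s hs)
      push_cast
      generalize X s = x at *
      rw [div_eq_mul_inv, div_eq_mul_inv]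
      linear_combination (u₀ * s⁻¹) * (mul_inv_cancel₀ this)
    rw [h4]
    refine h3.congr fun t _ => ?_
    simp [hu]
  have huc : ContinuousOn u (Ioi 0) := by
    have := hv.continuousOn_convolution powerExpBound_one
    simp only [mul_one] at this
    exact continuousOn_const.add this
  have hderiv : ∀ t : ℝ, 0 < t → deriv u t = v t := by
    intro t ht
    have h1 : HasDerivAt (fun t => ∫ τ in (0 : ℝ)..t, v τ) (v t) t :=
      intervalIntegral.integral_hasDerivAt_right (hv.intervalIntegrable ht)
        (hv.1.stronglyMeasurableAtFilter isOpen_Ioi t ht)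
        (hv.1.continuousAt (Ioi_mem_nhds ht))
    exact (h1.const_add u₀).deriv
  have hconv : ∀ t : ℝ, 0 < t → EqOn (fun τ => k (t - τ) * deriv u τ)
      (fun τ => v τ * k (t - τ)) (uIoc 0 t) := by
    intro t ht τ hτ
    rw [uIoc_of_le ht.le] at hτ
    simp only [hderiv τ hτ.1, mul_comm]
  have heq : EqOn (fun t => ((∫ τ in (0 : ℝ)..t, v τ * k (t - τ) : ℝ) : ℂ))
      (fun t => ((-lam * u t : ℝ) : ℂ)) (Ioi 0) := by
    refine eqOn_of_hasLaplaceAt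
      (Complex.continuous_ofReal.comp_continuousOn (hv.continuousOn_convolution hk))
      (Complex.continuous_ofReal.comp_continuousOn (continuousOn_const.mul huc)) (a + 1)
      (fun s => -lam * (u₀ * solutionTransform α₁ α₂ c lam s)) (fun s hs => ?_) (fun s hs => ?_)
    · have hs' : a < s.re := by linarith
      have hs0 := ne_zero_of_re_pos (h0 s hs')
      have h1 := hasLaplaceAt_ofReal_convolution (hvL s (hM s hs')) (hkL s (hM' s hs'))
      convert h1 using 1
      have h2 : powExp (1 - α₁) ((α₂ - α₁) * c) c s = s⁻¹ * (X s)⁻¹ := by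
        rw [hX, ← powExp_neg_neg, ← powExp_one_zero c hs0, powExp_mul]
        congr 1
        ring
      rw [h2, solutionTransform_eq α₁ α₂ c lam hs0 (add_ne_zero_of_re_pos hc (h0 s hs')), ← hX]
      have h3 : X s ≠ 0 := powExp_ne_zero _ _ _ _
      push_cast
      generalize X s = x at *
      field_simp
    · have hs' : a < s.re := by linarith
      simpa using (huL s hs').const_mul (-lam : ℂ)
  refine ⟨u, ⟨fun T hT => ?_, by simp [hu], fun t ht => ?_, fun t ht => ?_⟩, a, fun s hs => huL s hs⟩
  · have h1 := (hv.intervalIntegrable hT).absolutelyContinuousOnInterval_intervalIntegral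
      (c := 0) (by simp)
    have h2 : AbsolutelyContinuousOnInterval (fun _ : ℝ => u₀) 0 T :=
      (LipschitzWith.const u₀).lipschitzOnWith.absolutelyContinuousOnInterval
    exact h2.add h1
  · exact (hv.intervalIntegrable_convolution hk ht).congr (hconv t ht).symm
  · have h1 := heq ht
    simp only [Complex.ofReal_inj] at h1
    rw [scarpiDeriv, ← h1]
    exact intervalIntegral.integral_congr_ae (Eventually.of_forall fun τ hτ => hconv t ht hτ)

/-! ### Uniqueness of the solution -/

lemma PowerExpBound.exists_integral_lt {f : ℝ → ℝ} {γ C M : ℝ} (hf : PowerExpBound f γ C M)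
    {ε : ℝ} (hε : 0 < ε) :
    ∃ r : ℝ, 0 < r ∧ IntegrableOn (fun t => Real.exp (-r * t) * |f t|) (Ioi 0) ∧
      ∫ t in Ioi (0 : ℝ), Real.exp (-r * t) * |f t| < ε := by
  have hγ := hf.2.1
  have hlim : Tendsto (fun r : ℝ => C * ((1 / r) ^ γ * Real.Gamma γ)) atTop (𝓝 0) := by
    have h1 : Tendsto (fun r : ℝ => C * (r ^ (-γ) * Real.Gamma γ)) atTop (𝓝 0) := by
      simpa using ((tendsto_rpow_neg_atTop hγ).mul_const (Real.Gamma γ)).const_mul C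
    refine h1.congr' ?_
    filter_upwards [eventually_gt_atTop 0] with r hr
    rw [one_div, Real.inv_rpow hr.le, Real.rpow_neg hr.le]
  obtain ⟨r, hr, hr0⟩ := ((hlim.eventually (gt_mem_nhds hε)).and (eventually_gt_atTop |M|)).exists
  have hr0' : 0 < r := (abs_nonneg M).trans_lt hr0
  have hi : IntegrableOn (fun t => Real.exp (-(r + M) * t) * |f t|) (Ioi 0) := by
    have := (hf.integrableOn_laplace (s := ((r + M : ℝ) : ℂ)) (by simpa)).norm
    refine this.congr (Eventually.of_forall fun t => ?_)
    simp only [norm_mul, norm_exp_neg_mul, Complex.norm_real, Real.norm_eq_abs, Complex.ofReal_re]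
  refine ⟨r + M, by linarith [neg_abs_le M], hi, lt_of_le_of_lt ?_ hr⟩
  rw [← Real.integral_rpow_mul_exp_neg_mul_Ioi hγ hr0', ← integral_const_mul]
  refine setIntegral_mono_on hi (Integrable.const_mul ?_ _) measurableSet_Ioi fun t ht => ?_
  · have := integrableOn_rpow_mul_exp_neg_mul_rpow (s := γ - 1) (p := 1) (b := r)
      (by linarith) one_pos hr0'
    simp only [Real.rpow_one, neg_mul] at this
    exact this
  · calc Real.exp (-(r + M) * t) * |f t|
        ≤ Real.exp (-(r + M) * t) * (C * t ^ (γ - 1) * Real.exp (M * t)) := by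
          gcongr; exact hf.2.2.2.2 t ht
      _ = C * (t ^ (γ - 1) * Real.exp (-(r * t))) := by
          rw [show -(r * t) = -(r + M) * t + M * t by ring, Real.exp_add]; ring

/-- A continuous solution of `w = -λ ψ * w` with `ψ` locally integrable vanishes: in the norm
`sup e ^ (-r t) |w t|` with `r` large the right-hand side is a contraction. -/
lemma eq_zero_of_volterra {ψ w : ℝ → ℝ} {γ C M T lam : ℝ} (hψ : PowerExpBound ψ γ C M)
    (hlam : 0 < lam) (hw : ContinuousOn w (Icc 0 T)) (hw0 : w 0 = 0)
    (h : ∀ t ∈ Ioo 0 T, w t = -lam * ∫ τ in (0 : ℝ)..t, ψ τ * w (t - τ)) :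
    ∀ t ∈ Ico 0 T, w t = 0 := by
  obtain ⟨r, hr0, hri, hr⟩ := hψ.exists_integral_lt (ε := 1 / (2 * lam)) (by positivity)
  intro t₁ ht₁
  rcases eq_or_lt_of_le ht₁.1 with h0 | h0
  · rw [← h0, hw0]
  have hwc : ContinuousOn (fun t => Real.exp (-r * t) * |w t|) (Icc 0 t₁) :=
    (by fun_prop : Continuous fun t => Real.exp (-r * t)).continuousOn.mul
      (hw.mono (Icc_subset_Icc_right ht₁.2.le)).abs
  -- at the maximum `S` of the weighted function the equation gives `S ≤ S / 2`
  obtain ⟨t₂, ht₂, hmax⟩ := isCompact_Icc.exists_isMaxOn ⟨0, by simp [h0.le]⟩ hwc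
  set S := Real.exp (-r * t₂) * |w t₂| with hS
  have hS0 : 0 ≤ S := by positivity
  have hle : ∀ t ∈ Icc 0 t₁, Real.exp (-r * t) * |w t| ≤ S := fun t ht => hmax ht
  have hSz : S ≤ S / 2 := by
    rcases eq_or_lt_of_le ht₂.1 with h2 | h2
    · rw [hS, ← h2, hw0]; simp
    · have e1 := h t₂ ⟨h2, ht₂.2.trans_lt ht₁.2⟩
      have e2 : |∫ τ in (0 : ℝ)..t₂, ψ τ * w (t₂ - τ)| ≤
          ∫ τ in (0 : ℝ)..t₂, (Real.exp (r * t₂) * S) * (Real.exp (-r * τ) * |ψ τ|) := by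
        refine intervalIntegral.abs_integral_le_integral_abs h2.le |>.trans ?_
        rw [intervalIntegral.integral_of_le h2.le, intervalIntegral.integral_of_le h2.le]
        refine integral_mono_of_nonneg (Eventually.of_forall fun _ => abs_nonneg _)
          ((hri.mono_set Ioc_subset_Ioi_self).const_mul _) ?_
        refine (ae_restrict_iff' measurableSet_Ioc).2 (Eventually.of_forall fun τ hτ => ?_)
        have h3 := hle (t₂ - τ) ⟨by linarith [hτ.2], by linarith [hτ.1, ht₂.2]⟩
        have h4 : |w (t₂ - τ)| ≤ Real.exp (r * (t₂ - τ)) * S := by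
          have : Real.exp (r * (t₂ - τ)) * (Real.exp (-r * (t₂ - τ)) * |w (t₂ - τ)|) =
              |w (t₂ - τ)| := by
            rw [← mul_assoc, ← Real.exp_add]; simp
          rw [← this]
          gcongr
        simp only [abs_mul]
        calc |ψ τ| * |w (t₂ - τ)| ≤ |ψ τ| * (Real.exp (r * (t₂ - τ)) * S) := by gcongr
          _ = _ := by
            rw [show r * (t₂ - τ) = r * t₂ + -r * τ by ring, Real.exp_add]; ring
      have e3 : ∫ τ in (0 : ℝ)..t₂, (Real.exp (-r * τ) * |ψ τ|) ≤ 1 / (2 * lam) := by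
        rw [intervalIntegral.integral_of_le h2.le]
        refine (setIntegral_mono_set hri (Eventually.of_forall fun _ => by positivity)
          Ioc_subset_Ioi_self.eventuallyLE).trans hr.le
      rw [intervalIntegral.integral_const_mul] at e2
      have e4 : |w t₂| ≤ lam * (Real.exp (r * t₂) * S * (1 / (2 * lam))) := by
        rw [e1, abs_mul, abs_neg, abs_of_pos hlam]
        gcongr
        refine e2.trans ?_
        gcongr
      calc S = Real.exp (-r * t₂) * |w t₂| := rfl
        _ ≤ Real.exp (-r * t₂) * (lam * (Real.exp (r * t₂) * S * (1 / (2 * lam)))) := by gcongr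
        _ = (Real.exp (-r * t₂) * Real.exp (r * t₂)) * S / 2 := by field_simp
        _ = S / 2 := by rw [← Real.exp_add]; simp
  have hSzero : S = 0 := by linarith
  have h5 := hle t₁ ⟨h0.le, le_rfl⟩
  rw [hSzero] at h5
  have h6 : |w t₁| ≤ 0 := by
    by_contra hneg
    push Not at hneg
    have : 0 < Real.exp (-r * t₁) * |w t₁| := by positivity
    linarith
  exact abs_eq_zero.1 (le_antisymm h6 (abs_nonneg _))

/-- Convolving the equation with the function `ψ` of transform `s ^ (-s A(s))`, for which
`ψ * φ = 1`, turns it into a Volterra equation of the second kind. -/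
lemma IsSolution.volterra {α₁ α₂ c lam u₀ : ℝ} {u ψ : ℝ → ℝ} (hα₁' : α₁ < 1)
    (hc : 0 < c) (hu : IsSolution (expTransition α₁ α₂ c) lam u₀ u)
    (hψ : IsLaplacePair ψ (powExp α₁ (-((α₂ - α₁) * c)) c)) {t : ℝ} (ht : 0 < t) :
    u t = u₀ - lam * ∫ τ in (0 : ℝ)..t, ψ τ * u (t - τ) := by
  obtain ⟨γ, C, M, hψb, hψL⟩ := hψ
  obtain ⟨γ', C', M', hk, hkL⟩ := isLaplacePair_kernel (α₂ := α₂) hα₁' hc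
  set k := kernel (expTransition α₁ α₂ c) with hkdef
  set T := t + 1 with hT
  have hT0 : 0 < T := by linarith
  have hac := hu.absolutelyContinuous T hT0
  -- the derivative of `u`, cut off at `T`
  set d : ℝ → ℝ := indicator (Ioc 0 T) (deriv u) with hd
  have hdi : Integrable d := by
    rw [hd, integrable_indicator_iff measurableSet_Ioc,
      ← intervalIntegrable_iff_integrableOn_Ioc_of_le hT0.le]
    exact hac.intervalIntegrable_deriv
  have hdeq : ∀ x ∈ Ioo 0 T, ∀ τ ∈ uIoc 0 x, d τ = deriv u τ := by
    intro x hx τ hτ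
    rw [uIoc_of_le hx.1.le] at hτ
    exact indicator_of_mem (show τ ∈ Ioc 0 T from ⟨hτ.1, hτ.2.trans hx.2.le⟩) _
  have hdL : ∀ s : ℂ, 0 < s.re → HasLaplaceAt (fun t => (d t : ℂ)) s
      (∫ t in Ioi (0 : ℝ), Complex.exp (-s * (t : ℂ)) * (d t : ℂ)) := by
    intro s hs
    refine ⟨?_, rfl⟩
    refine Integrable.mono' hdi.norm.integrableOn ?_ ?_
    · exact (Continuous.aestronglyMeasurable (by fun_prop)).mul
        hdi.ofReal.aestronglyMeasurable.restrict
    · refine (ae_restrict_iff' measurableSet_Ioi).2 (Eventually.of_forall fun t ht => ?_)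
      rw [norm_mul, norm_exp_neg_mul, Complex.norm_real]
      refine mul_le_of_le_one_left (norm_nonneg _) (Real.exp_le_one_iff.2 ?_)
      have : 0 < t := ht
      nlinarith
  -- `h = ψ * (φ * u')` and `w = 1 * u'` have the same Laplace transform
  set g : ℝ → ℝ := fun t => ∫ τ in (0 : ℝ)..t, d τ * k (t - τ) with hg
  set h : ℝ → ℝ := fun t => ∫ τ in (0 : ℝ)..t, ψ τ * g (t - τ) with hh
  set w : ℝ → ℝ := fun t => ∫ τ in (0 : ℝ)..t, d τ with hw
  have hgeq : ∀ x ∈ Ioo 0 T, g x = -lam * u x := by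
    intro x hx
    rw [← hu.equation x hx.1, scarpiDeriv, hg]
    refine intervalIntegral.integral_congr_ae (Eventually.of_forall fun τ hτ => ?_)
    rw [hdeq x hx τ hτ, mul_comm]
  have hweq : ∀ x ∈ Ioo 0 T, w x = u x - u₀ := by
    intro x hx
    have h1 : w x = ∫ τ in (0 : ℝ)..x, deriv u τ :=
      intervalIntegral.integral_congr_ae (Eventually.of_forall fun τ hτ => hdeq x hx τ hτ)
    rw [h1, (hu.absolutelyContinuous x hx.1).integral_deriv_eq_sub, hu.initial]
  -- a bounded continuous function which agrees with `u` on `[0, T]`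
  have huc : ContinuousOn u (Icc 0 T) := by
    have := hac.continuousOn
    rwa [uIcc_of_le hT0.le] at this
  set ũ : ℝ → ℝ := IccExtend hT0.le (domRestrict (Icc 0 T) u) with hũ
  have hũc : Continuous ũ := (continuousOn_iff_continuous_domRestrict.1 huc).Icc_extend'
  have hũeq : ∀ x ∈ Icc 0 T, ũ x = u x := fun x hx => by
    rw [hũ, IccExtend_of_mem _ _ hx, domRestrict_apply]
  obtain ⟨B, hB⟩ := isCompact_Icc.exists_bound_of_continuousOn huc
  have hũb : PowerExpBound ũ 1 B 0 := by
    refine ⟨hũc.continuousOn, one_pos, le_rfl,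
      (norm_nonneg _).trans (hB 0 ⟨le_rfl, hT0.le⟩), fun x _ => ?_⟩
    simpa [hũ, IccExtend, projIcc, domRestrict] using hB (projIcc 0 T hT0.le x) (Subtype.coe_prop _)
  have hheq : ∀ x ∈ Ioo 0 T, h x = -lam * ∫ τ in (0 : ℝ)..x, ψ τ * ũ (x - τ) := by
    intro x hx
    rw [hh, ← intervalIntegral.integral_const_mul]
    have hne : ∀ᵐ τ : ℝ, τ ≠ x := by simp [ae_iff]
    refine intervalIntegral.integral_congr_ae ?_
    filter_upwards [hne] with τ hτx hτ
    rw [uIoc_of_le hx.1.le] at hτ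
    have h1 : x - τ ∈ Ioo 0 T :=
      ⟨sub_pos.2 (lt_of_le_of_ne hτ.2 hτx), by linarith [hτ.1, hx.2]⟩
    rw [hgeq _ h1, hũeq _ ⟨h1.1.le, h1.2.le⟩]
    ring
  have hx : t ∈ Ioo 0 T := ⟨ht, by linarith⟩
  have hmem : Ioo 0 T ∈ 𝓝 t := Ioo_mem_nhds hx.1 hx.2
  have hhc : ContinuousAt h t := by
    have h1 := ((hψb.continuousOn_convolution hũb).continuousAt (Ioi_mem_nhds ht)).const_mul (-lam)
    refine h1.congr ?_
    filter_upwards [hmem] with x hx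
    exact (hheq x hx).symm
  have hwc : ContinuousAt w t := by
    have h1 : ContinuousAt (fun x => u x - u₀) t :=
      (huc.continuousAt (Icc_mem_nhds hx.1 hx.2)).sub continuousAt_const
    refine h1.congr ?_
    filter_upwards [hmem] with x hx
    exact (hweq x hx).symm
  have hzero := eq_zero_of_hasLaplaceAt (f := fun x => (h x : ℂ) - (w x : ℂ))
    (max (max M M') 0 + 1) (fun s hs => ?_) ht
    ((Complex.continuous_ofReal.continuousAt.comp hhc).sub
      (Complex.continuous_ofReal.continuousAt.comp hwc))
  · have h1 : h t = w t := by exact_mod_cast sub_eq_zero.1 hzero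
    rw [hheq t hx, hweq t hx] at h1
    have h2 : ∫ τ in (0 : ℝ)..t, ψ τ * ũ (t - τ) = ∫ τ in (0 : ℝ)..t, ψ τ * u (t - τ) := by
      refine intervalIntegral.integral_congr_ae (Eventually.of_forall fun τ hτ => ?_)
      rw [uIoc_of_le ht.le] at hτ
      rw [hũeq _ ⟨by linarith [hτ.2], by linarith [hτ.1]⟩]
    rw [h2] at h1
    linarith
  · have hs0 : 0 < s.re := by rw [hs]; linarith [le_max_right (max M M') 0]
    have hsM : M < s.re := by
      rw [hs]; linarith [le_max_left (max M M') 0, le_max_left M M']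
    have hsM' : M' < s.re := by
      rw [hs]; linarith [le_max_left (max M M') 0, le_max_right M M']
    have hne := ne_zero_of_re_pos hs0
    have e1 := hasLaplaceAt_ofReal_convolution (hψL s hsM)
      (hasLaplaceAt_ofReal_convolution (hdL s hs0) (hkL s hsM'))
    have e2 := hasLaplaceAt_ofReal_convolution (g := fun _ => 1) (hdL s hs0)
      (by simpa using hasLaplaceAt_one hs0)
    simp only [mul_one] at e2
    have e3 := e1.sub e2
    convert e3 using 1
    have e4 : powExp α₁ (-((α₂ - α₁) * c)) c s * powExp (1 - α₁) ((α₂ - α₁) * c) c s = s⁻¹ := by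
      rw [powExp_mul, ← powExp_one_zero c hne]
      congr 1 <;> ring
    linear_combination -(∫ t in Ioi (0 : ℝ), Complex.exp (-s * (t : ℂ)) * (d t : ℂ)) * e4

lemma IsSolution.eqOn {α₁ α₂ c lam u₀ : ℝ} {u v : ℝ → ℝ} (hα₁ : 0 < α₁) (hα₁' : α₁ < 1)
    (hc : 0 < c) (hlam : 0 < lam) (hu : IsSolution (expTransition α₁ α₂ c) lam u₀ u)
    (hv : IsSolution (expTransition α₁ α₂ c) lam u₀ v) : EqOn v u (Ici 0) := by
  obtain ⟨ψ, hψ⟩ := exists_isLaplacePair_powExp hα₁ (-((α₂ - α₁) * c)) hc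
  obtain ⟨γ, C, M, hψb, -⟩ := id hψ
  intro t ht
  have ht : 0 ≤ t := ht
  have hT : 0 < t + 1 := by linarith
  have huc : ContinuousOn u (Icc 0 (t + 1)) := by
    have := (hu.absolutelyContinuous _ hT).continuousOn
    rwa [uIcc_of_le hT.le] at this
  have hvc : ContinuousOn v (Icc 0 (t + 1)) := by
    have := (hv.absolutelyContinuous _ hT).continuousOn
    rwa [uIcc_of_le hT.le] at this
  have hint : ∀ f : ℝ → ℝ, ContinuousOn f (Icc 0 (t + 1)) → ∀ x ∈ Ioo 0 (t + 1),
      IntervalIntegrable (fun τ => ψ τ * f (x - τ)) volume 0 x := by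
    intro f hf x hx
    refine (hψb.intervalIntegrable hx.1).mul_continuousOn (hf.comp (by fun_prop) fun τ hτ => ?_)
    rw [uIcc_of_le hx.1.le] at hτ
    exact ⟨by linarith [hτ.2], by linarith [hτ.1, hx.2]⟩
  refine sub_eq_zero.1 (eq_zero_of_volterra (w := fun t => v t - u t) hψb hlam (hvc.sub huc)
    (by simp [hu.initial, hv.initial]) (fun x hx => ?_) t ⟨ht, by linarith⟩)
  rw [hu.volterra hα₁' hc hψ hx.1, hv.volterra hα₁' hc hψ hx.1]
  simp only [mul_sub]
  rw [intervalIntegral.integral_sub (hint v hvc x hx) (hint u huc x hx)]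
  ring

/-! ### Logarithmic coordinates -/

/-- `log (λ s ^ (-s A(s)))` in the coordinate `ζ = log s`. It is meromorphic on the whole plane, with
poles where `e ^ ζ = -c`; the two sides of the branch cut are the lines `Im ζ = ± π`. -/
def logRatio (α₁ α₂ c lam : ℝ) (ζ : ℂ) : ℂ :=
  Real.log lam - (α₁ + ((α₂ - α₁) * c : ℝ) / (Complex.exp ζ + c)) * ζ

/-- The function `s W(s) = 1 / (1 + λ s ^ (-s A(s)))` in the coordinate `ζ = log s`. -/
def logTransform (α₁ α₂ c lam : ℝ) (ζ : ℂ) : ℂ :=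
  (1 + Complex.exp (logRatio α₁ α₂ c lam ζ))⁻¹

section Basic

variable {α₁ α₂ c lam : ℝ}

lemma exp_logRatio_log (hlam : 0 < lam) {s : ℂ} (hs0 : s ≠ 0) :
    Complex.exp (logRatio α₁ α₂ c lam (Complex.log s)) =
      lam * powExp α₁ (-((α₂ - α₁) * c)) c s := by
  rw [logRatio, Complex.exp_log hs0, powExp, sub_eq_add_neg, Complex.exp_add, ← Complex.ofReal_exp,
    Real.exp_log hlam]
  congr 2
  push_cast
  ring

lemma solutionTransform_eq_logTransform (hlam : 0 < lam) {s : ℂ} (hs0 : s ≠ 0)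
    (hsc : s + c ≠ 0) : solutionTransform α₁ α₂ c lam s =
      s⁻¹ * logTransform α₁ α₂ c lam (Complex.log s) := by
  rw [solutionTransform_eq α₁ α₂ c lam hs0 hsc, logTransform, exp_logRatio_log hlam hs0,
    div_eq_mul_inv]

lemma denom_eq_zero_iff (hlam : 0 < lam) {s : ℂ} (hs0 : s ≠ 0) (hsc : s + c ≠ 0) :
    denom α₁ α₂ c lam s = 0 ↔ 1 + Complex.exp (logRatio α₁ α₂ c lam (Complex.log s)) = 0 := by
  have h2 : powExp (-α₁) ((α₂ - α₁) * c) c s = (powExp α₁ (-((α₂ - α₁) * c)) c s)⁻¹ := by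
    rw [← powExp_neg_neg, neg_neg]
  rw [denom, cpow_mul_expA α₁ α₂ c hs0 hsc, h2, exp_logRatio_log hlam hs0]
  have h3 := powExp_ne_zero α₁ (-((α₂ - α₁) * c)) c s
  set X := powExp α₁ (-((α₂ - α₁) * c)) c s
  have h4 : X⁻¹ + lam = X⁻¹ * (1 + lam * X) := by field_simp
  rw [h4, mul_eq_zero, or_iff_right (inv_ne_zero h3)]

lemma slitPlane_add_ne_zero (hc : 0 < c) {s : ℂ} (hs : s ∈ Complex.slitPlane) : s + c ≠ 0 := by
  intro h
  have h1 : s = ((-c : ℝ) : ℂ) := by push_cast; linear_combination h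
  rw [h1, Complex.ofReal_mem_slitPlane] at hs
  linarith

lemma mem_poles_iff (hc : 0 < c) (hlam : 0 < lam) {z : ℂ} : z ∈ poles α₁ α₂ c lam ↔
    z ∈ Complex.slitPlane ∧ 1 + Complex.exp (logRatio α₁ α₂ c lam (Complex.log z)) = 0 := by
  refine and_congr_right fun hz => ?_
  exact denom_eq_zero_iff hlam (Complex.slitPlane_ne_zero hz) (slitPlane_add_ne_zero hc hz)

lemma logRatio_conj (ζ : ℂ) : logRatio α₁ α₂ c lam ((starRingEnd ℂ) ζ) =
    (starRingEnd ℂ) (logRatio α₁ α₂ c lam ζ) := by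
  simp [logRatio, ← Complex.exp_conj]

lemma logTransform_conj (ζ : ℂ) : logTransform α₁ α₂ c lam ((starRingEnd ℂ) ζ) =
    (starRingEnd ℂ) (logTransform α₁ α₂ c lam ζ) := by
  rw [logTransform, logTransform, logRatio_conj, Complex.exp_conj]
  simp

lemma differentiableAt_logRatio {ζ : ℂ} (h : Complex.exp ζ + c ≠ 0) :
    DifferentiableAt ℂ (logRatio α₁ α₂ c lam) ζ := by
  have h1 : DifferentiableAt ℂ (fun ζ : ℂ => Complex.exp ζ + c) ζ := by fun_prop
  have h2 : DifferentiableAt ℂ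
      (fun ζ : ℂ => (((α₂ - α₁) * c : ℝ) : ℂ) / (Complex.exp ζ + c)) ζ :=
    (differentiableAt_const _).div h1 h
  exact ((h2.const_add (α₁ : ℂ)).mul differentiableAt_id).const_sub _

lemma differentiableAt_logTransform {ζ : ℂ} (h : Complex.exp ζ + c ≠ 0)
    (h1 : 1 + Complex.exp (logRatio α₁ α₂ c lam ζ) ≠ 0) :
    DifferentiableAt ℂ (logTransform α₁ α₂ c lam) ζ := by
  unfold logTransform
  exact ((differentiableAt_logRatio h).cexp.const_add 1).inv h1

end Basic

/-! ### Behaviour near `0` and `∞` -/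

section Ends

variable {α₁ α₂ c lam : ℝ}

lemma norm_le_of_abs_im_le {ζ : ℂ} (h : |ζ.im| ≤ Real.pi) : ‖ζ‖ ≤ |ζ.re| + Real.pi :=
  (Complex.norm_le_abs_re_add_abs_im ζ).trans (by gcongr)

lemma norm_exp_logRatio_le_right (hα : α₁ < α₂) (hc : 0 < c) (hlam : 0 < lam) {ζ : ℂ}
    (h : |ζ.im| ≤ Real.pi) (h0 : 0 ≤ ζ.re) (hx : 2 * c ≤ Real.exp ζ.re) :
    ‖Complex.exp (logRatio α₁ α₂ c lam ζ)‖ ≤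
      lam * Real.exp (2 * ((α₂ - α₁) * c) * (1 + Real.pi)) * Real.exp (-α₁ * ζ.re) := by
  have hb : 0 < (α₂ - α₁) * c := mul_pos (by linarith) hc
  have hden : Real.exp ζ.re / 2 ≤ ‖Complex.exp ζ + c‖ := by
    have h1 := norm_sub_norm_le (Complex.exp ζ) (-(c : ℂ))
    rw [sub_neg_eq_add, norm_neg, Complex.norm_real, Real.norm_eq_abs, abs_of_pos hc,
      Complex.norm_exp] at h1
    linarith
  have he : 0 < Real.exp ζ.re := Real.exp_pos _
  have hζ : ‖ζ‖ ≤ (1 + Real.pi) * Real.exp ζ.re := by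
    have h1 := norm_le_of_abs_im_le h
    rw [abs_of_nonneg h0] at h1
    have h2 := Real.add_one_le_exp ζ.re
    have h3 : Real.pi ≤ Real.pi * Real.exp ζ.re :=
      le_mul_of_one_le_right Real.pi_pos.le (Real.one_le_exp h0)
    nlinarith
  have hE : ‖((α₂ - α₁) * c : ℝ) / (Complex.exp ζ + c) * ζ‖ ≤
      2 * ((α₂ - α₁) * c) * (1 + Real.pi) := by
    rw [norm_mul, norm_div, Complex.norm_real, Real.norm_eq_abs, abs_of_pos hb]
    calc (α₂ - α₁) * c / ‖Complex.exp ζ + c‖ * ‖ζ‖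
        ≤ (α₂ - α₁) * c / (Real.exp ζ.re / 2) * ((1 + Real.pi) * Real.exp ζ.re) := by gcongr
      _ = _ := by field_simp
  have e : logRatio α₁ α₂ c lam ζ = ((Real.log lam : ℝ) : ℂ) + ((-α₁ : ℝ) : ℂ) * ζ +
      -(((α₂ - α₁) * c : ℝ) / (Complex.exp ζ + c) * ζ) := by
    rw [logRatio]; push_cast; ring
  have hre : (logRatio α₁ α₂ c lam ζ).re ≤
      Real.log lam + 2 * ((α₂ - α₁) * c) * (1 + Real.pi) + -α₁ * ζ.re := by
    rw [e, Complex.add_re, Complex.add_re, Complex.ofReal_re, Complex.re_ofReal_mul]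
    have h1 := (Complex.re_le_norm (-(((α₂ - α₁) * c : ℝ) / (Complex.exp ζ + c) * ζ)))
    rw [norm_neg] at h1
    linarith
  rw [Complex.norm_exp]
  refine (Real.exp_le_exp.2 hre).trans (le_of_eq ?_)
  rw [Real.exp_add, Real.exp_add, Real.exp_log hlam]

lemma norm_exp_neg_logRatio_le_left (hα : α₁ < α₂) (hc : 0 < c) (hlam : 0 < lam) {ζ : ℂ}
    (h : |ζ.im| ≤ Real.pi) (h0 : ζ.re ≤ 0) (hx : Real.exp ζ.re ≤ c / 2) :
    ‖Complex.exp (-logRatio α₁ α₂ c lam ζ)‖ ≤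
      lam⁻¹ * Real.exp ((α₂ - α₁) * (1 + Real.pi) * (2 / c)) * Real.exp (α₂ * ζ.re) := by
  have hb : 0 < α₂ - α₁ := by linarith
  have hden : c / 2 ≤ ‖Complex.exp ζ + c‖ := by
    have h1 := norm_sub_norm_le (c : ℂ) (-Complex.exp ζ)
    rw [sub_neg_eq_add, norm_neg, Complex.norm_real, Real.norm_eq_abs, abs_of_pos hc,
      Complex.norm_exp, add_comm] at h1
    linarith
  have hne : Complex.exp ζ + c ≠ 0 := fun h => by
    rw [h, norm_zero] at hden; linarith
  have hζ : Real.exp ζ.re * ‖ζ‖ ≤ 1 + Real.pi := by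
    have h1 := norm_le_of_abs_im_le h
    rw [abs_of_nonpos h0] at h1
    have h2 : Real.exp ζ.re * -ζ.re ≤ 1 := by
      have h3 := Real.add_one_le_exp (-ζ.re)
      have h4 : Real.exp ζ.re * Real.exp (-ζ.re) = 1 := by rw [← Real.exp_add]; simp
      nlinarith [Real.exp_pos ζ.re]
    have h3 : Real.exp ζ.re ≤ 1 := Real.exp_le_one_iff.2 h0
    nlinarith [Real.exp_pos ζ.re, Real.pi_pos]
  have hE : ‖((α₂ - α₁ : ℝ) : ℂ) * (Complex.exp ζ / (Complex.exp ζ + c)) * ζ‖ ≤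
      (α₂ - α₁) * (1 + Real.pi) * (2 / c) := by
    rw [norm_mul, norm_mul, norm_div, Complex.norm_real, Real.norm_eq_abs, abs_of_pos hb,
      Complex.norm_exp]
    calc (α₂ - α₁) * (Real.exp ζ.re / ‖Complex.exp ζ + c‖) * ‖ζ‖
        ≤ (α₂ - α₁) * (Real.exp ζ.re / (c / 2)) * ‖ζ‖ := by gcongr
      _ = (α₂ - α₁) * (Real.exp ζ.re * ‖ζ‖) * (2 / c) := by field_simp
      _ ≤ _ := by gcongr
  have e : -logRatio α₁ α₂ c lam ζ = ((-Real.log lam : ℝ) : ℂ) + ((α₂ : ℝ) : ℂ) * ζ +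
      -(((α₂ - α₁ : ℝ) : ℂ) * (Complex.exp ζ / (Complex.exp ζ + c)) * ζ) := by
    rw [logRatio]; push_cast; field_simp; ring
  have hre : (-logRatio α₁ α₂ c lam ζ).re ≤
      -Real.log lam + (α₂ - α₁) * (1 + Real.pi) * (2 / c) + α₂ * ζ.re := by
    rw [e, Complex.add_re, Complex.add_re, Complex.ofReal_re, Complex.re_ofReal_mul]
    have h1 := (Complex.re_le_norm
      (-(((α₂ - α₁ : ℝ) : ℂ) * (Complex.exp ζ / (Complex.exp ζ + c)) * ζ)))
    rw [norm_neg] at h1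
    linarith
  rw [Complex.norm_exp]
  refine (Real.exp_le_exp.2 hre).trans (le_of_eq ?_)
  rw [Real.exp_add, Real.exp_add, Real.exp_neg, Real.exp_log hlam]

/-- In the strip `|Im ζ| ≤ π`, the function `s W(s)` tends to `1` exponentially as `Re ζ → ∞` and to
`0` as `Re ζ → -∞`, and has no poles there. -/
lemma exists_logTransform_ends (hα₁ : 0 < α₁) (hα : α₁ < α₂) (hc : 0 < c) (hlam : 0 < lam) :
    ∃ X K : ℝ, |Real.log c| + 1 < X ∧ 0 < K ∧
      (∀ ζ : ℂ, |ζ.im| ≤ Real.pi → X ≤ ζ.re →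
        1 + Complex.exp (logRatio α₁ α₂ c lam ζ) ≠ 0 ∧
        ‖logTransform α₁ α₂ c lam ζ - 1‖ ≤ K * Real.exp (-α₁ * ζ.re)) ∧
      (∀ ζ : ℂ, |ζ.im| ≤ Real.pi → ζ.re ≤ -X →
        1 + Complex.exp (logRatio α₁ α₂ c lam ζ) ≠ 0 ∧
        ‖logTransform α₁ α₂ c lam ζ‖ ≤ K * Real.exp (α₂ * ζ.re)) := by
  set K₁ := lam * Real.exp (2 * ((α₂ - α₁) * c) * (1 + Real.pi)) with hK₁
  set K₂ := lam⁻¹ * Real.exp ((α₂ - α₁) * (1 + Real.pi) * (2 / c)) with hK₂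
  have hK₁0 : 0 < K₁ := by positivity
  have hK₂0 : 0 < K₂ := by positivity
  have hα₂ : 0 < α₂ := hα₁.trans hα
  have l1 : ∀ᶠ x : ℝ in atTop, K₁ * Real.exp (-α₁ * x) < 1 / 2 := by
    have h1 : Tendsto (fun x : ℝ => K₁ * Real.exp (-α₁ * x)) atTop (𝓝 (K₁ * 0)) :=
      (Real.tendsto_exp_atBot.comp
        (tendsto_id.const_mul_atTop_of_neg (neg_lt_zero.2 hα₁))).const_mul K₁
    rw [mul_zero] at h1
    exact h1.eventually (gt_mem_nhds one_half_pos)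
  have l2 : ∀ᶠ x : ℝ in atTop, K₂ * Real.exp (-α₂ * x) < 1 / 2 := by
    have h1 : Tendsto (fun x : ℝ => K₂ * Real.exp (-α₂ * x)) atTop (𝓝 (K₂ * 0)) :=
      (Real.tendsto_exp_atBot.comp
        (tendsto_id.const_mul_atTop_of_neg (neg_lt_zero.2 hα₂))).const_mul K₂
    rw [mul_zero] at h1
    exact h1.eventually (gt_mem_nhds one_half_pos)
  have l3 : ∀ᶠ x : ℝ in atTop, 2 * c ≤ Real.exp x :=
    Real.tendsto_exp_atTop.eventually (eventually_ge_atTop _)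
  have l4 : ∀ᶠ x : ℝ in atTop, Real.exp (-x) < c / 2 :=
    (Real.tendsto_exp_atBot.comp tendsto_neg_atTop_atBot).eventually (gt_mem_nhds (by positivity))
  obtain ⟨X₀, hX₀⟩ := (l1.and (l2.and (l3.and l4))).exists_forall_of_atTop
  refine ⟨max X₀ (|Real.log c| + 2), 2 * (K₁ + K₂),
    by linarith [le_max_right X₀ (|Real.log c| + 2)], by positivity, ?_, ?_⟩
  · intro ζ h hx
    have hx0 : 0 ≤ ζ.re := by
      linarith [le_max_right X₀ (|Real.log c| + 2), abs_nonneg (Real.log c)]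
    obtain ⟨a1, -, a3, -⟩ := hX₀ ζ.re ((le_max_left _ _).trans hx)
    have hE := norm_exp_logRatio_le_right (α₁ := α₁) hα hc hlam h hx0 a3
    rw [← hK₁] at hE
    set E := Complex.exp (logRatio α₁ α₂ c lam ζ) with hEdef
    have h2 : 1 / 2 ≤ ‖1 + E‖ := by
      have := norm_sub_le_norm_add (1 : ℂ) E
      rw [norm_one] at this
      linarith
    have h3 : 1 + E ≠ 0 := fun h => by rw [h, norm_zero] at h2; linarith
    refine ⟨h3, ?_⟩
    have h4 : logTransform α₁ α₂ c lam ζ - 1 = -E / (1 + E) := by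
      rw [logTransform, ← hEdef]; field_simp; ring
    rw [h4, norm_div, norm_neg, div_le_iff₀ (by linarith)]
    have h5 : 0 < Real.exp (-α₁ * ζ.re) := Real.exp_pos _
    calc ‖E‖ ≤ K₁ * Real.exp (-α₁ * ζ.re) := hE
      _ ≤ 2 * (K₁ + K₂) * Real.exp (-α₁ * ζ.re) * (1 / 2) := by nlinarith
      _ ≤ _ := by gcongr
  · intro ζ h hx
    have hx0 : ζ.re ≤ 0 := by
      linarith [le_max_right X₀ (|Real.log c| + 2), abs_nonneg (Real.log c)]
    obtain ⟨-, a2, -, a4⟩ := hX₀ (-ζ.re) (by linarith [le_max_left X₀ (|Real.log c| + 2)])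
    rw [neg_neg] at a4
    rw [neg_mul_neg] at a2
    have hE := norm_exp_neg_logRatio_le_left (α₁ := α₁) hα hc hlam h hx0 a4.le
    rw [← hK₂, Complex.exp_neg] at hE
    set E := Complex.exp (logRatio α₁ α₂ c lam ζ) with hEdef
    have hE0 : E ≠ 0 := Complex.exp_ne_zero _
    have h2 : 1 / 2 ≤ ‖1 + E⁻¹‖ := by
      have := norm_sub_le_norm_add (1 : ℂ) E⁻¹
      rw [norm_one] at this
      linarith
    have h3 : 1 + E⁻¹ ≠ 0 := fun h => by rw [h, norm_zero] at h2; linarith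
    have h6 : 1 + E = E * (1 + E⁻¹) := by field_simp; ring
    refine ⟨by rw [h6]; exact mul_ne_zero hE0 h3, ?_⟩
    have h4 : logTransform α₁ α₂ c lam ζ = E⁻¹ / (1 + E⁻¹) := by
      rw [logTransform, ← hEdef, h6, mul_inv, div_eq_mul_inv]
    rw [h4, norm_div, div_le_iff₀ (by linarith)]
    have h5 : 0 < Real.exp (α₂ * ζ.re) := Real.exp_pos _
    calc ‖E⁻¹‖ ≤ K₂ * Real.exp (α₂ * ζ.re) := hE
      _ ≤ 2 * (K₁ + K₂) * Real.exp (α₂ * ζ.re) * (1 / 2) := by nlinarith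
      _ ≤ _ := by gcongr

/-- The poles lie in an annulus about the origin. -/
lemma exists_norm_bounds_poles (hα₁ : 0 < α₁) (hα : α₁ < α₂) (hc : 0 < c) (hlam : 0 < lam) :
    ∃ X : ℝ, ∀ z ∈ poles α₁ α₂ c lam, Real.exp (-X) < ‖z‖ ∧ ‖z‖ < Real.exp X := by
  obtain ⟨X, K, -, -, h1, h2⟩ := exists_logTransform_ends hα₁ hα hc hlam
  refine ⟨X, fun z hz => ?_⟩
  rw [mem_poles_iff hc hlam] at hz
  have hz0 := norm_pos_iff.2 (Complex.slitPlane_ne_zero hz.1)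
  have him : |(Complex.log z).im| ≤ Real.pi := by
    rw [Complex.log_im]; exact Complex.abs_arg_le_pi z
  constructor
  · rw [← Real.lt_log_iff_exp_lt hz0, ← Complex.log_re]
    by_contra hneg
    exact (h2 _ him (not_lt.1 hneg)).1 hz.2
  · rw [← Real.log_lt_iff_lt_exp hz0, ← Complex.log_re]
    by_contra hneg
    exact (h1 _ him (not_lt.1 hneg)).1 hz.2

end Ends

/-! ### Functions with a simple pole and the fibre of their exponential over `-1` -/

/-- The conclusions drawn from `P y = A / y + B y` with `B` analytic at `0`: in the punctured disc of
radius `r₀`, `P` is differentiable, comparable to `A / y`, and injective in the quantitative sense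
that its increments dominate those of `A / (2 y)`. -/
structure IsPoleChart (P : ℂ → ℂ) (A r₀ : ℝ) : Prop where
  pos : 0 < A
  radius_pos : 0 < r₀
  differentiableAt : ∀ y : ℂ, y ≠ 0 → ‖y‖ < r₀ → DifferentiableAt ℂ P y
  norm_le : ∀ y : ℂ, y ≠ 0 → ‖y‖ < r₀ → ‖P y‖ ≤ 2 * A / ‖y‖
  norm_sub_ge : ∀ y₁ y₂ : ℂ, y₁ ≠ 0 → ‖y₁‖ < r₀ → y₂ ≠ 0 → ‖y₂‖ < r₀ →
    A / 2 * ‖y₁⁻¹ - y₂⁻¹‖ ≤ ‖P y₁ - P y₂‖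

lemma exists_isPoleChart {P B : ℂ → ℂ} {A : ℂ} (hA : A ≠ 0) (hB : AnalyticAt ℂ B 0)
    (hP : ∀ᶠ y in 𝓝[≠] 0, P y = A / y + B y) : ∃ r₀, IsPoleChart P ‖A‖ r₀ := by
  have hA0 : 0 < ‖A‖ := norm_pos_iff.2 hA
  obtain ⟨K, t, ht, hK⟩ := (hB.contDiffAt (n := 1)).exists_lipschitzOnWith
  have hbd : ∀ᶠ y in 𝓝 (0 : ℂ), ‖B y‖ < ‖B 0‖ + 1 :=
    hB.continuousAt.norm.eventually (gt_mem_nhds (by linarith))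
  obtain ⟨r₁, hr₁, h1⟩ := Metric.eventually_nhds_iff.1
    ((hbd.and ht).and (hB.eventually_analyticAt.and (eventually_nhdsWithin_iff.1 hP)))
  set m : ℝ := ‖A‖ / (2 * (K + ‖B 0‖ + 1 + ‖A‖)) with hm
  have hK0 : (0 : ℝ) ≤ K := K.2
  have hm0 : 0 < m := by positivity
  have hm1 : m ≤ 1 := by
    rw [hm, div_le_one (by positivity)]
    linarith [norm_nonneg (B 0)]
  have hmK : m * (K + ‖B 0‖ + 1) ≤ ‖A‖ / 2 := by
    rw [hm, div_mul_eq_mul_div, div_le_div_iff₀ (by positivity) two_pos]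
    nlinarith [norm_nonneg (B 0)]
  set r₀ : ℝ := min r₁ m with hr₀
  have hr₀m : r₀ ≤ m := min_le_right _ _
  have hnear : ∀ y : ℂ, ‖y‖ < r₀ → ((‖B y‖ < ‖B 0‖ + 1 ∧ y ∈ t) ∧
      (AnalyticAt ℂ B y ∧ (y ∈ ({0}ᶜ : Set ℂ) → P y = A / y + B y))) := fun y hy =>
    h1 (by rw [dist_zero_right]; exact hy.trans_le (min_le_left _ _))
  refine ⟨r₀, hA0, lt_min hr₁ hm0, ?_, ?_, ?_⟩
  · intro y hy hr
    have h2 : DifferentiableAt ℂ (fun y => A / y + B y) y :=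
      ((differentiableAt_const A).div differentiableAt_id hy).add (hnear y hr).2.1.differentiableAt
    refine h2.congr_of_eventuallyEq ?_
    have h3 : Metric.ball (0 : ℂ) r₀ ∈ 𝓝 y := Metric.isOpen_ball.mem_nhds (by simpa using hr)
    filter_upwards [h3, isOpen_ne.mem_nhds hy] with x hx hx0
    exact (hnear x (by simpa using hx)).2.2 hx0
  · intro y hy hr
    have hy0 : 0 < ‖y‖ := norm_pos_iff.2 hy
    rw [(hnear y hr).2.2 hy]
    refine (norm_add_le _ _).trans ?_
    rw [norm_div]
    have h2 : ‖B y‖ ≤ ‖A‖ / ‖y‖ := by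
      rw [le_div_iff₀ hy0]
      have h3 := (hnear y hr).1.1.le
      have h4 : ‖y‖ ≤ m := hr.le.trans hr₀m
      calc ‖B y‖ * ‖y‖ ≤ (‖B 0‖ + 1) * m := by gcongr
        _ ≤ ‖A‖ := by nlinarith
    calc ‖A‖ / ‖y‖ + ‖B y‖ ≤ ‖A‖ / ‖y‖ + ‖A‖ / ‖y‖ := by gcongr
      _ = _ := by ring
  · intro y₁ y₂ hy₁ hr₁ hy₂ hr₂
    rw [(hnear y₁ hr₁).2.2 hy₁, (hnear y₂ hr₂).2.2 hy₂]
    have e1 : y₁ - y₂ = -(y₁ * y₂ * (y₁⁻¹ - y₂⁻¹)) := by field_simp; ring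
    have h2 : ‖B y₁ - B y₂‖ ≤ ‖A‖ / 2 * ‖y₁⁻¹ - y₂⁻¹‖ := by
      have h3 := hK.dist_le_mul _ (hnear y₁ hr₁).1.2 _ (hnear y₂ hr₂).1.2
      rw [dist_eq_norm, dist_eq_norm, e1, norm_neg, norm_mul, norm_mul] at h3
      have h4 : ‖y₁‖ ≤ m := hr₁.le.trans hr₀m
      have h5 : ‖y₂‖ ≤ 1 := (hr₂.le.trans hr₀m).trans hm1
      calc ‖B y₁ - B y₂‖ ≤ K * (‖y₁‖ * ‖y₂‖ * ‖y₁⁻¹ - y₂⁻¹‖) := h3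
        _ ≤ K * (m * 1 * ‖y₁⁻¹ - y₂⁻¹‖) := by gcongr
        _ = (K * m) * ‖y₁⁻¹ - y₂⁻¹‖ := by ring
        _ ≤ _ := by
          gcongr
          nlinarith [norm_nonneg (B 0)]
    have e2 : A / y₁ + B y₁ - (A / y₂ + B y₂) =
        A * (y₁⁻¹ - y₂⁻¹) - (B y₂ - B y₁) := by ring
    rw [e2]
    have h6 := norm_sub_norm_le (A * (y₁⁻¹ - y₂⁻¹)) (B y₂ - B y₁)
    rw [norm_mul, norm_sub_rev (B y₂)] at h6
    linarith

section Chart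

variable {P : ℂ → ℂ} {A r₀ : ℝ}

lemma IsPoleChart.injOn (h : IsPoleChart P A r₀) : InjOn P {y | y ≠ 0 ∧ ‖y‖ < r₀} := by
  intro y₁ hy₁ y₂ hy₂ heq
  have h1 := h.norm_sub_ge y₁ y₂ hy₁.1 hy₁.2 hy₂.1 hy₂.2
  rw [heq, sub_self, norm_zero] at h1
  have h2 : ‖y₁⁻¹ - y₂⁻¹‖ ≤ 0 := by
    by_contra hneg
    push Not at hneg
    have := h.pos
    have : 0 < A / 2 * ‖y₁⁻¹ - y₂⁻¹‖ := by positivity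
    linarith
  exact inv_injective (sub_eq_zero.1 (norm_eq_zero.1 (le_antisymm h2 (norm_nonneg _))))

lemma IsPoleChart.norm_deriv_ge (h : IsPoleChart P A r₀) {y : ℂ} (hy : y ≠ 0) (hr : ‖y‖ < r₀) :
    A / 2 / ‖y‖ ^ 2 ≤ ‖deriv P y‖ := by
  have h1 : Tendsto (fun x => ‖slope P y x‖) (𝓝[≠] y) (𝓝 ‖deriv P y‖) :=
    (hasDerivAt_iff_tendsto_slope.1 (h.differentiableAt y hy hr).hasDerivAt).norm
  have h2 : Tendsto (fun x => A / 2 / (‖x‖ * ‖y‖)) (𝓝[≠] y) (𝓝 (A / 2 / (‖y‖ * ‖y‖))) := by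
    have hy0 : ‖y‖ * ‖y‖ ≠ 0 := by simpa using hy
    have : ContinuousAt (fun x : ℂ => A / 2 / (‖x‖ * ‖y‖)) y := by
      exact continuousAt_const.div (by fun_prop) hy0
    exact this.tendsto.mono_left nhdsWithin_le_nhds
  rw [pow_two]
  refine le_of_tendsto_of_tendsto h2 h1 ?_
  have h3 : Metric.ball (0 : ℂ) r₀ ∈ 𝓝[≠] y :=
    mem_nhdsWithin_of_mem_nhds (Metric.isOpen_ball.mem_nhds (by simpa using hr))
  filter_upwards [h3, mem_nhdsWithin_of_mem_nhds (isOpen_ne.mem_nhds hy), self_mem_nhdsWithin]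
    with x hx hx0 hxy
  have hx0 : x ≠ 0 := hx0
  have h4 := h.norm_sub_ge x y hx0 (by simpa using hx) hy hr
  have e1 : x⁻¹ - y⁻¹ = -((x - y) / (x * y)) := by field_simp; ring
  have hxy' : 0 < ‖x - y‖ := norm_pos_iff.2 (sub_ne_zero.2 hxy)
  rw [e1, norm_neg, norm_div, norm_mul] at h4
  rw [slope_def_field, norm_div, le_div_iff₀ hxy']
  calc A / 2 / (‖x‖ * ‖y‖) * ‖x - y‖ = A / 2 * (‖x - y‖ / (‖x‖ * ‖y‖)) := by ring
    _ ≤ _ := h4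

/-- A solution of `P y = (2k + 1) π i` satisfies `|y| ≤ 2 A / (π |2k + 1|)`. -/
lemma IsPoleChart.norm_le_of_eq (h : IsPoleChart P A r₀) {y : ℂ} (hy : y ≠ 0) (hr : ‖y‖ < r₀)
    {k : ℤ} (hk : P y = (2 * k + 1) * (Real.pi * Complex.I)) :
    ‖y‖ ≤ 2 * A / (Real.pi * |2 * (k : ℝ) + 1|) := by
  have h1 := h.norm_le y hy hr
  have hy0 : 0 < ‖y‖ := norm_pos_iff.2 hy
  have h2 : ‖P y‖ = Real.pi * |2 * (k : ℝ) + 1| := by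
    rw [hk, norm_mul, norm_mul, Complex.norm_I, Complex.norm_real, Real.norm_eq_abs,
      abs_of_pos Real.pi_pos, mul_one, mul_comm, ← Real.norm_eq_abs, ← Complex.norm_real]
    push_cast
    rfl
  have h3 : 0 < |2 * (k : ℝ) + 1| := by
    rw [abs_pos]
    have : (2 * k + 1 : ℤ) ≠ 0 := by omega
    exact_mod_cast this
  rw [h2, le_div_iff₀ hy0] at h1
  rw [le_div_iff₀ (by have := Real.pi_pos; positivity)]
  linarith

/-- There are arbitrarily small squares about `0` on whose boundary `P` keeps a fixed distance from
the odd multiples of `π i`. In terms of `R = 1 / r`, a given odd multiple is approached only for `R`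
in a set of diameter `O(δ)`, and only `O(N)` of them are met for `R ≤ 2 N`; for small `δ` these
sets cannot cover `[N, 2 N]`. -/
lemma IsPoleChart.exists_good_radius (h : IsPoleChart P A r₀) : ∃ δ : ℝ, 0 < δ ∧ δ ≤ 1 ∧
    ∀ r₁ : ℝ, 0 < r₁ → ∃ r : ℝ, 0 < r ∧ r < r₁ ∧ ∀ y : ℂ, max |y.re| |y.im| = r →
      ∀ k : ℤ, δ ≤ ‖P y - (2 * k + 1) * (Real.pi * Complex.I)‖ := by
  have hA := h.pos
  set δ : ℝ := A / (32 * (2 * A + 7)) with hδ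
  have hδ0 : 0 < δ := by positivity
  have hδ1 : δ ≤ 1 := by
    rw [hδ, div_le_one (by positivity)]
    linarith
  refine ⟨δ, hδ0, hδ1, fun r₁ hr₁ => ?_⟩
  have hr₀ := h.radius_pos
  set N : ℝ := max 1 (max (2 / r₁) (4 / r₀)) with hN
  have hN1 : 1 ≤ N := le_max_left _ _
  have hN2 : 2 / r₁ ≤ N := (le_max_left _ _).trans (le_max_right _ _)
  have hN3 : 4 / r₀ ≤ N := (le_max_right _ _).trans (le_max_right _ _)
  by_contra hcon
  push Not at hcon
  -- with `R = 1 / r`, every `R ∈ [N, 2 N]` is now bad for some odd multiple of `π i`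
  have hsup : ∀ y : ℂ, max |y.re| |y.im| ≤ ‖y‖ ∧ ‖y‖ ≤ 2 * max |y.re| |y.im| := fun y =>
    ⟨max_le (Complex.abs_re_le_norm y) (Complex.abs_im_le_norm y),
      (Complex.norm_le_abs_re_add_abs_im y).trans
        (by linarith [le_max_left |y.re| |y.im|, le_max_right |y.re| |y.im|])⟩
  have hgood : ∀ R ∈ Icc N (2 * N), ∀ y : ℂ, max |y.re| |y.im| = 1 / R →
      y ≠ 0 ∧ ‖y‖ < r₀ ∧ 1 / R ≤ ‖y‖ ∧ ‖y‖ ≤ 2 * (1 / R) := by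
    intro R hR y hy
    have hR0 : 0 < R := by linarith [hR.1]
    have h1 := hsup y
    rw [hy] at h1
    have h2 : 0 < 1 / R := by positivity
    refine ⟨norm_pos_iff.1 (by linarith), ?_, h1.1, h1.2⟩
    refine h1.2.trans_lt ?_
    have h3 : 1 / R ≤ 1 / N := one_div_le_one_div_of_le (by linarith) hR.1
    have h4 : 1 / N ≤ r₀ / 4 := by
      rw [div_le_iff₀ (by linarith)]
      rw [div_le_iff₀ hr₀] at hN3
      linarith
    linarith
  set bad : ℤ → Set ℝ := fun k => {R | R ∈ Icc N (2 * N) ∧ ∃ y : ℂ, max |y.re| |y.im| = 1 / R ∧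
    ‖P y - (2 * k + 1) * (Real.pi * Complex.I)‖ < δ} with hbad
  obtain ⟨m, hm⟩ : ∃ m : ℕ, m = ⌈A * N + 2⌉₊ := ⟨_, rfl⟩
  have hm1 : A * N + 2 ≤ m := by rw [hm]; exact Nat.le_ceil _
  have hm2 : (m : ℝ) ≤ A * N + 3 := by
    rw [hm]
    have := Nat.ceil_lt_add_one (a := A * N + 2) (by positivity)
    linarith
  -- `|P y| ≤ 2 A / |y| ≤ 4 A N` on the squares concerned, so only `O(N)` multiples are met
  have hcover : Icc N (2 * N) ⊆ ⋃ k ∈ Finset.Icc (-(m : ℤ)) m, bad k := by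
    intro R hR
    have hR0 : 0 < R := by linarith [hR.1]
    obtain ⟨y, hy, k, hk⟩ := hcon (1 / R) (by positivity) (by
      rw [div_lt_iff₀ hR0]
      rw [div_le_iff₀ hr₁] at hN2
      have : N * r₁ ≤ R * r₁ := by gcongr; exact hR.1
      linarith)
    obtain ⟨hy0, hyr, hy1, -⟩ := hgood R hR y hy
    refine mem_iUnion₂.2 ⟨k, ?_, hR, y, hy, hk⟩
    have h2 : ‖P y‖ ≤ 4 * A * N := by
      refine (h.norm_le y hy0 hyr).trans ?_
      rw [div_le_iff₀ (norm_pos_iff.2 hy0)]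
      have h5 : 1 / (2 * N) ≤ 1 / R := one_div_le_one_div_of_le hR0 hR.2
      calc 2 * A = 4 * A * N * (1 / (2 * N)) := by field_simp; ring
        _ ≤ 4 * A * N * ‖y‖ := by
          gcongr
          exact h5.trans hy1
    have h3 : ‖((2 * k + 1 : ℤ) : ℂ) * (Real.pi * Complex.I)‖ = |((2 * k + 1 : ℤ) : ℝ)| * Real.pi := by
      rw [norm_mul, norm_mul, Complex.norm_I, Complex.norm_real, Real.norm_eq_abs,
        abs_of_pos Real.pi_pos, mul_one, Complex.norm_intCast]
    have h4 : |((2 * k + 1 : ℤ) : ℝ)| * Real.pi ≤ 4 * A * N + 1 := by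
      rw [← h3]
      have := norm_sub_norm_le (((2 * k + 1 : ℤ) : ℂ) * (Real.pi * Complex.I)) (P y)
      rw [norm_sub_rev] at this
      push_cast at this ⊢
      linarith
    have h5 : |((2 * k + 1 : ℤ) : ℝ)| * 2 ≤ 4 * A * N + 1 :=
      le_trans (by gcongr; exact Real.two_le_pi) h4
    have h6 : |((2 * k + 1 : ℤ) : ℝ)| ≤ 2 * A * N + 1 := by linarith
    rw [abs_le] at h6
    push_cast at h6
    rw [Finset.mem_Icc]
    constructor
    · have : (-(m : ℝ)) ≤ k := by linarith [h6.1]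
      exact_mod_cast this
    · have : (k : ℝ) ≤ m := by linarith [h6.2]
      exact_mod_cast this
  -- if `P` is `δ`-close to the same multiple at `y₁` and `y₂`, then `|1 / y₁ - 1 / y₂| ≤ 4 δ / A`
  have hdiam : ∀ k, volume (bad k) ≤ ENNReal.ofReal (16 * δ / A) := by
    intro k
    refine (Real.volume_le_diam _).trans (Metric.ediam_le fun R₁ h₁ R₂ h₂ => ?_)
    obtain ⟨hR₁, y₁, hy₁, hk₁⟩ := h₁
    obtain ⟨hR₂, y₂, hy₂, hk₂⟩ := h₂
    obtain ⟨a0, ar, a1, a2⟩ := hgood R₁ hR₁ y₁ hy₁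
    obtain ⟨b0, br, b1, b2⟩ := hgood R₂ hR₂ y₂ hy₂
    have hR₁0 : 0 < R₁ := by linarith [hR₁.1]
    have hR₂0 : 0 < R₂ := by linarith [hR₂.1]
    have h1 : ‖P y₁ - P y₂‖ < 2 * δ := by
      have := norm_sub_le (P y₁ - (2 * k + 1) * (Real.pi * Complex.I))
        (P y₂ - (2 * k + 1) * (Real.pi * Complex.I))
      rw [sub_sub_sub_cancel_right] at this
      linarith
    have h2 := h.norm_sub_ge y₁ y₂ a0 ar b0 br
    have e1 : y₁ - y₂ = -(y₁ * y₂ * (y₁⁻¹ - y₂⁻¹)) := by field_simp; ring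
    have h3 : |1 / R₁ - 1 / R₂| ≤ ‖y₁ - y₂‖ := by
      rw [← hy₁, ← hy₂]
      have e2 := Complex.abs_re_le_norm (y₁ - y₂)
      have e3 := Complex.abs_im_le_norm (y₁ - y₂)
      rw [Complex.sub_re] at e2
      rw [Complex.sub_im] at e3
      refine (abs_max_sub_max_le_max _ _ _ _).trans (max_le ?_ ?_)
      · exact (abs_abs_sub_abs_le _ _).trans e2
      · exact (abs_abs_sub_abs_le _ _).trans e3
    rw [e1, norm_neg, norm_mul, norm_mul] at h3
    have e4 : |1 / R₁ - 1 / R₂| = |R₁ - R₂| * (1 / R₁ * (1 / R₂)) := by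
      have : 1 / R₁ - 1 / R₂ = -((R₁ - R₂) * (1 / R₁ * (1 / R₂))) := by field_simp; ring
      rw [this, abs_neg, abs_mul, abs_of_pos (by positivity : 0 < 1 / R₁ * (1 / R₂))]
    have h4 : |R₁ - R₂| ≤ 4 * ‖y₁⁻¹ - y₂⁻¹‖ := by
      have h5 : |R₁ - R₂| * (1 / R₁ * (1 / R₂)) ≤
          4 * ‖y₁⁻¹ - y₂⁻¹‖ * (1 / R₁ * (1 / R₂)) := by
        rw [← e4]
        refine h3.trans ?_
        calc ‖y₁‖ * ‖y₂‖ * ‖y₁⁻¹ - y₂⁻¹‖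
            ≤ (2 * (1 / R₁)) * (2 * (1 / R₂)) * ‖y₁⁻¹ - y₂⁻¹‖ := by gcongr
          _ = _ := by ring
      exact le_of_mul_le_mul_right h5 (by positivity)
    rw [edist_dist, Real.dist_eq]
    apply ENNReal.ofReal_le_ofReal
    rw [le_div_iff₀ hA]
    nlinarith
  -- the choice of `δ` makes the total length of the bad sets at most `N / 2`
  have h7 : volume (Icc N (2 * N)) ≤ ENNReal.ofReal ((2 * m + 1) * (16 * δ / A)) := by
    calc volume (Icc N (2 * N)) ≤ volume (⋃ k ∈ Finset.Icc (-(m : ℤ)) m, bad k) :=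
          measure_mono hcover
      _ ≤ ∑ k ∈ Finset.Icc (-(m : ℤ)) m, volume (bad k) := measure_biUnion_finset_le _ _
      _ ≤ ∑ k ∈ Finset.Icc (-(m : ℤ)) m, ENNReal.ofReal (16 * δ / A) :=
          Finset.sum_le_sum fun k _ => hdiam k
      _ = ENNReal.ofReal ((2 * m + 1) * (16 * δ / A)) := by
          rw [Finset.sum_const, Int.card_Icc, ← ENNReal.ofReal_nsmul, nsmul_eq_mul]
          congr 2
          have : ((m : ℤ) + 1 - -(m : ℤ)).toNat = 2 * m + 1 := by omega
          rw [this]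
          push_cast
          ring
  rw [Real.volume_Icc, ENNReal.ofReal_le_ofReal_iff (by positivity)] at h7
  have h8 : (2 * (m : ℝ) + 1) * (16 * δ / A) ≤ N / 2 := by
    have h9 : 2 * (m : ℝ) + 1 ≤ (2 * A + 7) * N := by nlinarith
    calc (2 * (m : ℝ) + 1) * (16 * δ / A) ≤ (2 * A + 7) * N * (16 * δ / A) := by gcongr
      _ = N / 2 := by rw [hδ]; field_simp; ring
  linarith

end Chart

/-- `1 + e ^ w` is bounded away from `0` off a neighbourhood of the odd multiples of `π i`: if it is
small, `w` differs from such a multiple by a logarithm of a number close to `1`. -/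
lemma norm_one_add_exp_ge {w : ℂ} {δ : ℝ} (hδ1 : δ ≤ 1)
    (h : ∀ k : ℤ, δ ≤ ‖w - (2 * k + 1) * (Real.pi * Complex.I)‖) :
    δ / 2 ≤ ‖1 + Complex.exp w‖ := by
  by_contra hneg
  push Not at hneg
  set x := -(1 + Complex.exp w) with hx
  have hxn : ‖x‖ < 1 / 2 := by rw [hx, norm_neg]; linarith
  have h1 : Complex.exp (w - Real.pi * Complex.I) = Complex.exp (Complex.log (1 + x)) := by
    have hne : 1 + x ≠ 0 := by
      have h2 : 1 + x = -Complex.exp w := by rw [hx]; ring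
      rw [h2]
      exact neg_ne_zero.2 (Complex.exp_ne_zero _)
    rw [Complex.exp_log hne, Complex.exp_sub, Complex.exp_pi_mul_I, hx]
    ring
  obtain ⟨k, hk⟩ := Complex.exp_eq_exp_iff_exists_int.1 h1
  have h2 := Complex.norm_log_one_add_half_le_self hxn.le
  have h3 := h k
  have h4 : w - (2 * k + 1) * (Real.pi * Complex.I) = Complex.log (1 + x) := by
    linear_combination hk
  rw [h4] at h3
  have h5 : ‖x‖ < δ / 2 := by rw [hx, norm_neg]; exact hneg
  linarith [norm_nonneg x]

lemma exists_int_of_one_add_exp_eq_zero {w : ℂ} (h : 1 + Complex.exp w = 0) :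
    ∃ k : ℤ, w = (2 * k + 1) * (Real.pi * Complex.I) := by
  have h1 : Complex.exp w = Complex.exp (Real.pi * Complex.I) := by
    rw [Complex.exp_pi_mul_I]; linear_combination h
  obtain ⟨k, hk⟩ := Complex.exp_eq_exp_iff_exists_int.1 h1
  exact ⟨k, by linear_combination hk⟩

/-! ### The singularity at `-c` -/

section Singularity

variable {α₁ α₂ c lam : ℝ}

/-- The points of the upper and of the lower side of the cut lying over `-c` are
`cutPoint c π` and `cutPoint c (-π)`. -/
def cutPoint (c ω : ℝ) : ℂ := Real.log c + ω * Complex.I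

@[simp] lemma cutPoint_re (c ω : ℝ) : (cutPoint c ω).re = Real.log c := by simp [cutPoint]

@[simp] lemma cutPoint_im (c ω : ℝ) : (cutPoint c ω).im = ω := by simp [cutPoint]

lemma exp_cutPoint_add (hc : 0 < c) {ω : ℝ} (hω : |ω| = Real.pi) (y : ℂ) :
    Complex.exp (cutPoint c ω + y) = -c * Complex.exp y := by
  rw [cutPoint, Complex.exp_add, Complex.exp_add, ← Complex.ofReal_exp, Real.exp_log hc]
  have : Complex.exp (ω * Complex.I) = -1 := by
    rcases (abs_eq Real.pi_pos.le).1 hω with h | h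
    · rw [h, Complex.exp_pi_mul_I]
    · rw [h]; push_cast; rw [neg_mul, Complex.exp_neg, Complex.exp_pi_mul_I]; norm_num
  rw [this]
  ring

/-- `logRatio` has a simple pole at the points over `-c`. -/
lemma exists_isPoleChart_logRatio (hα : α₁ < α₂) (hc : 0 < c) {ω : ℝ} (hω : |ω| = Real.pi) :
    ∃ A r₀, IsPoleChart (fun y => logRatio α₁ α₂ c lam (cutPoint c ω + y)) A r₀ := by
  set Z := cutPoint c ω with hZ
  have hZ0 : Z ≠ 0 := fun h => by
    have := congrArg Complex.im h
    simp only [hZ, cutPoint_im, Complex.zero_im] at this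
    rw [this, abs_zero] at hω
    exact Real.pi_ne_zero hω.symm
  set E : ℂ → ℂ := dslope Complex.exp 0 with hE
  have hE0 : E 0 = 1 := by simp [hE]
  have hEa : AnalyticAt ℂ E 0 := by
    have h1 : Differentiable ℂ E := by
      have := (Complex.differentiableOn_dslope (f := Complex.exp) (s := univ) (c := 0)
        univ_mem).2 Complex.differentiable_exp.differentiableOn
      rwa [differentiableOn_univ] at this
    exact h1.analyticAt 0
  have hEinv : AnalyticAt ℂ (fun y => (E y)⁻¹) 0 := hEa.inv (by rw [hE0]; exact one_ne_zero)
  set κ : ℂ → ℂ := dslope (fun y => (E y)⁻¹) 0 with hκ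
  have hκa : AnalyticAt ℂ κ 0 := by
    obtain ⟨U, hU, hUd⟩ := hEinv.exists_mem_nhds_analyticOnNhd
    have := (Complex.differentiableOn_dslope hU).2 hUd.differentiableOn
    exact this.analyticAt hU
  have hexp : ∀ y : ℂ, Complex.exp y - 1 = y * E y := by
    intro y
    have := sub_smul_dslope Complex.exp 0 y
    simp only [sub_zero, Complex.exp_zero, smul_eq_mul] at this
    exact this.symm
  have hκe : ∀ y : ℂ, (E y)⁻¹ = 1 + y * κ y := by
    intro y
    have := sub_smul_dslope (fun y => (E y)⁻¹) 0 y
    simp only [sub_zero, smul_eq_mul, hE0, inv_one] at this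
    linear_combination -this
  refine ⟨_, exists_isPoleChart (A := (α₂ - α₁ : ℝ) * Z)
    (B := fun y => Real.log lam - α₁ * (Z + y) +
      (α₂ - α₁ : ℝ) * Z * κ y + (α₂ - α₁ : ℝ) * (E y)⁻¹) ?_ ?_ ?_⟩
  · refine mul_ne_zero ?_ hZ0
    exact_mod_cast (by linarith : α₂ - α₁ ≠ 0)
  · have h1 : AnalyticAt ℂ (fun y : ℂ => (Real.log lam : ℂ) - α₁ * (Z + y)) 0 := by fun_prop
    exact (h1.add (analyticAt_const.mul hκa)).add (analyticAt_const.mul hEinv)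
  · have hne : ∀ᶠ y in 𝓝[≠] (0 : ℂ), E y ≠ 0 :=
      (hEa.continuousAt.eventually_ne (by rw [hE0]; exact one_ne_zero)).filter_mono
        nhdsWithin_le_nhds
    filter_upwards [hne, self_mem_nhdsWithin] with y hy hy0
    have hy0 : y ≠ 0 := hy0
    have hc0 : (c : ℂ) ≠ 0 := by exact_mod_cast hc.ne'
    rw [logRatio, exp_cutPoint_add hc hω]
    have h2 : -(c : ℂ) * Complex.exp y + c = -(c * (y * E y)) := by rw [← hexp]; ring
    rw [h2]
    have h3 := hκe y
    have h4 : (E y)⁻¹ * E y = 1 := inv_mul_cancel₀ hy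
    have h5 : (((α₂ - α₁) * c : ℝ) : ℂ) / -(c * (y * E y)) =
        -((α₂ - α₁ : ℝ) * y⁻¹ * (E y)⁻¹) := by
      push_cast; field_simp
    rw [h5]
    have h6 : y⁻¹ * y = 1 := inv_mul_cancel₀ hy0
    have h7 : y⁻¹ * (E y)⁻¹ = y⁻¹ + κ y := by rw [h3]; linear_combination κ y * h6
    rw [div_eq_mul_inv]
    linear_combination ((α₂ - α₁ : ℝ) : ℂ) * (Z * h7) + ((α₂ - α₁ : ℝ) : ℂ) * (E y)⁻¹ * h6

end Singularity

/-! ### The poles are isolated and accumulate only at `-c` -/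

section Poles

variable {α₁ α₂ c lam : ℝ}

lemma exp_add_eq_zero_of_abs_im_le (hc : 0 < c) {ζ : ℂ} (h : |ζ.im| ≤ Real.pi)
    (h0 : Complex.exp ζ + c = 0) : ζ = cutPoint c Real.pi ∨ ζ = cutPoint c (-Real.pi) := by
  have h1 : Complex.exp ζ = Complex.exp (cutPoint c Real.pi) := by
    have := exp_cutPoint_add hc (ω := Real.pi) (abs_of_pos Real.pi_pos) 0
    rw [add_zero] at this
    rw [this, Complex.exp_zero]
    linear_combination h0
  obtain ⟨k, hk⟩ := Complex.exp_eq_exp_iff_exists_int.1 h1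
  have him : ζ.im = Real.pi * (1 + 2 * k) := by
    rw [hk]; simp; ring
  have hpi := Real.pi_pos
  rw [him, abs_le] at h
  have hk1 : (k : ℝ) ≤ 0 := by
    by_contra hneg
    push Not at hneg
    nlinarith [h.2]
  have hk2 : (-1 : ℝ) ≤ k := by
    by_contra hneg
    push Not at hneg
    nlinarith [h.1]
  have hk1' : k ≤ 0 := by exact_mod_cast hk1
  have hk2' : -1 ≤ k := by exact_mod_cast hk2
  obtain rfl | rfl : k = 0 ∨ k = -1 := by omega
  · left; simpa using hk
  · right; rw [hk, cutPoint, cutPoint]; push_cast; ring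

lemma analyticOnNhd_one_add_exp : AnalyticOnNhd ℂ
    (fun ζ => 1 + Complex.exp (logRatio α₁ α₂ c lam ζ)) {ζ | Complex.exp ζ + c ≠ 0} := by
  have ho : IsOpen {ζ : ℂ | Complex.exp ζ + c ≠ 0} :=
    isOpen_ne.preimage (by fun_prop : Continuous fun ζ : ℂ => Complex.exp ζ + c)
  refine DifferentiableOn.analyticOnNhd (fun ζ hζ => ?_) ho
  exact ((differentiableAt_logRatio hζ).cexp.const_add 1).differentiableWithinAt

lemma isPreconnected_exp_add_ne_zero (c : ℝ) :
    IsPreconnected {ζ : ℂ | Complex.exp ζ + c ≠ 0} := by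
  have hcount : {ζ : ℂ | Complex.exp ζ + c = 0}.Countable := by
    refine (countable_range fun k : ℤ => Complex.log (-c) + k * (2 * Real.pi * Complex.I)).mono ?_
    intro ζ hζ
    have hζ : Complex.exp ζ + c = 0 := hζ
    have h1 : Complex.exp ζ = -c := by linear_combination hζ
    have h2 : Complex.exp ζ = Complex.exp (Complex.log (-c)) := by
      rw [Complex.exp_log (by rw [← h1]; exact Complex.exp_ne_zero _), h1]
    obtain ⟨k, hk⟩ := Complex.exp_eq_exp_iff_exists_int.1 h2
    exact ⟨k, hk.symm⟩
  exact (hcount.isConnected_compl_of_one_lt_rank (by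
    rw [Complex.rank_real_complex]; exact Nat.one_lt_ofNat)).isPreconnected

/-- `1 + e ^ logRatio` vanishes identically near no point, as it tends to `1` at `+∞`. -/
lemma eventually_one_add_exp_ne_zero (hα₁ : 0 < α₁) (hα : α₁ < α₂) (hc : 0 < c) (hlam : 0 < lam)
    {ζ : ℂ} (hζ : Complex.exp ζ + c ≠ 0) :
    ∀ᶠ x in 𝓝[≠] ζ, 1 + Complex.exp (logRatio α₁ α₂ c lam x) ≠ 0 := by
  by_contra hev
  have hfreq := not_eventually.1 hev
  simp only [not_not] at hfreq
  have h := analyticOnNhd_one_add_exp.eqOn_zero_of_preconnected_of_frequently_eq_zero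
    (isPreconnected_exp_add_ne_zero c) hζ hfreq
  obtain ⟨X, K, -, -, h1, -⟩ := exists_logTransform_ends hα₁ hα hc hlam
  refine (h1 (X : ℂ) (by simp [Real.pi_pos.le]) (by simp)).1 (h ?_)
  have : (0 : ℝ) < Real.exp X + c := by positivity
  rw [mem_ofPred_eq]
  rw [← Complex.ofReal_exp]
  exact_mod_cast this.ne'

lemma abs_log_im_le (z : ℂ) : |(Complex.log z).im| ≤ Real.pi := by
  rw [Complex.log_im]; exact Complex.abs_arg_le_pi z

/-- Only finitely many poles stay away from `-c` in logarithmic coordinates. -/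
lemma finite_poles_far (hα₁ : 0 < α₁) (hα : α₁ < α₂) (hc : 0 < c) (hlam : 0 < lam) {r : ℝ}
    (hr : 0 < r) : {z | z ∈ poles α₁ α₂ c lam ∧ r ≤ ‖Complex.log z - cutPoint c Real.pi‖ ∧
      r ≤ ‖Complex.log z - cutPoint c (-Real.pi)‖}.Finite := by
  obtain ⟨X, hX⟩ := exists_norm_bounds_poles hα₁ hα hc hlam
  set S : Set ℂ := (Icc (-X) X ×ℂ Icc (-Real.pi) Real.pi) ∩
    {ζ | r ≤ ‖ζ - cutPoint c Real.pi‖ ∧ r ≤ ‖ζ - cutPoint c (-Real.pi)‖} with hS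
  have hScomp : IsCompact S := by
    refine (isCompact_Icc.reProdIm isCompact_Icc).inter_right ?_
    exact (isClosed_le (f := fun _ : ℂ => r) (g := fun ζ : ℂ => ‖ζ - cutPoint c Real.pi‖)
      continuous_const (by fun_prop)).inter (isClosed_le (f := fun _ : ℂ => r)
        (g := fun ζ : ℂ => ‖ζ - cutPoint c (-Real.pi)‖) continuous_const (by fun_prop))
  have hSU : ∀ ζ ∈ S, Complex.exp ζ + c ≠ 0 := by
    intro ζ hζ h0
    rcases exp_add_eq_zero_of_abs_im_le hc (abs_le.2 hζ.1.2) h0 with h | h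
    · have := hζ.2.1
      rw [h, sub_self, norm_zero] at this
      linarith
    · have := hζ.2.2
      rw [h, sub_self, norm_zero] at this
      linarith
  have hfin : {ζ | ζ ∈ S ∧ 1 + Complex.exp (logRatio α₁ α₂ c lam ζ) = 0}.Finite := by
    by_contra hinf
    obtain ⟨x, hx, hacc⟩ := Set.Infinite.exists_accPt_of_subset_isCompact hinf hScomp
      (fun ζ hζ => hζ.1)
    rw [accPt_iff_frequently_nhdsNE] at hacc
    obtain ⟨ζ, hζ, h⟩ := (hacc.and_eventually
      (eventually_one_add_exp_ne_zero hα₁ hα hc hlam (hSU x hx))).exists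
    exact h hζ.2
  refine Finite.of_finite_image (f := Complex.log) (hfin.subset ?_) ?_
  · rintro _ ⟨z, ⟨hz, h1, h2⟩, rfl⟩
    have hb := hX z hz
    have hz' := (mem_poles_iff hc hlam).1 hz
    have hz0 := norm_pos_iff.2 (Complex.slitPlane_ne_zero hz'.1)
    refine ⟨⟨⟨?_, abs_le.1 (abs_log_im_le z)⟩, h1, h2⟩, hz'.2⟩
    rw [mem_preimage, Complex.log_re]
    exact ⟨((Real.lt_log_iff_exp_lt hz0).2 hb.1).le, ((Real.log_lt_iff_lt_exp hz0).2 hb.2).le⟩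
  · intro z hz w hw heq
    have hz0 := Complex.slitPlane_ne_zero hz.1.1
    have hw0 := Complex.slitPlane_ne_zero hw.1.1
    rw [← Complex.exp_log hz0, heq, Complex.exp_log hw0]

/-- Every pole is the only one in some closed disc contained in the cut plane. -/
lemma exists_isolating_radius (hα₁ : 0 < α₁) (hα : α₁ < α₂) (hc : 0 < c) (hlam : 0 < lam) {z : ℂ}
    (hz : z ∈ Complex.slitPlane) : ∃ ϱ : ℝ, 0 < ϱ ∧ ϱ ≤ 1 ∧ ∀ σ : ℂ, ‖σ - z‖ ≤ ϱ →
      σ ∈ Complex.slitPlane ∧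
      (σ ≠ z → 1 + Complex.exp (logRatio α₁ α₂ c lam (Complex.log σ)) ≠ 0) := by
  have hz0 := Complex.slitPlane_ne_zero hz
  have h1 : ∀ᶠ σ in 𝓝[≠] z,
      1 + Complex.exp (logRatio α₁ α₂ c lam (Complex.log σ)) ≠ 0 := by
    have hne : Complex.exp (Complex.log z) + c ≠ 0 := by
      rw [Complex.exp_log hz0]; exact slitPlane_add_ne_zero hc hz
    have ht : Tendsto Complex.log (𝓝[≠] z) (𝓝[≠] Complex.log z) := by
      refine tendsto_nhdsWithin_iff.2
        ⟨(continuousAt_clog hz).tendsto.mono_left nhdsWithin_le_nhds, ?_⟩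
      filter_upwards [self_mem_nhdsWithin, mem_nhdsWithin_of_mem_nhds (isOpen_ne.mem_nhds hz0)]
        with σ hσ hσ0 heq
      refine hσ ?_
      have heq : Complex.log σ = Complex.log z := heq
      rw [mem_singleton_iff, ← Complex.exp_log hσ0, heq, Complex.exp_log hz0]
    exact ht.eventually (eventually_one_add_exp_ne_zero hα₁ hα hc hlam hne)
  have h2 := (Complex.isOpen_slitPlane.mem_nhds hz)
  obtain ⟨ε, hε, h3⟩ := Metric.eventually_nhds_iff.1
    ((eventually_nhdsWithin_iff.1 h1).and h2)
  refine ⟨min (ε / 2) 1, by positivity, min_le_right _ _, fun σ hσ => ?_⟩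
  have h4 := h3 (y := σ) (by
    rw [dist_eq_norm]
    linarith [min_le_left (ε / 2) 1])
  exact ⟨h4.2, h4.1⟩

lemma differentiableAt_solutionTransform (hc : 0 < c) (hlam : 0 < lam) {σ : ℂ}
    (hσ : σ ∈ Complex.slitPlane)
    (h : 1 + Complex.exp (logRatio α₁ α₂ c lam (Complex.log σ)) ≠ 0) :
    DifferentiableAt ℂ (solutionTransform α₁ α₂ c lam) σ := by
  have hσ0 := Complex.slitPlane_ne_zero hσ
  have hne : Complex.exp (Complex.log σ) + c ≠ 0 := by
    rw [Complex.exp_log hσ0]; exact slitPlane_add_ne_zero hc hσ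
  have h1 : DifferentiableAt ℂ (fun s : ℂ => s⁻¹ * logTransform α₁ α₂ c lam (Complex.log s)) σ :=
    (differentiableAt_inv hσ0).mul
      ((differentiableAt_logTransform hne h).comp σ (Complex.differentiableAt_log hσ))
  refine h1.congr_of_eventuallyEq ?_
  filter_upwards [Complex.isOpen_slitPlane.mem_nhds hσ] with s hs
  exact solutionTransform_eq_logTransform hlam (Complex.slitPlane_ne_zero hs)
    (slitPlane_add_ne_zero hc hs)

end Poles

/-! ### Residues -/

lemma circleIntegral_eq_of_differentiableAt {f : ℂ → ℂ} {z : ℂ} {ϱ r : ℝ} (hr : 0 < r) (hrϱ : r ≤ ϱ)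
    (hf : ∀ σ : ℂ, σ ≠ z → ‖σ - z‖ ≤ ϱ → DifferentiableAt ℂ f σ) :
    (∮ σ in C(z, r), f σ) = ∮ σ in C(z, ϱ), f σ := by
  refine (Complex.circleIntegral_eq_of_differentiable_on_annulus_off_countable hr hrϱ
    countable_empty (fun σ hσ => ?_) fun σ hσ => ?_).symm
  · refine (hf σ (fun h => hσ.2 ?_) ?_).continuousAt.continuousWithinAt
    · rw [h]; exact Metric.mem_ball_self hr
    · rw [← dist_eq_norm]; exact hσ.1
  · refine hf σ (fun h => hσ.1.2 ?_) ?_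
    · rw [h]; exact Metric.mem_closedBall_self hr.le
    · rw [← dist_eq_norm]; exact (Metric.mem_ball.1 hσ.1.1).le

lemma residue_eq_circleIntegral {f : ℂ → ℂ} {z : ℂ} {ϱ : ℝ} (hϱ : 0 < ϱ)
    (hf : ∀ σ : ℂ, σ ≠ z → ‖σ - z‖ ≤ ϱ → DifferentiableAt ℂ f σ) :
    residue f z = (2 * (Real.pi : ℂ) * Complex.I)⁻¹ * ∮ σ in C(z, ϱ), f σ := by
  refine Tendsto.limUnder_eq (tendsto_const_nhds.congr' ?_)
  filter_upwards [Ioc_mem_nhdsGT hϱ] with r hr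
  rw [circleIntegral_eq_of_differentiableAt hr.1 hr.2 hf]

/-- The residue of `N / G` at a simple zero of `G`. -/
lemma residue_div {N G : ℂ → ℂ} {z : ℂ} (hN : AnalyticAt ℂ N z) (hG : AnalyticAt ℂ G z)
    (hGz : G z = 0) (hG' : deriv G z ≠ 0) :
    residue (fun σ => N σ / G σ) z = N z / deriv G z := by
  set g := dslope G z with hg
  have hga : AnalyticAt ℂ g z := by
    obtain ⟨U, hU, hUd⟩ := hG.exists_mem_nhds_analyticOnNhd
    exact ((Complex.differentiableOn_dslope hU).2 hUd.differentiableOn).analyticAt hU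
  have hgz : g z = deriv G z := dslope_same G z
  have hq : AnalyticAt ℂ (fun σ => N σ / g σ) z := hN.div hga (by rw [hgz]; exact hG')
  obtain ⟨ε, hε, h1⟩ := Metric.eventually_nhds_iff.1 hq.eventually_analyticAt
  refine Tendsto.limUnder_eq (tendsto_const_nhds.congr' ?_)
  filter_upwards [Ioo_mem_nhdsGT hε] with r hr
  have h2 : (∮ σ in C(z, r), N σ / G σ) = ∮ σ in C(z, r), (σ - z)⁻¹ • (N σ / g σ) := by
    refine circleIntegral.integral_congr hr.1.le fun σ hσ => ?_
    have h3 := sub_smul_dslope G z σ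
    rw [hGz, sub_zero, smul_eq_mul] at h3
    simp only [← h3, smul_eq_mul]
    rw [← hg, div_mul_eq_div_div_swap, div_eq_mul_inv _ (σ - z), mul_comm]
  have h4 := Complex.circleIntegral_sub_inv_smul_of_differentiable_on_off_countable
    (R := r) (c := z) (w := z) (f := fun σ => N σ / g σ) countable_empty
    (Metric.mem_ball_self hr.1)
    (fun σ hσ => (h1 (lt_of_le_of_lt hσ hr.2)).continuousAt.continuousWithinAt)
    (fun σ hσ => (h1 ((Metric.mem_ball.1 hσ.1).trans hr.2)).differentiableAt)
  rw [h2, h4, smul_eq_mul, ← mul_assoc, inv_mul_cancel₀ Complex.two_pi_I_ne_zero, one_mul, hgz]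

section SolutionResidue

variable {α₁ α₂ c lam : ℝ}

/-- Where `logRatio` has nonzero derivative, the residue of `W(s) e ^ (s t)` is explicit. -/
lemma solutionResidue_of_deriv_ne_zero (hc : 0 < c) (hlam : 0 < lam) (t : ℝ) {z : ℂ}
    (hz : z ∈ poles α₁ α₂ c lam) (hd : deriv (logRatio α₁ α₂ c lam) (Complex.log z) ≠ 0) :
    solutionResidue α₁ α₂ c lam t z =
      -Complex.exp (z * t) / deriv (logRatio α₁ α₂ c lam) (Complex.log z) := by
  obtain ⟨hzs, hz0⟩ := (mem_poles_iff hc hlam).1 hz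
  have hzne := Complex.slitPlane_ne_zero hzs
  have hne : ∀ σ ∈ Complex.slitPlane, Complex.exp (Complex.log σ) + c ≠ 0 := fun σ hσ => by
    rw [Complex.exp_log (Complex.slitPlane_ne_zero hσ)]; exact slitPlane_add_ne_zero hc hσ
  set G : ℂ → ℂ := fun σ => 1 + Complex.exp (logRatio α₁ α₂ c lam (Complex.log σ)) with hG
  set N : ℂ → ℂ := fun σ => σ⁻¹ * Complex.exp (σ * t) with hN
  have hnhds := Complex.isOpen_slitPlane.mem_nhds hzs
  have hGd : ∀ σ ∈ Complex.slitPlane, HasDerivAt G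
      (Complex.exp (logRatio α₁ α₂ c lam (Complex.log σ)) *
        (deriv (logRatio α₁ α₂ c lam) (Complex.log σ) * σ⁻¹)) σ := fun σ hσ =>
    (((differentiableAt_logRatio (hne σ hσ)).hasDerivAt.comp σ
      (Complex.hasDerivAt_log hσ)).cexp).const_add 1
  have hGa : AnalyticAt ℂ G z := DifferentiableOn.analyticAt
    (fun σ hσ => (hGd σ hσ).differentiableAt.differentiableWithinAt) hnhds
  have hNa : AnalyticAt ℂ N z := (analyticAt_id.inv hzne).mul (by fun_prop)
  have hE : Complex.exp (logRatio α₁ α₂ c lam (Complex.log z)) = -1 := by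
    linear_combination hz0
  have hdG := (hGd z hzs).deriv
  rw [hE] at hdG
  have h1 := residue_div hNa hGa hz0 (by
    rw [hdG]
    exact mul_ne_zero (by norm_num) (mul_ne_zero hd (inv_ne_zero hzne)))
  have h2 : solutionResidue α₁ α₂ c lam t z = residue (fun σ => N σ / G σ) z := by
    have hev : ∀ᶠ σ in 𝓝 z, solutionTransform α₁ α₂ c lam σ * Complex.exp (σ * t) =
        N σ / G σ := by
      filter_upwards [hnhds] with σ hσ
      rw [solutionTransform_eq_logTransform hlam (Complex.slitPlane_ne_zero hσ)
        (slitPlane_add_ne_zero hc hσ), logTransform, hN, hG, div_eq_mul_inv]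
      ring
    obtain ⟨ε, hε, h3⟩ := Metric.eventually_nhds_iff.1 hev
    rw [solutionResidue, residue, residue, limUnder, limUnder]
    congr 1
    refine Filter.map_congr ?_
    filter_upwards [Ioo_mem_nhdsGT hε] with r hr
    congr 1
    refine circleIntegral.integral_congr hr.1.le fun σ hσ => h3 ?_
    rw [mem_sphere_iff_norm] at hσ
    rw [dist_eq_norm, hσ]
    exact hr.2
  rw [h2, h1, hdG, hN]
  field_simp

/-- The poles near `-c` are simple, and their residues are `O(k⁻²)` when they are numbered by the
integers `k` with `logRatio = (2k + 1) π i`. -/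
lemma exists_summable_bound_near (hα : α₁ < α₂) (hc : 0 < c) (hlam : 0 < lam) {ω : ℝ}
    (hω : |ω| = Real.pi) : ∃ r : ℝ, 0 < r ∧ ∃ C : ℂ → ℝ,
      Summable (fun z : {z | z ∈ poles α₁ α₂ c lam ∧ ‖Complex.log z - cutPoint c ω‖ < r} => C z) ∧
      ∀ z ∈ poles α₁ α₂ c lam, ‖Complex.log z - cutPoint c ω‖ < r → ∀ t : ℝ,
        ‖solutionResidue α₁ α₂ c lam t z‖ ≤ C z * Real.exp (z.re * t) := by
  obtain ⟨A, r, hP⟩ := exists_isPoleChart_logRatio (lam := lam) hα hc hω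
  have hA := hP.pos
  refine ⟨r, hP.radius_pos, fun z => 2 / A * ‖Complex.log z - cutPoint c ω‖ ^ 2, ?_, ?_⟩
  · refine Summable.mul_left _ ?_
    -- the poles near the point over `-c` are numbered injectively by integers `k`, and their distance
    -- to it is `O(1 / |2 k + 1|)`
    have hy0 : ∀ z ∈ poles α₁ α₂ c lam, Complex.log z - cutPoint c ω ≠ 0 := by
      intro z hz h
      have hzs := ((mem_poles_iff hc hlam).1 hz).1
      have h1 := exp_cutPoint_add hc hω 0
      rw [add_zero, ← sub_eq_zero.1 h, Complex.exp_log (Complex.slitPlane_ne_zero hzs),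
        Complex.exp_zero] at h1
      exact slitPlane_add_ne_zero hc hzs (by rw [h1]; ring)
    have hk : ∀ z : {z | z ∈ poles α₁ α₂ c lam ∧ ‖Complex.log z - cutPoint c ω‖ < r}, ∃ k : ℤ,
        logRatio α₁ α₂ c lam (cutPoint c ω + (Complex.log z - cutPoint c ω)) =
          (2 * k + 1) * (Real.pi * Complex.I) := fun z => by
      rw [add_sub_cancel]
      exact exists_int_of_one_add_exp_eq_zero ((mem_poles_iff hc hlam).1 z.2.1).2
    choose k hk using hk
    have hkinj : Function.Injective k := by
      intro z w hzw
      have h1 := hP.injOn ⟨hy0 z z.2.1, z.2.2⟩ ⟨hy0 w w.2.1, w.2.2⟩ (by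
        simp only [hk, hzw])
      have h2 : Complex.log z = Complex.log w := by linear_combination h1
      apply Subtype.ext
      rw [← Complex.exp_log (Complex.slitPlane_ne_zero z.2.1.1), h2,
        Complex.exp_log (Complex.slitPlane_ne_zero w.2.1.1)]
    have hs : Summable fun z : {z | z ∈ poles α₁ α₂ c lam ∧ ‖Complex.log z - cutPoint c ω‖ < r} =>
        (2 * A / Real.pi) ^ 2 * (1 / ((2 * k z + 1 : ℤ) : ℝ) ^ 2) := by
      refine Summable.mul_left _ ?_
      exact (Real.summable_one_div_int_pow.2 one_lt_two).comp_injective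
        (i := fun z => 2 * k z + 1) fun z w h => hkinj (by
          have h : 2 * k z + 1 = 2 * k w + 1 := h
          omega)
    refine Summable.of_nonneg_of_le (fun _ => by positivity) (fun z => ?_) hs
    have h1 := hP.norm_le_of_eq (hy0 z z.2.1) z.2.2 (hk z)
    have h2 : (2 * A / Real.pi) ^ 2 * (1 / ((2 * k z + 1 : ℤ) : ℝ) ^ 2) =
        (2 * A / (Real.pi * |2 * (k z : ℝ) + 1|)) ^ 2 := by
      rw [div_pow, div_pow, mul_pow Real.pi, sq_abs]
      push_cast
      rw [div_mul_div_comm, mul_one]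
    rw [h2]
    gcongr
  · intro z hz hzr t
    have hzs := ((mem_poles_iff hc hlam).1 hz).1
    have hy0 : Complex.log z - cutPoint c ω ≠ 0 := by
      intro h
      have h1 := exp_cutPoint_add hc hω 0
      rw [add_zero, ← sub_eq_zero.1 h, Complex.exp_log (Complex.slitPlane_ne_zero hzs),
        Complex.exp_zero] at h1
      exact slitPlane_add_ne_zero hc hzs (by rw [h1]; ring)
    -- at distance `d` from its pole `logRatio` has a derivative of size at least `A / (2 d²)`, and
    -- the residue is `-e ^ (z t)` divided by it
    have h1 := hP.norm_deriv_ge hy0 hzr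
    have h2 : deriv (fun y => logRatio α₁ α₂ c lam (cutPoint c ω + y))
        (Complex.log z - cutPoint c ω) = deriv (logRatio α₁ α₂ c lam) (Complex.log z) := by
      rw [deriv_comp_const_add, add_sub_cancel]
    rw [h2] at h1
    have hn : 0 < ‖Complex.log z - cutPoint c ω‖ := norm_pos_iff.2 hy0
    have h3 : 0 < ‖deriv (logRatio α₁ α₂ c lam) (Complex.log z)‖ :=
      lt_of_lt_of_le (by positivity) h1
    rw [solutionResidue_of_deriv_ne_zero hc hlam t hz (norm_pos_iff.1 h3), norm_div, norm_neg,
      Complex.norm_exp, div_le_iff₀ h3]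
    have h4 : (z * t).re = z.re * t := by simp
    rw [h4]
    have h5 : 1 ≤ 2 / A * ‖Complex.log z - cutPoint c ω‖ ^ 2 *
        ‖deriv (logRatio α₁ α₂ c lam) (Complex.log z)‖ := by
      calc (1 : ℝ) = 2 / A * ‖Complex.log z - cutPoint c ω‖ ^ 2 *
            (A / 2 / ‖Complex.log z - cutPoint c ω‖ ^ 2) := by field_simp
        _ ≤ _ := by gcongr
    nlinarith [Real.exp_pos (z.re * t)]

lemma differentiableAt_solutionTransform_mul_exp (hc : 0 < c) (hlam : 0 < lam) (t : ℝ) {z : ℂ}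
    {ϱ : ℝ} (hϱ : ∀ σ : ℂ, ‖σ - z‖ ≤ ϱ → σ ∈ Complex.slitPlane ∧
      (σ ≠ z → 1 + Complex.exp (logRatio α₁ α₂ c lam (Complex.log σ)) ≠ 0)) (σ : ℂ) (hσ : σ ≠ z)
    (hσr : ‖σ - z‖ ≤ ϱ) :
    DifferentiableAt ℂ (fun s => solutionTransform α₁ α₂ c lam s * Complex.exp (s * t)) σ :=
  (differentiableAt_solutionTransform hc hlam (hϱ σ hσr).1 ((hϱ σ hσr).2 hσ)).mul (by fun_prop)

lemma solutionResidue_eq (hc : 0 < c) (hlam : 0 < lam) (t : ℝ) {z : ℂ} {ϱ : ℝ} (hϱ0 : 0 < ϱ)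
    (hϱ : ∀ σ : ℂ, ‖σ - z‖ ≤ ϱ → σ ∈ Complex.slitPlane ∧
      (σ ≠ z → 1 + Complex.exp (logRatio α₁ α₂ c lam (Complex.log σ)) ≠ 0)) :
    solutionResidue α₁ α₂ c lam t z = (2 * (Real.pi : ℂ) * Complex.I)⁻¹ *
      ∮ σ in C(z, ϱ), solutionTransform α₁ α₂ c lam σ * Complex.exp (σ * t) :=
  residue_eq_circleIntegral hϱ0 (differentiableAt_solutionTransform_mul_exp hc hlam t hϱ)

lemma continuous_solutionTransform_circleMap (hc : 0 < c) (hlam : 0 < lam) {z : ℂ} {ϱ : ℝ}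
    (hϱ0 : 0 < ϱ) (hϱ : ∀ σ : ℂ, ‖σ - z‖ ≤ ϱ → σ ∈ Complex.slitPlane ∧
      (σ ≠ z → 1 + Complex.exp (logRatio α₁ α₂ c lam (Complex.log σ)) ≠ 0)) :
    Continuous fun θ : ℝ => solutionTransform α₁ α₂ c lam (circleMap z ϱ θ) := by
  refine continuous_iff_continuousAt.2 fun θ => ?_
  have h1 : ‖circleMap z ϱ θ - z‖ ≤ ϱ := by simp [circleMap, abs_of_pos hϱ0]
  have h2 : ContinuousAt (solutionTransform α₁ α₂ c lam) (circleMap z ϱ θ) :=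
    (differentiableAt_solutionTransform hc hlam (hϱ _ h1).1
      ((hϱ _ h1).2 (circleMap_ne_center hϱ0.ne'))).continuousAt
  exact h2.comp (continuous_circleMap z ϱ).continuousAt

lemma continuous_solutionResidue (hα₁ : 0 < α₁) (hα : α₁ < α₂) (hc : 0 < c) (hlam : 0 < lam)
    {z : ℂ} (hz : z ∈ Complex.slitPlane) :
    Continuous fun t => solutionResidue α₁ α₂ c lam t z := by
  obtain ⟨ϱ, hϱ0, -, hϱ⟩ := exists_isolating_radius (lam := lam) hα₁ hα hc hlam hz
  simp only [solutionResidue_eq hc hlam _ hϱ0 hϱ, circleIntegral]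
  refine continuous_const.mul ?_
  refine intervalIntegral.continuous_parametric_intervalIntegral_of_continuous' ?_ _ _
  have h1 := continuous_solutionTransform_circleMap hc hlam hϱ0 hϱ
  have h2 : Continuous fun p : ℝ × ℝ => solutionTransform α₁ α₂ c lam (circleMap z ϱ p.2) :=
    h1.comp continuous_snd
  have h3 : Continuous fun p : ℝ × ℝ => circleMap z ϱ p.2 :=
    (continuous_circleMap z ϱ).comp continuous_snd
  have h4 : Continuous fun p : ℝ × ℝ => deriv (circleMap z ϱ) p.2 := by
    simp only [deriv_circleMap]
    exact ((continuous_circleMap 0 ϱ).comp continuous_snd).mul continuous_const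
  simp only [Function.uncurry_def, smul_eq_mul]
  exact h4.mul (h2.mul ((h3.mul (by fun_prop)).cexp))

/-- The Laplace transform of the residue of `W(σ) e ^ (σ t)` at `z` is the contribution of `z` to
the partial fraction expansion of `W`. -/
lemma hasLaplaceAt_solutionResidue (hc : 0 < c) (hlam : 0 < lam) {z : ℂ} {ϱ : ℝ} (hϱ0 : 0 < ϱ)
    (hϱ : ∀ σ : ℂ, ‖σ - z‖ ≤ ϱ → σ ∈ Complex.slitPlane ∧
      (σ ≠ z → 1 + Complex.exp (logRatio α₁ α₂ c lam (Complex.log σ)) ≠ 0)) {s : ℂ}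
    (hs : z.re + ϱ < s.re) :
    HasLaplaceAt (fun t => solutionResidue α₁ α₂ c lam t z) s
      ((2 * (Real.pi : ℂ) * Complex.I)⁻¹ *
        ∮ σ in C(z, ϱ), solutionTransform α₁ α₂ c lam σ / (s - σ)) := by
  have hcont := continuous_solutionTransform_circleMap hc hlam hϱ0 hϱ
  have hre : ∀ θ : ℝ, (circleMap z ϱ θ).re ≤ z.re + ϱ := fun θ => by
    have h1 := Complex.re_le_norm (circleMap z ϱ θ - z)
    have h2 : ‖circleMap z ϱ θ - z‖ = ϱ := by simp [circleMap, abs_of_pos hϱ0]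
    rw [h2, Complex.sub_re] at h1
    linarith
  set D : ℝ → ℂ := fun θ => deriv (circleMap z ϱ) θ * solutionTransform α₁ α₂ c lam (circleMap z ϱ θ)
    with hD
  have hDc : Continuous D := by
    simp only [hD, deriv_circleMap]
    exact ((continuous_circleMap 0 ϱ).mul continuous_const).mul hcont
  set H : ℝ → ℝ → ℂ := fun t θ => D θ * Complex.exp ((circleMap z ϱ θ - s) * t) with hH
  have e1 : ∀ t : ℝ, Complex.exp (-s * (t : ℂ)) * solutionResidue α₁ α₂ c lam t z =
      (2 * (Real.pi : ℂ) * Complex.I)⁻¹ * ∫ θ in Ioc 0 (2 * Real.pi), H t θ := by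
    intro t
    rw [solutionResidue_eq hc hlam t hϱ0 hϱ, circleIntegral,
      intervalIntegral.integral_of_le Real.two_pi_pos.le, mul_left_comm, ← integral_const_mul]
    congr 2
    ext θ
    simp only [hH, hD, smul_eq_mul]
    rw [sub_mul, sub_eq_add_neg, Complex.exp_add, neg_mul]
    ring
  have hexp : IntegrableOn (fun t : ℝ => Real.exp (-(s.re - z.re - ϱ) * t)) (Ioi 0) :=
    integrableOn_exp_mul_Ioi (by linarith) 0
  have hDi : IntegrableOn (fun θ => ‖D θ‖) (Ioc 0 (2 * Real.pi)) :=
    (hDc.norm.continuousOn.integrableOn_Icc).mono_set Ioc_subset_Icc_self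
  have hint : Integrable (Function.uncurry H)
      ((volume.restrict (Ioi 0)).prod (volume.restrict (Ioc 0 (2 * Real.pi)))) := by
    refine (hexp.mul_prod hDi).mono' ?_ ?_
    · refine Continuous.aestronglyMeasurable ?_
      simp only [Function.uncurry_def, hH]
      have h3 : Continuous fun p : ℝ × ℝ => circleMap z ϱ p.2 :=
        (continuous_circleMap z ϱ).comp continuous_snd
      exact (hDc.comp continuous_snd).mul (((h3.sub continuous_const).mul (by fun_prop)).cexp)
    · rw [Measure.prod_restrict]
      refine (ae_restrict_iff' (measurableSet_Ioi.prod measurableSet_Ioc)).2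
        (Eventually.of_forall fun p hp => ?_)
      have hp1 : 0 < p.1 := hp.1
      simp only [Function.uncurry_def, hH]
      rw [norm_mul, Complex.norm_exp, mul_comm]
      gcongr
      simp only [Complex.mul_re, Complex.sub_re, Complex.ofReal_re, Complex.ofReal_im, mul_zero,
        sub_zero]
      have := hre p.2
      nlinarith
  refine ⟨?_, ?_⟩
  · simp only [e1]
    exact hint.integral_prod_left.const_mul _
  · simp only [e1]
    rw [integral_const_mul, integral_integral_swap hint, circleIntegral,
      intervalIntegral.integral_of_le Real.two_pi_pos.le]
    congr 2
    ext θ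
    simp only [hH]
    have h5 : (circleMap z ϱ θ - s).re < 0 := by
      rw [Complex.sub_re]; linarith [hre θ]
    have h6 : s - circleMap z ϱ θ ≠ 0 := fun h => by
      have := congrArg Complex.re h
      rw [Complex.sub_re, Complex.zero_re] at this
      rw [Complex.sub_re] at h5
      linarith
    rw [integral_const_mul, integral_exp_mul_complex_Ioi h5]
    simp only [Complex.ofReal_zero, mul_zero, Complex.exp_zero, hD, smul_eq_mul]
    rw [← neg_sub s, neg_div_neg_eq]
    field_simp

/-- Summable bounds for the residues, uniform in `t` up to an exponential factor. -/
lemma exists_summable_bound (hα₁ : 0 < α₁) (hα : α₁ < α₂) (hc : 0 < c) (hlam : 0 < lam) :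
    ∃ (M : ℝ) (C : ℂ → ℝ), (∀ z ∈ poles α₁ α₂ c lam, z.re < M) ∧
      Summable (fun z : poles α₁ α₂ c lam => C z) ∧
      ∀ z ∈ poles α₁ α₂ c lam, ∀ t : ℝ, 0 ≤ t →
        ‖solutionResidue α₁ α₂ c lam t z‖ ≤ C z * Real.exp ((M + 1) * t) := by
  obtain ⟨X, hX⟩ := exists_norm_bounds_poles hα₁ hα hc hlam
  set M := Real.exp X with hM
  have hMre : ∀ z ∈ poles α₁ α₂ c lam, z.re < M := fun z hz =>
    (Complex.re_le_norm z).trans_lt (hX z hz).2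
  have hπ : |Real.pi| = Real.pi := abs_of_pos Real.pi_pos
  obtain ⟨r₁, hr₁, C₁, hs₁, hb₁⟩ := exists_summable_bound_near hα hc hlam hπ
  obtain ⟨r₂, hr₂, C₂, hs₂, hb₂⟩ := exists_summable_bound_near hα hc hlam
    ((abs_neg Real.pi).trans hπ)
  set N₁ := {z | z ∈ poles α₁ α₂ c lam ∧ ‖Complex.log z - cutPoint c Real.pi‖ < r₁} with hN₁
  set N₂ := {z | z ∈ poles α₁ α₂ c lam ∧ ‖Complex.log z - cutPoint c (-Real.pi)‖ < r₂} with hN₂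
  set F := {z | z ∈ poles α₁ α₂ c lam ∧ min r₁ r₂ ≤ ‖Complex.log z - cutPoint c Real.pi‖ ∧
      min r₁ r₂ ≤ ‖Complex.log z - cutPoint c (-Real.pi)‖} with hF
  have hFfin : F.Finite := finite_poles_far hα₁ hα hc hlam (lt_min hr₁ hr₂)
  -- the finitely many poles away from `-c` may be multiple; their residues are bounded as circle
  -- integrals over circles of radius at most `1`
  have hB : ∀ z ∈ poles α₁ α₂ c lam, ∃ B : ℝ, 0 ≤ B ∧ ∀ t : ℝ, 0 ≤ t →
      ‖solutionResidue α₁ α₂ c lam t z‖ ≤ B * Real.exp ((M + 1) * t) := by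
    intro z hz
    obtain ⟨ϱ, hϱ0, hϱ1, hϱ⟩ := exists_isolating_radius hα₁ hα hc hlam
      ((mem_poles_iff hc hlam).1 hz).1
    obtain ⟨K, hK⟩ := (isCompact_sphere z ϱ).exists_bound_of_continuousOn
      (f := solutionTransform α₁ α₂ c lam) fun σ hσ => by
        rw [mem_sphere_iff_norm] at hσ
        refine (differentiableAt_solutionTransform hc hlam (hϱ σ hσ.le).1
          ((hϱ σ hσ.le).2 fun h => ?_)).continuousAt.continuousWithinAt
        rw [h, sub_self, norm_zero] at hσ
        linarith
    have hK0 : 0 ≤ K := (norm_nonneg _).trans (hK (z + ϱ) (by simp [abs_of_pos hϱ0]))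
    refine ⟨‖(2 * (Real.pi : ℂ) * Complex.I)⁻¹‖ * (2 * Real.pi * ϱ * K), by
      have := Real.pi_pos; positivity, fun t ht => ?_⟩
    rw [solutionResidue_eq hc hlam t hϱ0 hϱ, norm_mul]
    refine (mul_le_mul_of_nonneg_left (circleIntegral.norm_integral_le_of_norm_le_const hϱ0.le
      (C := K * Real.exp ((M + 1) * t)) fun σ hσ => ?_) (norm_nonneg _)).trans (le_of_eq (by ring))
    rw [norm_mul, Complex.norm_exp]
    have h2 : σ.re ≤ M + 1 := by
      rw [mem_sphere_iff_norm] at hσ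
      have h3 := Complex.re_le_norm (σ - z)
      rw [Complex.sub_re] at h3
      linarith [hMre z hz]
    have h4 : (σ * t).re = σ.re * t := by simp
    rw [h4]
    gcongr
    exact hK σ hσ
  choose! B hB0 hB using hB
  have hle : ∀ z ∈ poles α₁ α₂ c lam, z.re ≤ M + 1 := fun z hz => by linarith [hMre z hz]
  have hC₁ : ∀ z ∈ N₁, 0 ≤ C₁ z := fun z hz => by
    have := (norm_nonneg _).trans (hb₁ z hz.1 hz.2 0)
    simpa using this
  have hC₂ : ∀ z ∈ N₂, 0 ≤ C₂ z := fun z hz => by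
    have := (norm_nonneg _).trans (hb₂ z hz.1 hz.2 0)
    simpa using this
  have hFpos : ∀ z, 0 ≤ F.indicator B z := indicator_nonneg fun z hz => hB0 z hz.1
  have hN₁pos : ∀ z, 0 ≤ N₁.indicator C₁ z := indicator_nonneg hC₁
  have hN₂pos : ∀ z, 0 ≤ N₂.indicator C₂ z := indicator_nonneg hC₂
  refine ⟨M, fun z => F.indicator B z + N₁.indicator C₁ z + N₂.indicator C₂ z, hMre, ?_,
    fun z hz t ht => ?_⟩
  · have hsF : Summable (F.indicator B) :=
      summable_of_hasFiniteSupport (hFfin.subset support_indicator_subset)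
    exact ((hsF.add (summable_subtype_iff_indicator.1 hs₁)).add
      (summable_subtype_iff_indicator.1 hs₂)).subtype _
  · by_cases h1 : z ∈ N₁
    · calc _ ≤ C₁ z * Real.exp (z.re * t) := hb₁ z hz h1.2 t
        _ ≤ C₁ z * Real.exp ((M + 1) * t) := by gcongr; exacts [hC₁ z h1, hle z hz]
        _ ≤ _ := by
          gcongr
          simp only [indicator_of_mem h1]
          linarith [hFpos z, hN₂pos z]
    by_cases h2 : z ∈ N₂
    · calc _ ≤ C₂ z * Real.exp (z.re * t) := hb₂ z hz h2.2 t
        _ ≤ C₂ z * Real.exp ((M + 1) * t) := by gcongr; exacts [hC₂ z h2, hle z hz]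
        _ ≤ _ := by
          gcongr
          simp only [indicator_of_mem h2]
          linarith [hFpos z, hN₁pos z]
    have h3 : z ∈ F := by
      refine ⟨hz, (min_le_left _ _).trans ?_, (min_le_right _ _).trans ?_⟩
      · by_contra h; exact h1 ⟨hz, not_le.1 h⟩
      · by_contra h; exact h2 ⟨hz, not_le.1 h⟩
    refine (hB z hz t ht).trans ?_
    gcongr
    simp only [indicator_of_mem h3]
    linarith [hN₁pos z, hN₂pos z]

end SolutionResidue

/-! ### The integrand as a jump across the branch cut -/

section CutIntegrand

variable {α₁ α₂ c lam : ℝ}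

lemma cutPoint_pi_eq_log {ρ : ℝ} (hρ : 0 < ρ) : cutPoint ρ Real.pi = Complex.log (-(ρ : ℂ)) := by
  apply Complex.ext
  · rw [cutPoint_re, Complex.log_re, norm_neg, Complex.norm_real, Real.norm_of_nonneg hρ.le]
  · rw [cutPoint_im, Complex.log_im, ← Complex.ofReal_neg, Complex.arg_ofReal_of_neg (by linarith)]

lemma cutPoint_neg (ρ ω : ℝ) : cutPoint ρ (-ω) = (starRingEnd ℂ) (cutPoint ρ ω) := by
  simp [cutPoint]

lemma exp_cutPoint {ρ : ℝ} (hρ : 0 < ρ) {ω : ℝ} (hω : |ω| = Real.pi) :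
    Complex.exp (cutPoint ρ ω) = -ρ := by
  simpa using exp_cutPoint_add hρ hω 0

lemma exp_cutPoint_add_ne_zero {ρ : ℝ} (hρ : 0 < ρ) (hρc : ρ ≠ c) {ω : ℝ} (hω : |ω| = Real.pi) :
    Complex.exp (cutPoint ρ ω) + c ≠ 0 := by
  rw [exp_cutPoint hρ hω, ← Complex.ofReal_neg, ← Complex.ofReal_add, Complex.ofReal_ne_zero]
  intro h
  exact hρc (by linarith)

lemma logRatio_cutPoint {ρ : ℝ} (hρ : 0 < ρ) (hρc : ρ ≠ c) {ω : ℝ} (hω : |ω| = Real.pi) :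
    logRatio α₁ α₂ c lam (cutPoint ρ ω) = Real.log lam + expo α₁ α₂ c ρ * cutPoint ρ ω := by
  rw [logRatio, exp_cutPoint hρ hω, sub_eq_add_neg, ← neg_mul]
  congr 2
  rw [expo]
  have h : (c : ℂ) - ρ ≠ 0 := by
    rw [← Complex.ofReal_sub, Complex.ofReal_ne_zero]
    intro h
    exact hρc (by linarith)
  have h' : -(ρ : ℂ) + c ≠ 0 := by rw [neg_add_eq_sub]; exact h
  push_cast
  field_simp
  ring

lemma logRatio_cutPoint_re {ρ : ℝ} (hρ : 0 < ρ) (hρc : ρ ≠ c) {ω : ℝ} (hω : |ω| = Real.pi) :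
    (logRatio α₁ α₂ c lam (cutPoint ρ ω)).re =
      Real.log lam + expo α₁ α₂ c ρ * Real.log ρ := by
  rw [logRatio_cutPoint hρ hρc hω]
  simp

lemma logRatio_cutPoint_im {ρ : ℝ} (hρ : 0 < ρ) (hρc : ρ ≠ c) {ω : ℝ} (hω : |ω| = Real.pi) :
    (logRatio α₁ α₂ c lam (cutPoint ρ ω)).im = expo α₁ α₂ c ρ * ω := by
  rw [logRatio_cutPoint hρ hρc hω]
  simp

lemma integrand_eq_mul_exp (t ρ : ℝ) : integrand α₁ α₂ c lam t ρ =
    integrand α₁ α₂ c lam 0 ρ * (Real.exp (-ρ * t) : ℝ) := by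
  rw [integrand, integrand, mul_zero, Real.exp_zero]
  push_cast
  ring

lemma inv_one_add_sub_inv_one_add_conj (E : ℂ) : (1 + E)⁻¹ - (1 + (starRingEnd ℂ) E)⁻¹ =
    -(2 * E.im * Complex.I) / ((1 + 2 * E.re + (E.re ^ 2 + E.im ^ 2) : ℝ) : ℂ) := by
  have hn : ((1 + 2 * E.re + (E.re ^ 2 + E.im ^ 2) : ℝ) : ℂ) = (1 + E) * (1 + (starRingEnd ℂ) E) := by
    have h1 : 1 + (starRingEnd ℂ) E = (starRingEnd ℂ) (1 + E) := by simp
    rw [h1, Complex.mul_conj, Complex.normSq_apply]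
    simp only [Complex.add_re, Complex.add_im, Complex.one_re, Complex.one_im]
    push_cast
    ring
  rw [hn]
  by_cases h : 1 + E = 0
  · have h' : 1 + (starRingEnd ℂ) E = 0 := by
      have := congrArg (starRingEnd ℂ) h
      simpa using this
    simp [h, h']
  · have h' : 1 + (starRingEnd ℂ) E ≠ 0 := by
      intro h1
      have := congrArg (starRingEnd ℂ) h1
      exact h (by simpa using this)
    have h2 : (2 : ℂ) * E.im * Complex.I = E - (starRingEnd ℂ) E := by
      rw [Complex.sub_conj]; push_cast; ring
    rw [h2]
    field_simp
    ring

/-- The integrand is `e ^ (-ρ t)` times the jump of `W` across the cut at `-ρ`. -/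
lemma integrand_eq_jump (hlam : 0 < lam) (t : ℝ) {ρ : ℝ} (hρ : 0 < ρ) (hρc : ρ ≠ c) :
    integrand α₁ α₂ c lam t ρ = -((ρ : ℂ)⁻¹ * (logTransform α₁ α₂ c lam (cutPoint ρ Real.pi) -
      logTransform α₁ α₂ c lam (cutPoint ρ (-Real.pi))) * (Real.exp (-ρ * t) : ℝ)) := by
  have hπ : |Real.pi| = Real.pi := abs_of_pos Real.pi_pos
  rw [cutPoint_neg, logTransform, logTransform, logRatio_conj, Complex.exp_conj,
    inv_one_add_sub_inv_one_add_conj, Complex.exp_re, Complex.exp_im,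
    logRatio_cutPoint_re hρ hρc hπ, logRatio_cutPoint_im hρ hρc hπ, integrand]
  have h1 : Real.exp (Real.log lam + expo α₁ α₂ c ρ * Real.log ρ) = lam * ρ ^ expo α₁ α₂ c ρ := by
    rw [Real.exp_add, Real.exp_log hlam, Real.rpow_def_of_pos hρ, mul_comm (Real.log ρ)]
  have h2 : ρ ^ (2 * expo α₁ α₂ c ρ) = (ρ ^ expo α₁ α₂ c ρ) ^ 2 := by
    rw [mul_comm, Real.rpow_mul hρ.le, ← Real.rpow_natCast]; norm_num
  rw [h1, h2, mul_comm (expo α₁ α₂ c ρ) Real.pi]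
  set θ := Real.pi * expo α₁ α₂ c ρ
  set P := ρ ^ expo α₁ α₂ c ρ
  have h3 : ρ * (1 + 2 * lam * P * Real.cos θ + lam ^ 2 * P ^ 2) = ρ * (1 + 2 * (lam * P * Real.cos θ)
      + ((lam * P * Real.cos θ) ^ 2 + (lam * P * Real.sin θ) ^ 2)) := by
    linear_combination (-ρ * lam ^ 2 * P ^ 2) * Real.sin_sq_add_cos_sq θ
  rw [h3]
  push_cast
  rw [div_eq_mul_inv, div_eq_mul_inv, mul_inv]
  ring

lemma norm_integrand_le (hlam : 0 < lam) {t : ℝ} (ht : 0 ≤ t) {ρ : ℝ} (hρ : 0 < ρ) (hρc : ρ ≠ c) :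
    ‖integrand α₁ α₂ c lam t ρ‖ ≤
      2 * ρ⁻¹ * |(logTransform α₁ α₂ c lam (cutPoint ρ Real.pi)).im| := by
  rw [integrand_eq_jump hlam t hρ hρc, cutPoint_neg, logTransform_conj, Complex.sub_conj, norm_neg,
    norm_mul, norm_mul, norm_mul, Complex.norm_I, mul_one, Complex.norm_real, Complex.norm_real,
    norm_inv, Complex.norm_real, Real.norm_of_nonneg hρ.le, Real.norm_eq_abs, Real.norm_eq_abs,
    abs_mul, abs_two, abs_of_pos (Real.exp_pos _)]
  have h1 : Real.exp (-ρ * t) ≤ 1 := Real.exp_le_one_iff.2 (by nlinarith)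
  calc _ ≤ ρ⁻¹ * (2 * |(logTransform α₁ α₂ c lam (cutPoint ρ Real.pi)).im|) * 1 := by gcongr
    _ = _ := by ring

lemma norm_integrand_le_zero {t : ℝ} (ht : 0 ≤ t) {ρ : ℝ} (hρ : 0 < ρ) :
    ‖integrand α₁ α₂ c lam t ρ‖ ≤ ‖integrand α₁ α₂ c lam 0 ρ‖ := by
  rw [integrand_eq_mul_exp, norm_mul, Complex.norm_real, Real.norm_eq_abs,
    abs_of_pos (Real.exp_pos _)]
  exact mul_le_of_le_one_right (norm_nonneg _) (Real.exp_le_one_iff.2 (by nlinarith))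

lemma integrand_self (t : ℝ) : integrand α₁ α₂ c lam t c = 0 := by
  -- `expo` has the junk value `0` at `c`, so the sine vanishes
  simp [integrand, expo]

lemma measurable_integrand (t : ℝ) : Measurable (integrand α₁ α₂ c lam t) := by
  unfold integrand expo
  fun_prop

lemma one_add_exp_cutPoint_ne_zero (hlam : 0 < lam)
    (hcut : ∀ ρ : ℝ, 0 < ρ → ρ ≠ c → denom α₁ α₂ c lam (-(ρ : ℂ)) ≠ 0) {ρ : ℝ} (hρ : 0 < ρ)
    (hρc : ρ ≠ c) {ω : ℝ} (hω : |ω| = Real.pi) :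
    1 + Complex.exp (logRatio α₁ α₂ c lam (cutPoint ρ ω)) ≠ 0 := by
  have h1 : 1 + Complex.exp (logRatio α₁ α₂ c lam (cutPoint ρ Real.pi)) ≠ 0 := by
    have h2 : -(ρ : ℂ) + c ≠ 0 := by
      have := exp_cutPoint_add_ne_zero (c := c) hρ hρc (abs_of_pos Real.pi_pos)
      rwa [exp_cutPoint hρ (abs_of_pos Real.pi_pos)] at this
    have h3 := hcut ρ hρ hρc
    rwa [Ne, denom_eq_zero_iff hlam (by simpa using hρ.ne') h2, ← cutPoint_pi_eq_log hρ] at h3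
  rcases (abs_eq Real.pi_pos.le).1 hω with h | h
  · rwa [h]
  · rw [h, cutPoint_neg, logRatio_conj, Complex.exp_conj]
    intro h2
    have h3 := congrArg (starRingEnd ℂ) h2
    exact h1 (by simpa using h3)

lemma continuousAt_integrand (hlam : 0 < lam)
    (hcut : ∀ ρ : ℝ, 0 < ρ → ρ ≠ c → denom α₁ α₂ c lam (-(ρ : ℂ)) ≠ 0) (t : ℝ) {ρ : ℝ} (hρ : 0 < ρ)
    (hρc : ρ ≠ c) : ContinuousAt (integrand α₁ α₂ c lam t) ρ := by
  have h1 : ∀ ω : ℝ, |ω| = Real.pi →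
      ContinuousAt (fun ρ => logTransform α₁ α₂ c lam (cutPoint ρ ω)) ρ := fun ω hω => by
    have h2 : ContinuousAt (fun ρ => cutPoint ρ ω) ρ := by
      unfold cutPoint
      exact (Complex.continuous_ofReal.continuousAt.comp
        (Real.continuousAt_log hρ.ne')).add continuousAt_const
    have h3 : ContinuousAt (logTransform α₁ α₂ c lam) (cutPoint ρ ω) :=
      (differentiableAt_logTransform (exp_cutPoint_add_ne_zero hρ hρc hω)
      (one_add_exp_cutPoint_ne_zero hlam hcut hρ hρc hω)).continuousAt
    exact ContinuousAt.comp (f := fun ρ => cutPoint ρ ω) h3 h2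
  have hπ : |Real.pi| = Real.pi := abs_of_pos Real.pi_pos
  have h4 : ContinuousAt (fun ρ : ℝ => (ρ : ℂ)⁻¹) ρ :=
    Complex.continuous_ofReal.continuousAt.inv₀ (by exact_mod_cast hρ.ne')
  have h5 := (((h4.mul ((h1 _ hπ).sub (h1 _ ((abs_neg _).trans hπ)))).mul
    (by fun_prop : ContinuousAt (fun ρ : ℝ => ((Real.exp (-ρ * t) : ℝ) : ℂ)) ρ))).neg
  refine h5.congr ?_
  filter_upwards [eventually_gt_nhds hρ, isOpen_ne.mem_nhds hρc] with x hx hxc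
  rw [integrand_eq_jump hlam t hx hxc]
  rfl

end CutIntegrand

/-! ### The integrand near `ρ = c` -/

section NearCut

variable {α₁ α₂ c lam : ℝ}

lemma one_sub_exp_neg_le_norm_one_add_exp {w : ℂ} {m : ℝ} (h : m ≤ |w.re|) :
    1 - Real.exp (-m) ≤ ‖1 + Complex.exp w‖ := by
  rcases le_abs.1 h with h | h
  · have h1 : ‖Complex.exp w‖ - ‖(1 : ℂ)‖ ≤ ‖1 + Complex.exp w‖ := by
      have := norm_sub_norm_le (Complex.exp w) (-1)
      rwa [norm_neg, sub_neg_eq_add, add_comm (Complex.exp w)] at this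
    rw [Complex.norm_exp, norm_one] at h1
    have h2 := Real.add_one_le_exp w.re
    have h3 := Real.add_one_le_exp (-m)
    linarith
  · have h1 : ‖(1 : ℂ)‖ - ‖Complex.exp w‖ ≤ ‖1 + Complex.exp w‖ := by
      have := norm_sub_norm_le 1 (-Complex.exp w)
      rwa [norm_neg, sub_neg_eq_add] at this
    rw [Complex.norm_exp, norm_one] at h1
    have h2 : Real.exp w.re ≤ Real.exp (-m) := Real.exp_le_exp.2 (by linarith)
    linarith

lemma expo_eq {ρ : ℝ} (hρc : ρ ≠ c) :
    expo α₁ α₂ c ρ = -α₁ + (α₂ - α₁) * c / (ρ - c) := by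
  have h1 : ρ - c ≠ 0 := sub_ne_zero.2 hρc
  have h2 : c - ρ ≠ 0 := sub_ne_zero.2 hρc.symm
  rw [expo]
  field_simp
  ring

/-- Unless `c = 1` and `λ e ^ (α₂ - α₁) = 1`, the modulus `λ ρ ^ p(ρ)` stays away from `1` near
`ρ = c`: for `c ≠ 1` it tends to `0` or `∞`, and for `c = 1` to `λ e ^ (α₂ - α₁)`. -/
lemma exists_abs_log_rpow_expo_ge (hα : α₁ < α₂) (hc : 0 < c) (hlam : 0 < lam)
    (h : c ≠ 1 ∨ lam * Real.exp (α₂ - α₁) ≠ 1) : ∃ m : ℝ, 0 < m ∧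
      ∀ᶠ ρ in 𝓝[≠] c, m ≤ |Real.log lam + expo α₁ α₂ c ρ * Real.log ρ| := by
  by_cases hc1 : c = 1
  · subst hc1
    have h1 : Tendsto (fun ρ : ℝ => Real.log lam + (-α₁ * Real.log ρ +
        (α₂ - α₁) * (slope Real.log 1 ρ))) (𝓝[≠] 1)
        (𝓝 (Real.log lam + (-α₁ * Real.log 1 + (α₂ - α₁) * 1⁻¹))) := by
      have h2 := hasDerivAt_iff_tendsto_slope.1 (Real.hasDerivAt_log (one_ne_zero))
      have h3 : Tendsto Real.log (𝓝[≠] 1) (𝓝 (Real.log 1)) :=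
        (Real.continuousAt_log one_ne_zero).tendsto.mono_left nhdsWithin_le_nhds
      exact ((h3.const_mul _).add (h2.const_mul _)).const_add _
    rw [Real.log_one, mul_zero, zero_add, inv_one, mul_one] at h1
    have h4 : Real.log lam + (α₂ - α₁) ≠ 0 := by
      have h5 := h.resolve_left (by simp)
      intro h6
      apply h5
      rw [← Real.exp_log hlam, ← Real.exp_add, h6, Real.exp_zero]
    refine ⟨|Real.log lam + (α₂ - α₁)| / 2, by positivity, ?_⟩
    filter_upwards [h1.abs.eventually (lt_mem_nhds (half_lt_self (abs_pos.2 h4))),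
      self_mem_nhdsWithin] with ρ h5 hρ
    have hρ : ρ ≠ 1 := hρ
    refine h5.le.trans (le_of_eq ?_)
    rw [expo_eq hρ, slope_def_field, Real.log_one]
    congr 1
    ring
  · have hl : Real.log c ≠ 0 := Real.log_ne_zero_of_pos_of_ne_one hc hc1
    have hb : (α₂ - α₁) * c * Real.log c ≠ 0 :=
      mul_ne_zero (mul_ne_zero (by linarith) hc.ne') hl
    have h1 : Tendsto (fun ρ : ℝ => (Real.log lam - α₁ * Real.log ρ) * (ρ - c) +
        (α₂ - α₁) * c * Real.log ρ) (𝓝[≠] c) (𝓝 ((Real.log lam - α₁ * Real.log c) * (c - c) +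
        (α₂ - α₁) * c * Real.log c)) := by
      refine Tendsto.mono_left (ContinuousAt.tendsto ?_) nhdsWithin_le_nhds
      have := Real.continuousAt_log hc.ne'
      fun_prop
    rw [sub_self, mul_zero, zero_add] at h1
    refine ⟨|(α₂ - α₁) * c * Real.log c| / 2, by positivity, ?_⟩
    filter_upwards [h1.abs.eventually (lt_mem_nhds (half_lt_self (abs_pos.2 hb))),
      self_mem_nhdsWithin, mem_nhdsWithin_of_mem_nhds (Metric.ball_mem_nhds c one_pos)]
      with ρ h5 hρ hρ1
    have hρ : ρ ≠ c := hρ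
    have h6 : ρ - c ≠ 0 := sub_ne_zero.2 hρ
    rw [Metric.mem_ball, Real.dist_eq] at hρ1
    have h7 : (Real.log lam - α₁ * Real.log ρ) * (ρ - c) + (α₂ - α₁) * c * Real.log ρ =
        (Real.log lam + expo α₁ α₂ c ρ * Real.log ρ) * (ρ - c) := by
      rw [expo_eq hρ]
      field_simp
      ring
    rw [h7, abs_mul (Real.log lam + _)] at h5
    refine h5.le.trans ?_
    exact mul_le_of_le_one_right (abs_nonneg _) hρ1.le

lemma exists_norm_integrand_le_near (hα : α₁ < α₂) (hc : 0 < c) (hlam : 0 < lam)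
    (h : c ≠ 1 ∨ lam * Real.exp (α₂ - α₁) ≠ 1) : ∃ δ > 0, ∃ M : ℝ, ∀ t : ℝ, 0 ≤ t → ∀ ρ : ℝ, 0 < ρ →
      |ρ - c| < δ → ‖integrand α₁ α₂ c lam t ρ‖ ≤ M := by
  have hπ : |Real.pi| = Real.pi := abs_of_pos Real.pi_pos
  obtain ⟨m, hm, hev⟩ := exists_abs_log_rpow_expo_ge hα hc hlam h
  obtain ⟨δ, hδ, h1⟩ := Metric.eventually_nhds_iff.1 (eventually_nhdsWithin_iff.1 hev)
  have hm' : 0 < 1 - Real.exp (-m) := by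
    rw [sub_pos, Real.exp_lt_one_iff]; linarith
  refine ⟨min δ (c / 2), by positivity, 2 * (c / 2)⁻¹ * (1 - Real.exp (-m))⁻¹,
    fun t ht ρ hρ hρδ => ?_⟩
  by_cases hρc : ρ = c
  · rw [hρc, integrand_self, norm_zero]
    positivity
  · refine (norm_integrand_le hlam ht hρ hρc).trans ?_
    have h2 := h1 (y := ρ) (by
      rw [Real.dist_eq]; exact hρδ.trans_le (min_le_left _ _)) hρc
    rw [← logRatio_cutPoint_re hρ hρc hπ] at h2
    have h3 := one_sub_exp_neg_le_norm_one_add_exp h2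
    have h4 : c / 2 ≤ ρ := by
      have h5 := hρδ.trans_le (min_le_right _ _)
      rw [abs_lt] at h5
      linarith
    gcongr
    refine (Complex.abs_im_le_norm _).trans ?_
    rw [logTransform, norm_inv]
    gcongr

lemma exp_mul_sq_div_four_le (a : ℝ) : Real.exp a * (a ^ 2 / 4) ≤ (1 - Real.exp a) ^ 2 := by
  set y := Real.exp (a / 2) with hy
  have hy0 : 0 < y := Real.exp_pos _
  have hx : Real.exp a = y ^ 2 := by rw [hy, ← Real.exp_nat_mul]; congr 1; push_cast; ring
  have h1 := Real.add_one_le_exp (a / 2)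
  have h2 := Real.add_one_le_exp (-(a / 2))
  rw [Real.exp_neg, ← hy] at h2
  rw [← hy] at h1
  have h3 : y * y⁻¹ = 1 := mul_inv_cancel₀ hy0.ne'
  have h4 : (a / 2) ^ 2 ≤ (y - y⁻¹) ^ 2 := by
    rcases le_total 0 a with ha | ha
    · have h5 : y⁻¹ ≤ 1 := inv_le_one_of_one_le₀ (by linarith)
      nlinarith
    · have h5 : y ≤ 1 := Real.exp_le_one_iff.2 (by linarith)
      nlinarith
  have h6 : (1 - y ^ 2) ^ 2 = y ^ 2 * (y - y⁻¹) ^ 2 := by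
    field_simp
    ring
  rw [hx, h6]
  gcongr
  linarith

/-- Where both `|a|` is small and `θ` is close to an odd multiple of `π`, the imaginary part of
`1 / (1 + e ^ (a + θ i))` is controlled by the geometric mean of `1 / |a|` and
`1 / |cos (θ / 2)|`. -/
lemma abs_im_inv_one_add_exp_le {w : ℂ} (hw : w.re ≠ 0) : |((1 + Complex.exp w)⁻¹).im| ≤
    2 * ((√|Real.cos (w.im / 2)|)⁻¹ * (√|w.re|)⁻¹) := by
  set κ := Real.cos (w.im / 2) with hκ
  set σ := Real.sin (w.im / 2) with hσ
  set x := Real.exp w.re with hx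
  have hx0 : 0 < x := Real.exp_pos _
  have hsin : Real.sin w.im = 2 * σ * κ := by
    rw [hκ, hσ, ← Real.sin_two_mul]; congr 1; ring
  have hcos : Real.cos w.im = 2 * κ ^ 2 - 1 := by
    rw [hκ, ← Real.cos_two_mul]; congr 1; ring
  have hσκ : σ ^ 2 + κ ^ 2 = 1 := Real.sin_sq_add_cos_sq _
  have hn : Complex.normSq (1 + Complex.exp w) = (1 - x) ^ 2 + 4 * x * κ ^ 2 := by
    rw [Complex.normSq_apply]
    simp only [Complex.add_re, Complex.add_im, Complex.one_re, Complex.one_im, Complex.exp_re,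
      Complex.exp_im]
    rw [hsin, hcos]
    linear_combination (4 * x ^ 2 * κ ^ 2) * hσκ
  have him : ((1 + Complex.exp w)⁻¹).im = -(x * (2 * σ * κ)) / ((1 - x) ^ 2 + 4 * x * κ ^ 2) := by
    rw [Complex.inv_im, hn, Complex.add_im, Complex.one_im, Complex.exp_im, hsin, zero_add]
  rw [him]
  by_cases hκ0 : κ = 0
  · simp [hκ0]
  have hm := Real.sqrt_pos.2 (abs_pos.2 hw)
  have hk := Real.sqrt_pos.2 (abs_pos.2 hκ0)
  have hm2 : √|w.re| ^ 4 = w.re ^ 2 := by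
    rw [show 4 = 2 * 2 from rfl, pow_mul, Real.sq_sqrt (abs_nonneg _), sq_abs]
  have hk2 : √|κ| ^ 4 = κ ^ 2 := by
    rw [show 4 = 2 * 2 from rfl, pow_mul, Real.sq_sqrt (abs_nonneg _), sq_abs]
  have hk3 : |κ| = √|κ| ^ 2 := (Real.sq_sqrt (abs_nonneg _)).symm
  have hσ1 : |σ| ≤ 1 := Real.abs_sin_le_one _
  have hden : x * (√|w.re| ^ 4 / 4 + 4 * √|κ| ^ 4) ≤ (1 - x) ^ 2 + 4 * x * κ ^ 2 := by
    have := exp_mul_sq_div_four_le w.re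
    rw [hm2, hk2]
    linarith
  set m := √|w.re|
  set k := √|κ|
  have hden0 : 0 < x * (m ^ 4 / 4 + 4 * k ^ 4) := by positivity
  rw [abs_div, abs_neg, abs_of_pos (hden0.trans_le hden), abs_mul, abs_mul, abs_mul, abs_two,
    abs_of_pos hx0, hk3]
  have hkm : k ^ 3 * m ≤ m ^ 4 / 4 + 4 * k ^ 4 := by
    rcases le_total m (2 * k) with h | h
    · have h1 : k ^ 3 * m ≤ k ^ 3 * (2 * k) := by gcongr
      have h2 : 0 < k ^ 4 := by positivity
      have h3 : 0 < m ^ 4 := by positivity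
      nlinarith
    · have h1 : k ^ 3 * m ≤ (m / 2) ^ 3 * m := by gcongr; linarith
      have h2 : 0 < k ^ 4 := by positivity
      have h3 : 0 < m ^ 4 := by positivity
      nlinarith
  calc x * (2 * |σ| * k ^ 2) / ((1 - x) ^ 2 + 4 * x * κ ^ 2)
      ≤ x * (2 * 1 * k ^ 2) / (x * (m ^ 4 / 4 + 4 * k ^ 4)) := by gcongr
    _ = 2 * (k ^ 2 / (m ^ 4 / 4 + 4 * k ^ 4)) := by field_simp
    _ ≤ 2 * (k⁻¹ * m⁻¹) := by
      gcongr
      rw [← mul_inv, div_le_iff₀ (by positivity), inv_mul_eq_div, le_div_iff₀ (by positivity)]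
      linarith

end NearCut

section Degenerate

lemma abs_sub_le_abs_cos {x : ℝ} (n : ℤ) (h : |x - (2 * n + 1)| ≤ 1) :
    |x - (2 * n + 1)| ≤ |Real.cos (Real.pi * x / 2)| := by
  have hpi := Real.pi_pos
  set v := x - (2 * n + 1) with hv
  have h1 : Real.pi * x / 2 = (Real.pi / 2 * v + Real.pi / 2) + n * Real.pi := by
    rw [hv]; ring
  have h2 : |(-1 : ℝ) ^ n| = 1 := by rw [abs_zpow, abs_neg, abs_one, one_zpow]
  rw [h1, Real.cos_add_int_mul_pi, Real.cos_add_pi_div_two, abs_mul, h2, one_mul, abs_neg]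
  have h3 : |Real.pi / 2 * v| = Real.pi / 2 * |v| := by rw [abs_mul, abs_of_pos (by positivity)]
  have h4 := Real.mul_abs_le_abs_sin (x := Real.pi / 2 * v) (by
    rw [h3]; exact mul_le_of_le_one_right (by positivity) h)
  rw [h3] at h4
  refine le_trans (le_of_eq ?_) h4
  field_simp

lemma integrableOn_inv_sqrt_abs :
    IntegrableOn (fun x : ℝ => (√|x|)⁻¹) (Ico (-1) 1) := by
  have h1 : IntervalIntegrable (fun x : ℝ => x ^ (-(1 / 2) : ℝ)) volume 0 1 :=
    intervalIntegral.intervalIntegrable_rpow' (by norm_num)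
  have h2 : IntervalIntegrable (fun x : ℝ => (√|x|)⁻¹) volume 0 1 := by
    refine h1.congr fun x hx => ?_
    rw [uIoc_of_le zero_le_one] at hx
    rw [abs_of_pos hx.1, Real.rpow_neg hx.1.le, Real.sqrt_eq_rpow]
  have h3 : IntervalIntegrable (fun x : ℝ => (√|x|)⁻¹) volume (-1) 0 := by
    have := h2.comp_mul_left (c := -1)
    simpa using this.symm
  have h4 := (intervalIntegrable_iff_integrableOn_Icc_of_le (by norm_num)).1 (h3.trans h2)
  exact h4.mono_set Ico_subset_Icc_self

/-- The singularities of `|cos|^(-1/2)` are integrable over each period, and the factor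
`|τ|^(-3/2)` makes the sum over the periods converge. -/
lemma integrableOn_rpow_mul_inv_sqrt_abs_cos {α : ℝ} (hα0 : 0 ≤ α) (hα1 : α ≤ 1) :
    IntegrableOn (fun τ : ℝ => |τ| ^ (-(3 / 2) : ℝ) * (√|Real.cos (Real.pi * (τ - α) / 2)|)⁻¹)
      {τ | 1 ≤ |τ|} := by
  set g : ℝ → ℝ := fun τ => |τ| ^ (-(3 / 2) : ℝ) * (√|Real.cos (Real.pi * (τ - α) / 2)|)⁻¹ with hg
  have hgm : Measurable g := by
    have : Measurable fun τ : ℝ => Real.cos (Real.pi * (τ - α) / 2) := by fun_prop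
    have h2 := this.abs.sqrt.inv
    have h3 : Measurable fun τ : ℝ => |τ| ^ (-(3 / 2) : ℝ) := measurable_id.abs.pow_const _
    exact h3.mul h2
  have hS : MeasurableSet {τ : ℝ | 1 ≤ |τ|} :=
    measurableSet_le measurable_const measurable_id.abs
  set φ : ℝ → ℝ := (Ico (-1) 1).indicator fun x => (√|x|)⁻¹ with hφ
  have hφi : Integrable φ := (integrable_indicator_iff measurableSet_Ico).2 integrableOn_inv_sqrt_abs
  set s : ℤ → Set ℝ := fun n => {τ | 1 ≤ |τ|} ∩ Ico (α + n • (2 : ℝ)) (α + (n + 1) • (2 : ℝ)) with hs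
  have hsm : ∀ n, MeasurableSet (s n) := fun n => hS.inter measurableSet_Ico
  have hunion : ⋃ n, s n = {τ : ℝ | 1 ≤ |τ|} := by
    rw [hs, ← inter_iUnion, iUnion_Ico_add_zsmul two_pos, inter_univ]
  set D : ℤ → ℝ := fun n => (2 / 3 * |(n : ℝ) + 1 / 2|) ^ (-(3 / 2) : ℝ) with hD
  have hn0 : ∀ n : ℤ, 0 < |(n : ℝ) + 1 / 2| := fun n => by
    rw [abs_pos]
    intro h
    have h1 : ((2 * n + 1 : ℤ) : ℝ) = 0 := by push_cast; linarith
    have h2 : 2 * n + 1 = 0 := by exact_mod_cast h1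
    omega
  have hbound : ∀ n, ∀ τ ∈ s n, ‖g τ‖ ≤ D n * φ (τ - (α + 2 * n + 1)) := by
    intro n τ hτ
    have h1 : 1 ≤ |τ| := hτ.1
    have h2 : α + n * 2 ≤ τ := by simpa using hτ.2.1
    have h3 : τ < α + (n + 1) * 2 := by simpa [-smul_eq_mul, zsmul_eq_mul] using hτ.2.2
    have hmem : τ - (α + 2 * n + 1) ∈ Ico (-1 : ℝ) 1 := ⟨by linarith, by linarith⟩
    have h4 : |τ - α - (2 * n + 1)| ≤ 1 := abs_le.2 ⟨by linarith, by linarith⟩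
    have h5 := abs_sub_le_abs_cos n h4
    rw [hφ, indicator_of_mem hmem, Real.norm_of_nonneg (by rw [hg]; positivity)]
    have h6 : τ - (α + 2 * n + 1) = τ - α - (2 * n + 1) := by ring
    rw [h6]
    have h7 : 2 / 3 * |(n : ℝ) + 1 / 2| ≤ |τ| := by
      have h8 : (n : ℝ) + 1 / 2 = (τ - α - (τ - α - (2 * n + 1))) / 2 := by ring
      have h9 : |(n : ℝ) + 1 / 2| ≤ (|τ| + |α| + |τ - α - (2 * n + 1)|) / 2 := by
        rw [h8, abs_div, abs_two]
        gcongr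
        exact (abs_sub _ _).trans (by gcongr; exact abs_sub _ _)
      rw [abs_of_nonneg hα0] at h9
      linarith
    have h8 : |τ| ^ (-(3 / 2) : ℝ) ≤ D n :=
      Real.rpow_le_rpow_of_nonpos (by have := hn0 n; positivity) h7 (by norm_num)
    rcases (abs_nonneg (τ - α - (2 * n + 1))).eq_or_lt with h0 | h0
    · -- at the centre of the period the cosine vanishes as well, and `0⁻¹ = 0`
      have h10 : τ = α + (2 * n + 1) := by
        have := abs_eq_zero.1 h0.symm
        linarith
      have h11 : Real.cos (Real.pi * (τ - α) / 2) = 0 := by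
        rw [h10, show Real.pi * (α + (2 * n + 1) - α) / 2 = Real.pi / 2 + n * Real.pi by ring,
          Real.cos_add_int_mul_pi, Real.cos_pi_div_two, mul_zero]
      rw [hg]
      simp only [h11]
      simp only [abs_zero, Real.sqrt_zero, inv_zero, mul_zero]
      have := hn0 n
      positivity
    · have h9 : (√|Real.cos (Real.pi * (τ - α) / 2)|)⁻¹ ≤ (√|τ - α - (2 * n + 1)|)⁻¹ := by
        gcongr
      exact mul_le_mul h8 h9 (by positivity) (by have := hn0 n; positivity)
  have hbi : ∀ n : ℤ, Integrable fun τ => D n * φ (τ - (α + 2 * n + 1)) := fun n =>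
    (hφi.comp_sub_right _).const_mul _
  have hφ0 : ∀ x, 0 ≤ φ x := indicator_nonneg fun x _ => by positivity
  have hgi : ∀ n, IntegrableOn g (s n) := fun n =>
    (hbi n).integrableOn.mono' hgm.aestronglyMeasurable
      ((ae_restrict_iff' (hsm n)).2 (Eventually.of_forall (hbound n)))
  rw [← hunion]
  refine integrableOn_iUnion_of_summable_integral_norm hgi ?_
  have hDs : Summable D := by
    have h1 := (Real.summable_one_div_int_add_rpow (1 / 2) (3 / 2)).2 (by norm_num)
    refine (h1.mul_left ((2 / 3 : ℝ) ^ (-(3 / 2) : ℝ))).congr fun n => ?_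
    change _ = (2 / 3 * |(n : ℝ) + 1 / 2|) ^ (-(3 / 2) : ℝ)
    rw [Real.mul_rpow (by norm_num) (abs_nonneg _), Real.rpow_neg (abs_nonneg _), one_div]
  refine Summable.of_nonneg_of_le (fun n => by positivity) (fun n => ?_) (hDs.mul_right (∫ x, φ x))
  calc ∫ τ in s n, ‖g τ‖ ≤ ∫ τ in s n, D n * φ (τ - (α + 2 * n + 1)) :=
        setIntegral_mono_on (hgi n).norm (hbi n).integrableOn (hsm n) (hbound n)
    _ ≤ ∫ τ, D n * φ (τ - (α + 2 * n + 1)) := by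
        refine setIntegral_le_integral (hbi n) (Eventually.of_forall fun τ => ?_)
        have := hn0 n
        have := hφ0 (τ - (α + 2 * n + 1))
        simp only [Pi.zero_apply]
        positivity
    _ = D n * ∫ x, φ x := by
        rw [integral_const_mul, integral_sub_right_eq_self φ]

/-- The substitution `ρ = 1 + b / τ` turns the accumulation of singularities at `ρ = 1` into a
periodic sequence of singularities. -/
lemma integrableOn_inv_sqrt_abs_cos_mul {α b : ℝ} (hα0 : 0 ≤ α) (hα1 : α ≤ 1) (hb : 0 < b) :
    IntegrableOn (fun ρ : ℝ => (√|Real.cos (Real.pi * (b / (ρ - 1) - α) / 2)|)⁻¹ * (√|ρ - 1|)⁻¹)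
      {ρ | ρ ≠ 1 ∧ |ρ - 1| ≤ b} := by
  set f : ℝ → ℝ := fun τ => 1 + b * τ⁻¹ with hf
  have hne : ∀ τ ∈ {τ : ℝ | 1 ≤ |τ|}, τ ≠ 0 := fun τ hτ h => by
    have h1 : 1 ≤ |τ| := hτ
    rw [h, abs_zero] at h1
    linarith
  have himage : f '' {τ | 1 ≤ |τ|} = {ρ | ρ ≠ 1 ∧ |ρ - 1| ≤ b} := by
    ext ρ
    constructor
    · rintro ⟨τ, hτ, rfl⟩
      have h0 := hne τ hτ
      have hτ : 1 ≤ |τ| := hτ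
      refine ⟨?_, ?_⟩
      · simp [hf, hb.ne', h0]
      · simp only [hf, add_sub_cancel_left]
        rw [abs_mul, abs_of_pos hb, abs_inv]
        exact mul_le_of_le_one_right hb.le (inv_le_one_of_one_le₀ hτ)
    · rintro ⟨h1, h2⟩
      have h3 : ρ - 1 ≠ 0 := sub_ne_zero.2 h1
      refine ⟨b / (ρ - 1), ?_, ?_⟩
      · rw [mem_ofPred_eq, abs_div, abs_of_pos hb, le_div_iff₀ (abs_pos.2 h3), one_mul]
        exact h2
      · simp only [hf]
        field_simp
        ring
  have hS : MeasurableSet {τ : ℝ | 1 ≤ |τ|} :=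
    measurableSet_le measurable_const measurable_id.abs
  rw [← himage, integrableOn_image_iff_integrableOn_abs_deriv_smul (f' := fun τ => b * -(τ ^ 2)⁻¹) hS
    (fun τ hτ => (((hasDerivAt_inv (hne τ hτ)).const_mul b).const_add 1).hasDerivWithinAt)
    (fun τ hτ τ' hτ' h => by
      have h1 : b * τ⁻¹ = b * τ'⁻¹ := by simpa [hf] using h
      exact inv_injective (mul_left_cancel₀ hb.ne' h1))]
  refine IntegrableOn.congr_fun ((integrableOn_rpow_mul_inv_sqrt_abs_cos hα0 hα1).const_mul (√b))
    (fun τ hτ => ?_) hS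
  have h0 := hne τ hτ
  have h1 : f τ - 1 = b / τ := by simp [hf, div_eq_mul_inv]
  have ha := abs_pos.2 h0
  have hr : |τ| ^ (-(3 / 2) : ℝ) = √|τ| * (|τ| ^ 2)⁻¹ := by
    rw [Real.sqrt_eq_rpow, ← Real.rpow_natCast, ← Real.rpow_neg ha.le, ← Real.rpow_add ha]
    norm_num
  change √b * (|τ| ^ (-(3 / 2) : ℝ) * (√|Real.cos (Real.pi * (τ - α) / 2)|)⁻¹) =
    |b * -(τ ^ 2)⁻¹| * ((√|Real.cos (Real.pi * (b / (f τ - 1) - α) / 2)|)⁻¹ * (√|f τ - 1|)⁻¹)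
  rw [h1, div_div_cancel₀ hb.ne', hr, abs_mul, abs_neg, abs_inv, abs_pow, abs_div, abs_of_pos hb, Real.sqrt_div hb.le, inv_div]
  have hsb : √b * √b = b := Real.mul_self_sqrt hb.le
  have hsb0 : √b ≠ 0 := (Real.sqrt_pos.2 hb).ne'
  generalize (√|Real.cos (Real.pi * (τ - α) / 2)|)⁻¹ = g
  field_simp
  rw [pow_two, hsb, mul_comm]

end Degenerate

/-! ### Integrability of the integrand -/

section Integrable

variable {α₁ α₂ c lam : ℝ}

/-- For `c = 1` and `λ e ^ (α₂ - α₁) = 1` the logarithm of the modulus `λ ρ ^ p(ρ)` vanishes at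
`ρ = 1`, but only to first order. -/
lemma mul_abs_le_abs_re_logRatio (hα₁ : 0 < α₁) (hα : α₁ < α₂) {ρ : ℝ} (hρ : 0 < ρ) (hρ1 : ρ ≠ 1)
    (hρ2 : ρ ≤ 2) : α₁ / 2 * |ρ - 1| ≤ |-(α₂ - α₁) + expo α₁ α₂ 1 ρ * Real.log ρ| := by
  have h1 : -(α₂ - α₁) + expo α₁ α₂ 1 ρ * Real.log ρ =
      -((α₂ - α₁) * (1 - Real.log ρ / (ρ - 1)) + α₁ * Real.log ρ) := by
    rw [expo_eq hρ1]; ring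
  have h2 := Real.log_le_sub_one_of_pos hρ
  have h3 := Real.one_sub_inv_le_log_of_pos hρ
  rw [h1, abs_neg]
  rcases lt_or_gt_of_ne hρ1 with h | h
  · have h4 : 1 ≤ Real.log ρ / (ρ - 1) := by
      rw [le_div_iff_of_neg (by linarith)]; linarith
    rw [abs_of_neg (by linarith : ρ - 1 < 0)]
    refine le_trans ?_ (neg_le_abs _)
    nlinarith [mul_nonneg (sub_pos.2 hα).le (sub_nonneg.2 h4)]
  · have h4 : Real.log ρ / (ρ - 1) ≤ 1 := by
      rw [div_le_one (by linarith)]; exact h2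
    rw [abs_of_pos (by linarith : 0 < ρ - 1)]
    refine le_trans ?_ (le_abs_self _)
    have h5 : (ρ - 1) / 2 ≤ 1 - ρ⁻¹ := by
      have : 1 - ρ⁻¹ = (ρ - 1) / ρ := by field_simp
      rw [this]
      gcongr
    nlinarith [mul_nonneg (sub_pos.2 hα).le (sub_nonneg.2 h4)]

/-- In the degenerate case `c = 1`, `λ e ^ (α₂ - α₁) = 1` the integrand has infinitely many peaks
accumulating at `c`, but an integrable majorant. -/
lemma exists_integrableOn_integrand_near (hα₁ : 0 < α₁) (hα : α₁ < α₂) (hα₂ : α₂ < 1) (hc : 0 < c)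
    (hlam : 0 < lam) : ∃ δ > 0, IntegrableOn (integrand α₁ α₂ c lam 0) (Icc (c - δ) (c + δ)) := by
  by_cases h : c ≠ 1 ∨ lam * Real.exp (α₂ - α₁) ≠ 1
  · obtain ⟨δ, hδ, M, hM⟩ := exists_norm_integrand_le_near hα hc hlam h
    refine ⟨min (δ / 2) (c / 2), by positivity, ?_⟩
    refine Measure.integrableOn_of_bounded (M := M) (by simp)
      (measurable_integrand 0).aestronglyMeasurable ?_
    refine (ae_restrict_iff' measurableSet_Icc).2 (Eventually.of_forall fun ρ hρ => ?_)
    have h1 := min_le_left (δ / 2) (c / 2)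
    have h2 := min_le_right (δ / 2) (c / 2)
    exact hM 0 le_rfl ρ (by linarith [hρ.1]) (abs_lt.2 ⟨by linarith [hρ.1], by linarith [hρ.2]⟩)
  · push Not at h
    obtain ⟨rfl, hl⟩ := h
    have hb : 0 < α₂ - α₁ := by linarith
    have hlog : Real.log lam = -(α₂ - α₁) := by
      rw [eq_inv_of_mul_eq_one_left hl, Real.log_inv, Real.log_exp]
    have hπ : |Real.pi| = Real.pi := abs_of_pos Real.pi_pos
    refine ⟨min (α₂ - α₁) (1 / 2), by positivity, ?_⟩
    have h1 := integrableOn_inv_sqrt_abs_cos_mul hα₁.le (by linarith) hb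
    have h2 : IntegrableOn (fun ρ : ℝ => 8 * (√(α₁ / 2))⁻¹ *
        ((√|Real.cos (Real.pi * ((α₂ - α₁) / (ρ - 1) - α₁) / 2)|)⁻¹ * (√|ρ - 1|)⁻¹))
        (Icc (1 - min (α₂ - α₁) (1 / 2)) (1 + min (α₂ - α₁) (1 / 2))) := by
      refine (IntegrableOn.union (h1.const_mul _)
        (integrableOn_singleton (x := (1 : ℝ)) (hx := by simp))).mono_set fun ρ hρ => ?_
      by_cases h : ρ = 1
      · exact Or.inr h
      · refine Or.inl ⟨h, abs_le.2 ?_⟩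
        have := min_le_left (α₂ - α₁) (1 / 2)
        exact ⟨by linarith [hρ.1], by linarith [hρ.2]⟩
    refine h2.mono' (measurable_integrand 0).aestronglyMeasurable
      ((ae_restrict_iff' measurableSet_Icc).2 (Eventually.of_forall fun ρ hρ => ?_))
    have h3 := min_le_right (α₂ - α₁) (1 / 2)
    by_cases hρ1 : ρ = 1
    · rw [hρ1, integrand_self, norm_zero]
      positivity
    have hρ2 : 1 / 2 ≤ ρ := by linarith [hρ.1]
    have hρ0 : 0 < ρ := by linarith
    have h4 := mul_abs_le_abs_re_logRatio hα₁ hα hρ0 hρ1 (by linarith [hρ.2])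
    have h5 : 0 < α₁ / 2 * |ρ - 1| := mul_pos (by positivity) (abs_pos.2 (sub_ne_zero.2 hρ1))
    have hre := logRatio_cutPoint_re (α₁ := α₁) (α₂ := α₂) (lam := lam) hρ0 hρ1 hπ
    have him := logRatio_cutPoint_im (α₁ := α₁) (α₂ := α₂) (lam := lam) hρ0 hρ1 hπ
    rw [hlog] at hre
    have h6 := abs_im_inv_one_add_exp_le (w := logRatio α₁ α₂ 1 lam (cutPoint ρ Real.pi)) (by
      rw [hre]
      exact abs_pos.1 (h5.trans_le h4))
    rw [hre, him] at h6
    refine (norm_integrand_le hlam le_rfl hρ0 hρ1).trans ?_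
    have h7 : expo α₁ α₂ 1 ρ * Real.pi = Real.pi * ((α₂ - α₁) / (ρ - 1) - α₁) := by
      rw [expo_eq hρ1]; ring
    rw [h7] at h6
    have h8 : ρ⁻¹ ≤ 2 := by
      rw [inv_le_comm₀ hρ0 two_pos]; linarith
    calc _ ≤ 2 * 2 * (2 * ((√|Real.cos (Real.pi * ((α₂ - α₁) / (ρ - 1) - α₁) / 2)|)⁻¹ *
          (√(α₁ / 2 * |ρ - 1|))⁻¹)) := by
          gcongr
          refine h6.trans ?_
          gcongr
      _ = _ := by
          rw [Real.sqrt_mul (by positivity), mul_inv]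
          ring

/-- The integral over the cut converges absolutely. -/
lemma integrableOn_integrand_zero (hα₁ : 0 < α₁) (hα : α₁ < α₂) (hα₂ : α₂ < 1) (hc : 0 < c)
    (hlam : 0 < lam) (hcut : ∀ ρ : ℝ, 0 < ρ → ρ ≠ c → denom α₁ α₂ c lam (-(ρ : ℂ)) ≠ 0) :
    IntegrableOn (integrand α₁ α₂ c lam 0) (Ioi 0) := by
  have hπ : |Real.pi| = Real.pi := abs_of_pos Real.pi_pos
  obtain ⟨X, K, hX, hK, hright, hleft⟩ := exists_logTransform_ends hα₁ hα hc hlam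
  obtain ⟨δ, hδ, hnear⟩ := exists_integrableOn_integrand_near hα₁ hα hα₂ hc hlam
  have hcont : ∀ a b : ℝ, 0 < a → c ∉ Icc a b →
      IntegrableOn (integrand α₁ α₂ c lam 0) (Icc a b) := fun a b ha hcab => by
    refine ContinuousOn.integrableOn_Icc fun ρ hρ => ?_
    exact (continuousAt_integrand hlam hcut 0 (ha.trans_le hρ.1)
      (fun h => hcab (h ▸ hρ))).continuousWithinAt
  have hXc : Real.exp (-X) < c ∧ c < Real.exp X := by
    constructor
    · rw [← Real.lt_log_iff_exp_lt hc]; linarith [neg_abs_le (Real.log c)]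
    · rw [← Real.log_lt_iff_lt_exp hc]; linarith [le_abs_self (Real.log c)]
  -- the integrand is `O(ρ ^ (α₂ - 1))` near `0` and `O(ρ ^ (-α₁ - 1))` near `∞`
  have hlow : IntegrableOn (integrand α₁ α₂ c lam 0) (Ioc 0 (Real.exp (-X))) := by
    have h1 : IntegrableOn (fun ρ : ℝ => 2 * K * ρ ^ (α₂ - 1)) (Ioc 0 (Real.exp (-X))) :=
      ((intervalIntegrable_iff_integrableOn_Ioc_of_le (Real.exp_pos _).le).1
        (intervalIntegral.intervalIntegrable_rpow' (by linarith))).const_mul _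
    refine h1.mono' (measurable_integrand 0).aestronglyMeasurable
      ((ae_restrict_iff' measurableSet_Ioc).2 (Eventually.of_forall fun ρ hρ => ?_))
    have hρ0 : 0 < ρ := hρ.1
    refine (norm_integrand_le hlam le_rfl hρ0 (by linarith [hρ.2] : ρ < c).ne).trans ?_
    have h2 := (hleft (cutPoint ρ Real.pi) (by rw [cutPoint_im, hπ]) (by
      rw [cutPoint_re, Real.log_le_iff_le_exp hρ0]; exact hρ.2)).2
    rw [cutPoint_re, mul_comm α₂, ← Real.rpow_def_of_pos hρ0] at h2
    calc _ ≤ 2 * ρ⁻¹ * (K * ρ ^ α₂) := by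
          gcongr
          exact (Complex.abs_im_le_norm _).trans h2
      _ = _ := by
          rw [Real.rpow_sub_one hρ0.ne']
          ring
  have hhigh : IntegrableOn (integrand α₁ α₂ c lam 0) (Ioi (Real.exp X)) := by
    have h1 : IntegrableOn (fun ρ : ℝ => 2 * K * ρ ^ (-α₁ - 1)) (Ioi (Real.exp X)) :=
      (integrableOn_Ioi_rpow_of_lt (by linarith) (Real.exp_pos _)).const_mul _
    refine h1.mono' (measurable_integrand 0).aestronglyMeasurable
      ((ae_restrict_iff' measurableSet_Ioi).2 (Eventually.of_forall fun ρ hρ => ?_))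
    have hρX : Real.exp X < ρ := hρ
    have hρ0 : 0 < ρ := (Real.exp_pos _).trans hρX
    refine (norm_integrand_le hlam le_rfl hρ0 (hXc.2.trans hρX).ne').trans ?_
    have h2 := (hright (cutPoint ρ Real.pi) (by rw [cutPoint_im, hπ]) (by
      rw [cutPoint_re, Real.le_log_iff_exp_le hρ0]; exact hρX.le)).2
    rw [cutPoint_re, mul_comm (-α₁), ← Real.rpow_def_of_pos hρ0] at h2
    have h3 : (logTransform α₁ α₂ c lam (cutPoint ρ Real.pi)).im =
        (logTransform α₁ α₂ c lam (cutPoint ρ Real.pi) - 1).im := by simp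
    calc _ ≤ 2 * ρ⁻¹ * (K * ρ ^ (-α₁)) := by
          gcongr
          rw [h3]
          exact (Complex.abs_im_le_norm _).trans h2
      _ = _ := by
          rw [Real.rpow_sub_one hρ0.ne']
          ring
  refine ((((hlow.union (hcont (Real.exp (-X)) (c - δ) (Real.exp_pos _) fun h => ?_)).union
    hnear).union (hcont (c + δ) (Real.exp X) (by linarith) fun h => ?_)).union hhigh).mono_set
    fun ρ hρ => ?_
  · linarith [h.2]
  · linarith [h.1]
  · have hρ : 0 < ρ := hρ
    simp only [mem_union, mem_Ioc, mem_Icc, mem_Ioi]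
    by_contra hcon
    push Not at hcon
    obtain ⟨⟨⟨⟨h1, h2⟩, h3⟩, h4⟩, h5⟩ := hcon
    have h6 := h2 (h1 hρ).le
    have h7 := h3 h6.le
    linarith [h4 h7.le]

lemma integrableOn_integrand (hα₁ : 0 < α₁) (hα : α₁ < α₂) (hα₂ : α₂ < 1) (hc : 0 < c)
    (hlam : 0 < lam) (hcut : ∀ ρ : ℝ, 0 < ρ → ρ ≠ c → denom α₁ α₂ c lam (-(ρ : ℂ)) ≠ 0) {t : ℝ}
    (ht : 0 ≤ t) : IntegrableOn (integrand α₁ α₂ c lam t) (Ioi 0) :=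
  Integrable.mono (integrableOn_integrand_zero hα₁ hα hα₂ hc hlam hcut)
    (measurable_integrand t).aestronglyMeasurable
    ((ae_restrict_iff' measurableSet_Ioi).2
      (Eventually.of_forall fun _ hρ => norm_integrand_le_zero ht hρ))

end Integrable

/-! ### Principal parts -/

/-- A meromorphic function is the sum of a polynomial in `1 / (σ - z)` without constant term and a
function analytic at `z`. -/
lemma exists_principalPart {f : ℂ → ℂ} {z : ℂ} (hf : MeromorphicAt f z) :
    ∃ (n : ℕ) (a : ℕ → ℂ) (h : ℂ → ℂ), AnalyticAt ℂ h z ∧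
      ∀ᶠ σ in 𝓝[≠] z, f σ = ∑ k ∈ Finset.range n, a k * ((σ - z) ^ (k + 1))⁻¹ + h σ := by
  have key : ∀ (n : ℕ) (g : ℂ → ℂ), AnalyticAt ℂ g z →
      ∃ (a : ℕ → ℂ) (h : ℂ → ℂ), AnalyticAt ℂ h z ∧ ∀ σ ≠ z,
        ((σ - z) ^ n)⁻¹ * g σ = ∑ k ∈ Finset.range n, a k * ((σ - z) ^ (k + 1))⁻¹ + h σ := by
    intro n
    induction n with
    | zero => exact fun g hg => ⟨0, g, hg, by simp⟩
    | succ n ih =>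
      intro g hg
      have hga : AnalyticAt ℂ (dslope g z) z := by
        obtain ⟨U, hU, hUd⟩ := hg.exists_mem_nhds_analyticOnNhd
        exact ((Complex.differentiableOn_dslope hU).2 hUd.differentiableOn).analyticAt hU
      obtain ⟨a, h, hh, hah⟩ := ih (dslope g z) hga
      refine ⟨fun k => if k = n then g z else a k, h, hh, fun σ hσ => ?_⟩
      have h1 := sub_smul_dslope g z σ
      rw [smul_eq_mul] at h1
      have h2 : σ - z ≠ 0 := sub_ne_zero.2 hσ
      have h3 : ∑ k ∈ Finset.range n, (if k = n then g z else a k) * ((σ - z) ^ (k + 1))⁻¹ =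
          ∑ k ∈ Finset.range n, a k * ((σ - z) ^ (k + 1))⁻¹ :=
        Finset.sum_congr rfl fun k hk => by rw [if_neg (Finset.mem_range.1 hk).ne]
      simp only [Finset.sum_range_succ, if_true]
      rw [h3, add_right_comm, ← hah σ hσ, ← sub_add_cancel (g σ) (g z), ← h1]
      field_simp
      ring
  obtain ⟨n, hn⟩ := hf
  obtain ⟨a, h, hh, hah⟩ := key n _ hn
  refine ⟨n, a, h, hh, ?_⟩
  filter_upwards [self_mem_nhdsWithin] with σ hσ
  have h2 : σ - z ≠ 0 := sub_ne_zero.2 hσ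
  rw [← hah σ hσ, smul_eq_mul, inv_mul_cancel_left₀ (pow_ne_zero _ h2)]

lemma circleIntegral_pow_inv {z : ℂ} {c : ℂ} {R : ℝ} (k : ℕ) (hz : z ∈ Metric.ball c R) :
    (∮ σ in C(c, R), ((σ - z) ^ (k + 1))⁻¹) = if k = 0 then 2 * Real.pi * Complex.I else 0 := by
  split_ifs with hk
  · simpa [hk] using circleIntegral.integral_sub_inv_of_mem_ball hz
  · have h1 := circleIntegral.integral_sub_zpow_of_ne (n := -(k + 1 : ℕ)) (by
      push_cast; omega) c z R
    simpa only [zpow_neg, zpow_natCast] using h1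

lemma circleIntegral_pow_inv_of_lt {z : ℂ} {R : ℝ} (k : ℕ) (hR : 0 < R) (hz : R < ‖z‖) :
    (∮ σ in C(0, R), ((σ - z) ^ (k + 1))⁻¹) = 0 := by
  have hne : ∀ σ : ℂ, ‖σ‖ ≤ R → (σ - z) ^ (k + 1) ≠ 0 := fun σ hσ => by
    refine pow_ne_zero _ (sub_ne_zero.2 fun h => ?_)
    rw [h] at hσ
    linarith
  have hd : ∀ σ : ℂ, ‖σ‖ ≤ R → DifferentiableAt ℂ (fun σ => ((σ - z) ^ (k + 1))⁻¹) σ :=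
    fun σ hσ => DifferentiableAt.inv (by fun_prop) (hne σ hσ)
  refine Complex.circleIntegral_eq_zero_of_differentiable_on_off_countable hR.le countable_empty
    (fun σ hσ => ?_) fun σ hσ => ?_
  · exact (hd σ (mem_closedBall_zero_iff.1 hσ)).continuousAt.continuousWithinAt
  · exact hd σ (mem_ball_zero_iff.1 hσ.1).le

/-- The circle integral about an isolated singularity is given by the coefficient of
`1 / (σ - z)`. -/
lemma circleIntegral_eq_of_principalPart {f h : ℂ → ℂ} {z : ℂ} {ϱ : ℝ} (hϱ : 0 < ϱ)
    (hf : ∀ σ : ℂ, σ ≠ z → ‖σ - z‖ ≤ ϱ → DifferentiableAt ℂ f σ) {n : ℕ} {a : ℕ → ℂ}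
    (hh : AnalyticAt ℂ h z) (hfa : ∀ᶠ σ in 𝓝[≠] z,
      f σ = ∑ k ∈ Finset.range n, a k * ((σ - z) ^ (k + 1))⁻¹ + h σ) :
    (∮ σ in C(z, ϱ), f σ) = ∑ k ∈ Finset.range n, a k * if k = 0 then 2 * Real.pi * Complex.I else 0 := by
  obtain ⟨ε, hε, h1⟩ := Metric.eventually_nhds_iff.1
    ((eventually_nhdsWithin_iff.1 hfa).and hh.eventually_analyticAt)
  set r := min (ε / 2) ϱ with hr
  have hr0 : 0 < r := by positivity
  have hrε : r < ε := (min_le_left _ _).trans_lt (half_lt_self hε)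
  have hne : ∀ σ ∈ Metric.sphere z r, σ ≠ z := fun σ hσ hc => by
    rw [hc, mem_sphere_iff_norm, sub_self, norm_zero] at hσ
    exact hr0.ne hσ
  have hdist : ∀ σ ∈ Metric.closedBall z r, dist σ z < ε := fun σ hσ =>
    (Metric.mem_closedBall.1 hσ).trans_lt hrε
  rw [← circleIntegral_eq_of_differentiableAt hr0 (min_le_right _ _) hf,
    circleIntegral.integral_congr (g := fun σ =>
      ∑ k ∈ Finset.range n, a k * ((σ - z) ^ (k + 1))⁻¹ + h σ) hr0.le fun σ hσ =>
      (h1 (hdist σ (Metric.sphere_subset_closedBall hσ))).1 (hne σ hσ)]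
  have hci : ∀ k ∈ Finset.range n,
      CircleIntegrable (fun σ => a k * ((σ - z) ^ (k + 1))⁻¹) z r := fun k _ => by
    refine ContinuousOn.circleIntegrable hr0.le fun σ hσ => ?_
    have h2 : ContinuousAt (fun σ => (σ - z) ^ (k + 1)) σ := by fun_prop
    exact (continuousAt_const.mul (h2.inv₀
      (pow_ne_zero _ (sub_ne_zero.2 (hne σ hσ))))).continuousWithinAt
  have hhz : (∮ σ in C(z, r), h σ) = 0 := by
    refine Complex.circleIntegral_eq_zero_of_differentiable_on_off_countable hr0.le countable_empty
      (fun σ hσ => ?_) fun σ hσ => ?_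
    · exact (h1 (hdist σ hσ)).2.continuousAt.continuousWithinAt
    · exact (h1 (hdist σ (Metric.ball_subset_closedBall hσ.1))).2.differentiableAt
  rw [circleIntegral.integral_add, hhz, add_zero, circleIntegral.integral_fun_sum hci]
  · refine Finset.sum_congr rfl fun k _ => ?_
    rw [circleIntegral.integral_const_mul,
      circleIntegral_pow_inv k (Metric.mem_ball_self hr0)]
  · exact CircleIntegrable.fun_sum _ hci
  · exact ContinuousOn.circleIntegrable hr0.le fun σ hσ =>
      (h1 (hdist σ (Metric.sphere_subset_closedBall hσ))).2.continuousAt.continuousWithinAt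

/-- Removable singularities are removed by replacing a function by its punctured limits. -/
lemma differentiableAt_limUnder {G h : ℂ → ℂ} {ζ₀ : ℂ} (hh : AnalyticAt ℂ h ζ₀)
    (heq : ∀ᶠ ζ in 𝓝[≠] ζ₀, G ζ = h ζ) :
    DifferentiableAt ℂ (fun ζ => limUnder (𝓝[≠] ζ) G) ζ₀ := by
  refine hh.differentiableAt.congr_of_eventuallyEq ?_
  have h1 : ∀ᶠ ζ in 𝓝 ζ₀, ∀ᶠ ξ in 𝓝[≠] ζ, G ξ = h ξ := by
    have h2 := eventually_eventually_nhdsWithin.2 heq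
    rw [eventually_nhdsWithin_iff] at h2
    filter_upwards [h2] with ζ hζ
    by_cases hc : ζ = ζ₀
    · rw [hc]; exact heq
    · have h3 := hζ hc
      rw [IsOpen.nhdsWithin_eq isOpen_compl_singleton hc] at h3
      exact h3.filter_mono nhdsWithin_le_nhds
  filter_upwards [h1, hh.eventually_analyticAt] with ζ h2 h3
  refine Tendsto.limUnder_eq ?_
  exact (h3.continuousAt.tendsto.mono_left nhdsWithin_le_nhds).congr' (h2.mono fun _ h => h.symm)

lemma limUnder_eq_of_continuousAt {G : ℂ → ℂ} {ζ : ℂ} (h : ContinuousAt G ζ) :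
    limUnder (𝓝[≠] ζ) G = G ζ :=
  (h.tendsto.mono_left nhdsWithin_le_nhds).limUnder_eq

/-! ### The keyhole contour in logarithmic coordinates -/

/-- The integral along the segment from `p + y i` to `q + y i`. -/
def hInt (f : ℂ → ℂ) (y p q : ℝ) : ℂ := ∫ x in p..q, f (x + y * Complex.I)

/-- The integral along the segment from `x + p i` to `x + q i`. -/
def vInt (f : ℂ → ℂ) (x p q : ℝ) : ℂ := Complex.I * ∫ y in p..q, f (x + y * Complex.I)

/-- The integral along the positively oriented boundary of the rectangle `[a, b] × [-π, π]` from
which the two squares of side `2 r` about `x₀ ± π i` have been removed. Under `exp` this becomes a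
keyhole contour about the negative real axis that avoids `-e ^ x₀`. -/
def keyhole (x₀ r a b : ℝ) (f : ℂ → ℂ) : ℂ :=
  hInt f (-Real.pi) a (x₀ - r) + hInt f (-Real.pi + r) (x₀ - r) (x₀ + r) +
    hInt f (-Real.pi) (x₀ + r) b -
  (hInt f Real.pi a (x₀ - r) + hInt f (Real.pi - r) (x₀ - r) (x₀ + r) +
    hInt f Real.pi (x₀ + r) b) +
  (vInt f b (-Real.pi) Real.pi - vInt f a (-Real.pi) Real.pi) +
  (vInt f (x₀ - r) (-Real.pi) (-Real.pi + r) + vInt f (x₀ - r) (Real.pi - r) Real.pi -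
    vInt f (x₀ + r) (-Real.pi) (-Real.pi + r) - vInt f (x₀ + r) (Real.pi - r) Real.pi)

/-- The closed region bounded by the keyhole contour. -/
def keyholeRegion (x₀ r a b : ℝ) : Set ℂ :=
  {ζ | a ≤ ζ.re ∧ ζ.re ≤ b ∧ |ζ.im| ≤ Real.pi ∧ (r ≤ |ζ.re - x₀| ∨ |ζ.im| ≤ Real.pi - r)}

/-- The keyhole contour. -/
def keyholeBoundary (x₀ r a b : ℝ) : Set ℂ :=
  keyholeRegion x₀ r a b ∩ {ζ | ζ.re = a ∨ ζ.re = b ∨ |ζ.im| = Real.pi ∨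
    (|ζ.re - x₀| ≤ r ∧ Real.pi - r ≤ |ζ.im|)}

section Segments

variable {f g : ℂ → ℂ} {s : Set ℂ}

lemma intervalIntegrable_hInt (hf : ContinuousOn f s) {y p q : ℝ} (hpq : p ≤ q)
    (h : ∀ x ∈ Icc p q, (x + y * Complex.I : ℂ) ∈ s) :
    IntervalIntegrable (fun x : ℝ => f (x + y * Complex.I)) volume p q := by
  refine ContinuousOn.intervalIntegrable ?_
  rw [uIcc_of_le hpq]
  exact hf.comp (by fun_prop) h

lemma intervalIntegrable_vInt (hf : ContinuousOn f s) {x p q : ℝ} (hpq : p ≤ q)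
    (h : ∀ y ∈ Icc p q, (x + y * Complex.I : ℂ) ∈ s) :
    IntervalIntegrable (fun y : ℝ => f (x + y * Complex.I)) volume p q := by
  refine ContinuousOn.intervalIntegrable ?_
  rw [uIcc_of_le hpq]
  exact hf.comp (by fun_prop) h

lemma hInt_add (hf : ContinuousOn f s) (hg : ContinuousOn g s) {y p q : ℝ} (hpq : p ≤ q)
    (h : ∀ x ∈ Icc p q, (x + y * Complex.I : ℂ) ∈ s) :
    hInt (fun ζ => f ζ + g ζ) y p q = hInt f y p q + hInt g y p q :=
  intervalIntegral.integral_add (intervalIntegrable_hInt hf hpq h)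
    (intervalIntegrable_hInt hg hpq h)

lemma vInt_add (hf : ContinuousOn f s) (hg : ContinuousOn g s) {x p q : ℝ} (hpq : p ≤ q)
    (h : ∀ y ∈ Icc p q, (x + y * Complex.I : ℂ) ∈ s) :
    vInt (fun ζ => f ζ + g ζ) x p q = vInt f x p q + vInt g x p q := by
  rw [vInt, intervalIntegral.integral_add (intervalIntegrable_vInt hf hpq h)
    (intervalIntegrable_vInt hg hpq h), mul_add]
  rfl

lemma hInt_congr {y p q : ℝ} (hpq : p ≤ q) (h : ∀ x ∈ Icc p q, (x + y * Complex.I : ℂ) ∈ s)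
    (hfg : EqOn f g s) : hInt f y p q = hInt g y p q :=
  intervalIntegral.integral_congr fun x hx => hfg (h x (by rwa [uIcc_of_le hpq] at hx))

lemma vInt_congr {x p q : ℝ} (hpq : p ≤ q) (h : ∀ y ∈ Icc p q, (x + y * Complex.I : ℂ) ∈ s)
    (hfg : EqOn f g s) : vInt f x p q = vInt g x p q := by
  rw [vInt, vInt]
  congr 1
  exact intervalIntegral.integral_congr fun y hy => hfg (h y (by rwa [uIcc_of_le hpq] at hy))

lemma vInt_add_adjacent (hf : ContinuousOn f s) {x p q u : ℝ} (hpq : p ≤ q) (hqu : q ≤ u)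
    (h : ∀ y ∈ Icc p u, (x + y * Complex.I : ℂ) ∈ s) :
    vInt f x p q + vInt f x q u = vInt f x p u := by
  rw [vInt, vInt, vInt, ← mul_add, intervalIntegral.integral_add_adjacent_intervals
    (intervalIntegrable_vInt hf hpq fun x hx => h x ⟨hx.1, hx.2.trans hqu⟩)
    (intervalIntegrable_vInt hf hqu fun x hx => h x ⟨hpq.trans hx.1, hx.2⟩)]

/-- Cauchy's theorem for a rectangle. -/
lemma hInt_sub_add_vInt_sub_eq_zero {p q u v : ℝ} (hpq : p ≤ q) (huv : u ≤ v)
    (hf : ∀ ζ : ℂ, ζ.re ∈ Icc p q → ζ.im ∈ Icc u v → DifferentiableAt ℂ f ζ) :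
    hInt f u p q - hInt f v p q + (vInt f q u v - vInt f p u v) = 0 := by
  have h := Complex.integral_boundary_rect_eq_zero_of_differentiableOn f ⟨p, u⟩ ⟨q, v⟩ (by
    rw [uIcc_of_le hpq, uIcc_of_le huv]
    exact fun ζ hζ => (hf ζ hζ.1 hζ.2).differentiableWithinAt)
  simp only [smul_eq_mul] at h
  rw [← add_sub_assoc]
  exact h

end Segments

section Keyhole

variable {f g : ℂ → ℂ} {x₀ r a b : ℝ}

lemma mem_keyholeRegion {x y : ℝ} : (x + y * Complex.I : ℂ) ∈ keyholeRegion x₀ r a b ↔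
    a ≤ x ∧ x ≤ b ∧ |y| ≤ Real.pi ∧ (r ≤ |x - x₀| ∨ |y| ≤ Real.pi - r) := by
  simp [keyholeRegion]

lemma mem_keyholeBoundary {x y : ℝ} : (x + y * Complex.I : ℂ) ∈ keyholeBoundary x₀ r a b ↔
    (a ≤ x ∧ x ≤ b ∧ |y| ≤ Real.pi ∧ (r ≤ |x - x₀| ∨ |y| ≤ Real.pi - r)) ∧
      (x = a ∨ x = b ∨ |y| = Real.pi ∨ (|x - x₀| ≤ r ∧ Real.pi - r ≤ |y|)) := by
  simp [keyholeBoundary, keyholeRegion]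

/-- The edges of the keyhole contour. -/
lemma keyhole_edges (hr : 0 < r) (hrπ : r < Real.pi) (ha : a < x₀ - r) (hb : x₀ + r < b) :
    (∀ y : ℝ, |y| = Real.pi → ∀ x ∈ Icc a (x₀ - r),
      (x + y * Complex.I : ℂ) ∈ keyholeBoundary x₀ r a b) ∧
    (∀ y : ℝ, |y| = Real.pi → ∀ x ∈ Icc (x₀ + r) b,
      (x + y * Complex.I : ℂ) ∈ keyholeBoundary x₀ r a b) ∧
    (∀ y : ℝ, |y| = Real.pi - r → ∀ x ∈ Icc (x₀ - r) (x₀ + r),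
      (x + y * Complex.I : ℂ) ∈ keyholeBoundary x₀ r a b) ∧
    (∀ x : ℝ, x = a ∨ x = b → ∀ y ∈ Icc (-Real.pi) Real.pi,
      (x + y * Complex.I : ℂ) ∈ keyholeBoundary x₀ r a b) ∧
    (∀ x : ℝ, |x - x₀| = r → ∀ y ∈ Icc (-Real.pi) (-Real.pi + r),
      (x + y * Complex.I : ℂ) ∈ keyholeBoundary x₀ r a b) ∧
    (∀ x : ℝ, |x - x₀| = r → ∀ y ∈ Icc (Real.pi - r) Real.pi,
      (x + y * Complex.I : ℂ) ∈ keyholeBoundary x₀ r a b) := by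
  simp only [mem_keyholeBoundary]
  refine ⟨fun y hy x hx => ?_, fun y hy x hx => ?_, fun y hy x hx => ?_, fun x hx y hy => ?_,
    fun x hx y hy => ?_, fun x hx y hy => ?_⟩
  · exact ⟨⟨hx.1, by linarith [hx.2], hy.le, Or.inl (by
      rw [abs_of_nonpos] <;> linarith [hx.2])⟩, Or.inr (Or.inr (Or.inl hy))⟩
  · exact ⟨⟨by linarith [hx.1], hx.2, hy.le, Or.inl (by
      rw [abs_of_nonneg] <;> linarith [hx.1])⟩, Or.inr (Or.inr (Or.inl hy))⟩
  · exact ⟨⟨by linarith [hx.1], by linarith [hx.2], by linarith, Or.inr hy.le⟩,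
      Or.inr (Or.inr (Or.inr ⟨abs_le.2 ⟨by linarith [hx.1], by linarith [hx.2]⟩, hy.ge⟩))⟩
  · have hxr : a ≤ x ∧ x ≤ b ∧ r ≤ |x - x₀| := by
      rcases hx with rfl | rfl
      · exact ⟨le_rfl, by linarith, by rw [abs_of_nonpos] <;> linarith⟩
      · exact ⟨by linarith, le_rfl, by rw [abs_of_nonneg] <;> linarith⟩
    exact ⟨⟨hxr.1, hxr.2.1, abs_le.2 hy, Or.inl hxr.2.2⟩, by tauto⟩
  · have hx' := abs_le.1 hx.le
    refine ⟨⟨by linarith, by linarith, abs_le.2 ⟨hy.1, by linarith [hy.2]⟩, Or.inl hx.ge⟩,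
      Or.inr (Or.inr (Or.inr ⟨hx.le, ?_⟩))⟩
    exact le_trans (by linarith [hy.2]) (neg_le_abs y)
  · have hx' := abs_le.1 hx.le
    refine ⟨⟨by linarith, by linarith, abs_le.2 ⟨by linarith [hy.1], hy.2⟩, Or.inl hx.ge⟩,
      Or.inr (Or.inr (Or.inr ⟨hx.le, ?_⟩))⟩
    exact hy.1.trans (le_abs_self y)

lemma keyhole_add (hr : 0 < r) (hrπ : r < Real.pi) (ha : a < x₀ - r) (hb : x₀ + r < b)
    (hf : ContinuousOn f (keyholeBoundary x₀ r a b))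
    (hg : ContinuousOn g (keyholeBoundary x₀ r a b)) :
    keyhole x₀ r a b (fun ζ => f ζ + g ζ) = keyhole x₀ r a b f + keyhole x₀ r a b g := by
  obtain ⟨h1, h2, h3, h4, h5, h6⟩ := keyhole_edges hr hrπ ha hb
  have hπ : |Real.pi| = Real.pi := abs_of_pos Real.pi_pos
  have hπ' : |-Real.pi| = Real.pi := (abs_neg _).trans hπ
  have hr1 : |Real.pi - r| = Real.pi - r := abs_of_pos (by linarith)
  have hr2 : |-Real.pi + r| = Real.pi - r := by rw [← abs_neg, neg_add_rev, neg_neg, neg_add_eq_sub, hr1]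
  have hx1 : |x₀ - r - x₀| = r := by rw [sub_sub_cancel_left, abs_neg, abs_of_pos hr]
  have hx2 : |x₀ + r - x₀| = r := by rw [add_sub_cancel_left, abs_of_pos hr]
  have hpp := Real.pi_pos
  unfold keyhole
  rw [hInt_add hf hg ha.le (h1 _ hπ'), hInt_add hf hg (by linarith) (h3 _ hr2),
    hInt_add hf hg hb.le (h2 _ hπ'), hInt_add hf hg ha.le (h1 _ hπ),
    hInt_add hf hg (by linarith) (h3 _ hr1), hInt_add hf hg hb.le (h2 _ hπ),
    vInt_add hf hg (by linarith) (h4 _ (Or.inr rfl)), vInt_add hf hg (by linarith) (h4 _ (Or.inl rfl)),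
    vInt_add hf hg (by linarith) (h5 _ hx1), vInt_add hf hg (by linarith) (h6 _ hx1),
    vInt_add hf hg (by linarith) (h5 _ hx2), vInt_add hf hg (by linarith) (h6 _ hx2)]
  ring

lemma keyhole_congr (hr : 0 < r) (hrπ : r < Real.pi) (ha : a < x₀ - r) (hb : x₀ + r < b)
    (hfg : EqOn f g (keyholeBoundary x₀ r a b)) : keyhole x₀ r a b f = keyhole x₀ r a b g := by
  obtain ⟨h1, h2, h3, h4, h5, h6⟩ := keyhole_edges hr hrπ ha hb
  have hπ : |Real.pi| = Real.pi := abs_of_pos Real.pi_pos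
  have hπ' : |-Real.pi| = Real.pi := (abs_neg _).trans hπ
  have hr1 : |Real.pi - r| = Real.pi - r := abs_of_pos (by linarith)
  have hr2 : |-Real.pi + r| = Real.pi - r := by rw [← abs_neg, neg_add_rev, neg_neg, neg_add_eq_sub, hr1]
  have hx1 : |x₀ - r - x₀| = r := by rw [sub_sub_cancel_left, abs_neg, abs_of_pos hr]
  have hx2 : |x₀ + r - x₀| = r := by rw [add_sub_cancel_left, abs_of_pos hr]
  have hpp := Real.pi_pos
  unfold keyhole
  rw [hInt_congr ha.le (h1 _ hπ') hfg, hInt_congr (by linarith) (h3 _ hr2) hfg,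
    hInt_congr hb.le (h2 _ hπ') hfg, hInt_congr ha.le (h1 _ hπ) hfg,
    hInt_congr (by linarith) (h3 _ hr1) hfg, hInt_congr hb.le (h2 _ hπ) hfg,
    vInt_congr (by linarith) (h4 _ (Or.inr rfl)) hfg, vInt_congr (by linarith) (h4 _ (Or.inl rfl)) hfg,
    vInt_congr (by linarith) (h5 _ hx1) hfg, vInt_congr (by linarith) (h6 _ hx1) hfg,
    vInt_congr (by linarith) (h5 _ hx2) hfg, vInt_congr (by linarith) (h6 _ hx2) hfg]

lemma keyhole_const_mul (k : ℂ) :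
    keyhole x₀ r a b (fun ζ => k * f ζ) = k * keyhole x₀ r a b f := by
  simp only [keyhole, hInt, vInt, intervalIntegral.integral_const_mul]
  ring

lemma keyhole_sum (hr : 0 < r) (hrπ : r < Real.pi) (ha : a < x₀ - r) (hb : x₀ + r < b)
    {ι : Type*} (S : Finset ι) (F : ι → ℂ → ℂ)
    (hF : ∀ i ∈ S, ContinuousOn (F i) (keyholeBoundary x₀ r a b)) :
    keyhole x₀ r a b (fun ζ => ∑ i ∈ S, F i ζ) = ∑ i ∈ S, keyhole x₀ r a b (F i) := by
  classical
  induction S using Finset.induction_on with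
  | empty => simp [keyhole, hInt, vInt]
  | insert i S hi ih =>
    simp only [Finset.sum_insert hi]
    rw [← ih fun j hj => hF j (Finset.mem_insert_of_mem hj)]
    exact keyhole_add hr hrπ ha hb (hF i (Finset.mem_insert_self i S))
      (continuousOn_finsetSum _ fun j hj => hF j (Finset.mem_insert_of_mem hj))

/-- Cauchy's theorem for the keyhole contour. -/
lemma keyhole_eq_zero (hr : 0 < r) (hrπ : r < Real.pi) (ha : a < x₀ - r) (hb : x₀ + r < b)
    (hf : ∀ ζ ∈ keyholeRegion x₀ r a b, DifferentiableAt ℂ f ζ) : keyhole x₀ r a b f = 0 := by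
  have hpp := Real.pi_pos
  have hfc : ContinuousOn f (keyholeRegion x₀ r a b) := fun ζ hζ =>
    (hf ζ hζ).continuousAt.continuousWithinAt
  have e1 := hInt_sub_add_vInt_sub_eq_zero (f := f) ha.le (u := -Real.pi) (v := Real.pi)
    (by linarith) fun ζ h1 h2 => hf ζ ⟨h1.1, by linarith [h1.2], abs_le.2 h2, Or.inl (by
      rw [abs_of_nonpos] <;> linarith [h1.2])⟩
  have e2 := hInt_sub_add_vInt_sub_eq_zero (f := f) hb.le (u := -Real.pi) (v := Real.pi)
    (by linarith) fun ζ h1 h2 => hf ζ ⟨by linarith [h1.1], h1.2, abs_le.2 h2, Or.inl (by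
      rw [abs_of_nonneg] <;> linarith [h1.1])⟩
  have e3 := hInt_sub_add_vInt_sub_eq_zero (f := f) (p := x₀ - r) (q := x₀ + r) (by linarith)
    (u := -Real.pi + r) (v := Real.pi - r)
    (by linarith) fun ζ h1 h2 => hf ζ ⟨by linarith [h1.1], by linarith [h1.2],
      abs_le.2 ⟨by linarith [h2.1], by linarith [h2.2]⟩, Or.inr
        (abs_le.2 ⟨by linarith [h2.1], by linarith [h2.2]⟩)⟩
  have hv : ∀ x : ℝ, |x - x₀| = r → ∀ y ∈ Icc (-Real.pi) Real.pi,
      (x + y * Complex.I : ℂ) ∈ keyholeRegion x₀ r a b := fun x hx y hy => by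
    have hx' := abs_le.1 hx.le
    exact mem_keyholeRegion.2 ⟨by linarith, by linarith, abs_le.2 hy, Or.inl hx.ge⟩
  have hx1 : |x₀ - r - x₀| = r := by rw [sub_sub_cancel_left, abs_neg, abs_of_pos hr]
  have hx2 : |x₀ + r - x₀| = r := by rw [add_sub_cancel_left, abs_of_pos hr]
  have hsplit : ∀ x : ℝ, |x - x₀| = r → vInt f x (-Real.pi) (-Real.pi + r) +
      vInt f x (-Real.pi + r) (Real.pi - r) + vInt f x (Real.pi - r) Real.pi =
      vInt f x (-Real.pi) Real.pi := fun x hx => by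
    rw [vInt_add_adjacent hfc (by linarith) (by linarith) fun y hy =>
      hv x hx y ⟨hy.1, by linarith [hy.2]⟩,
      vInt_add_adjacent hfc (by linarith) (by linarith) (hv x hx)]
  have h1 := hsplit _ hx1
  have h2 := hsplit _ hx2
  unfold keyhole
  linear_combination e1 + e2 + e3 + h1 - h2

lemma vInt_exp_mul (f : ℂ → ℂ) (x : ℝ) :
    vInt (fun ζ => Complex.exp ζ * f (Complex.exp ζ)) x (-Real.pi) Real.pi =
      ∮ σ in C(0, Real.exp x), f σ := by
  have h1 : ∀ y : ℝ, Complex.exp (x + y * Complex.I) = circleMap 0 (Real.exp x) y := fun y => by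
    rw [Complex.exp_add, circleMap, zero_add, Complex.ofReal_exp]
  have hper : Function.Periodic
      (fun y : ℝ => circleMap 0 (Real.exp x) y * f (circleMap 0 (Real.exp x) y)) (2 * Real.pi) :=
    fun y => by simp only [periodic_circleMap 0 (Real.exp x) y]
  have h2 := hper.intervalIntegral_add_eq (-Real.pi) 0
  rw [show -Real.pi + 2 * Real.pi = Real.pi by ring, zero_add] at h2
  simp only [vInt, h1]
  rw [h2, circleIntegral, ← intervalIntegral.integral_const_mul]
  refine intervalIntegral.integral_congr fun y _ => ?_
  simp only [deriv_circleMap, smul_eq_mul]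
  ring

lemma eq_log_of_exp_eq {ζ z : ℂ} (hz : z ∈ Complex.slitPlane) (hζ : |ζ.im| ≤ Real.pi)
    (h : Complex.exp ζ = z) : |ζ.im| < Real.pi ∧ ζ = Complex.log z := by
  have h1 : |ζ.im| < Real.pi := by
    refine lt_of_le_of_ne hζ fun h2 => ?_
    have h3 : Complex.exp ζ = ((-Real.exp ζ.re : ℝ) : ℂ) := by
      have h4 : ζ = Real.log (Real.exp ζ.re) + ζ.im * Complex.I := by
        rw [Real.log_exp, Complex.re_add_im]
      have h5 := exp_cutPoint (Real.exp_pos ζ.re) h2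
      rw [cutPoint, ← h4] at h5
      rw [h5]
      push_cast
      rfl
    rw [← h, h3, Complex.ofReal_mem_slitPlane] at hz
    linarith [Real.exp_pos ζ.re]
  refine ⟨h1, ?_⟩
  rw [← h, Complex.log_exp (abs_lt.1 h1).1 (abs_lt.1 h1).2.le]

/-- A point of the cut plane lies strictly inside the image of the keyhole contour. -/
def InsideKeyhole (x₀ r a b : ℝ) (z : ℂ) : Prop :=
  z ∈ Complex.slitPlane ∧ a < (Complex.log z).re ∧ (Complex.log z).re < b ∧
    (r < |(Complex.log z).re - x₀| ∨ |(Complex.log z).im| < Real.pi - r)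

lemma InsideKeyhole.exp_ne {z : ℂ} (hz : InsideKeyhole x₀ r a b z) {ζ : ℂ}
    (hζ : ζ ∈ keyholeBoundary x₀ r a b) : Complex.exp ζ ≠ z := by
  intro h
  obtain ⟨⟨h1, h2, h3, h4⟩, h5⟩ := hζ
  obtain ⟨h6, rfl⟩ := eq_log_of_exp_eq hz.1 h3 h
  obtain ⟨-, h7, h8, h9⟩ := hz
  rcases h5 with h5 | h5 | h5 | h5
  · exact h7.ne' h5
  · exact h8.ne h5
  · exact h6.ne h5
  · rcases h9 with h9 | h9
    · linarith [h5.1]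
    · linarith [h5.2]

lemma differentiableAt_exp_mul_pow_inv (k : ℕ) {z ζ : ℂ} (h : Complex.exp ζ ≠ z) :
    DifferentiableAt ℂ (fun ζ => Complex.exp ζ * ((Complex.exp ζ - z) ^ (k + 1))⁻¹) ζ := by
  have h1 : DifferentiableAt ℂ (fun ζ => (Complex.exp ζ - z) ^ (k + 1)) ζ := by fun_prop
  exact Complex.differentiable_exp.differentiableAt.mul
    (h1.inv (pow_ne_zero _ (sub_ne_zero.2 h)))

/-- The notches contribute nothing by Cauchy's theorem and the two sides of the cut cancel by
periodicity of `exp`, which leaves two full circles. -/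
lemma keyhole_pow_inv (hr : 0 < r) (hrπ : r < Real.pi) {z : ℂ} (hz : InsideKeyhole x₀ r a b z)
    (k : ℕ) :
    keyhole x₀ r a b (fun ζ => Complex.exp ζ * ((Complex.exp ζ - z) ^ (k + 1))⁻¹) =
      if k = 0 then 2 * Real.pi * Complex.I else 0 := by
  have hz0 := norm_pos_iff.2 (Complex.slitPlane_ne_zero hz.1)
  set F : ℂ → ℂ := fun ζ => Complex.exp ζ * ((Complex.exp ζ - z) ^ (k + 1))⁻¹ with hF
  have hper : ∀ p q : ℝ, hInt F Real.pi p q = hInt F (-Real.pi) p q := fun p q => by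
    refine intervalIntegral.integral_congr fun x _ => ?_
    have h1 : Complex.exp (x + Real.pi * Complex.I) = Complex.exp (x + (-Real.pi : ℝ) * Complex.I) := by
      rw [Complex.exp_add, Complex.exp_add, Complex.exp_pi_mul_I]
      push_cast
      rw [neg_mul, Complex.exp_neg, Complex.exp_pi_mul_I]
      norm_num
    simp only [hF, h1]
  -- the removed squares contain no logarithm of `z`
  have hsq : ∀ ζ : ℂ, ζ.re ∈ Icc (x₀ - r) (x₀ + r) → |ζ.im| ≤ Real.pi → Real.pi - r ≤ |ζ.im| →
      DifferentiableAt ℂ F ζ := fun ζ h1 h2 h3 => by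
    refine differentiableAt_exp_mul_pow_inv k fun h => ?_
    obtain ⟨-, rfl⟩ := eq_log_of_exp_eq hz.1 h2 h
    rcases hz.2.2.2 with h4 | h4
    · exact absurd (abs_le.2 ⟨by linarith [h1.1], by linarith [h1.2]⟩) (not_le.2 h4)
    · linarith
  have hlow := hInt_sub_add_vInt_sub_eq_zero (f := F) (p := x₀ - r) (q := x₀ + r) (by linarith)
    (u := -Real.pi) (v := -Real.pi + r) (by linarith) fun ζ h1 h2 =>
      hsq ζ h1 (abs_le.2 ⟨h2.1, by linarith [h2.2]⟩) (le_trans (by linarith [h2.2]) (neg_le_abs _))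
  have hupp := hInt_sub_add_vInt_sub_eq_zero (f := F) (p := x₀ - r) (q := x₀ + r) (by linarith)
    (u := Real.pi - r) (v := Real.pi) (by linarith) fun ζ h1 h2 =>
      hsq ζ h1 (abs_le.2 ⟨by linarith [h2.1], h2.2⟩) (h2.1.trans (le_abs_self _))
  have hR : vInt F b (-Real.pi) Real.pi = if k = 0 then 2 * Real.pi * Complex.I else 0 := by
    rw [hF, vInt_exp_mul (fun σ => ((σ - z) ^ (k + 1))⁻¹)]
    refine circleIntegral_pow_inv k (mem_ball_zero_iff.2 ?_)
    rw [← Real.log_lt_iff_lt_exp hz0, ← Complex.log_re]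
    exact hz.2.2.1
  have hL : vInt F a (-Real.pi) Real.pi = 0 := by
    rw [hF, vInt_exp_mul (fun σ => ((σ - z) ^ (k + 1))⁻¹)]
    refine circleIntegral_pow_inv_of_lt k (Real.exp_pos _) ?_
    rw [← Real.lt_log_iff_exp_lt hz0, ← Complex.log_re]
    exact hz.2.1
  unfold keyhole
  rw [hper, hper, hR, hL]
  rw [hper] at hupp
  linear_combination -hlow - hupp

/-- The residue theorem for the keyhole contour: `N` is the pullback of `M` under `exp` with the
factor `e ^ ζ`, and `I z` is the integral of `M` over a small circle about the singularity `z`. -/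
theorem keyhole_eq_sum (hr : 0 < r) (hrπ : r < Real.pi) (ha : a < x₀ - r) (hb : x₀ + r < b)
    {M N I : ℂ → ℂ} {S : Finset ℂ} (hS : ∀ z ∈ S, InsideKeyhole x₀ r a b z)
    (hNM : ∀ ζ : ℂ, |ζ.im| < Real.pi → N ζ = Complex.exp ζ * M (Complex.exp ζ))
    (hN : ∀ ζ ∈ keyholeRegion x₀ r a b, Complex.exp ζ ∉ S → AnalyticAt ℂ N ζ)
    (hM : ∀ z ∈ S, MeromorphicAt M z)
    (hI : ∀ z ∈ S, ∃ ϱ : ℝ, 0 < ϱ ∧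
      (∀ σ : ℂ, σ ≠ z → ‖σ - z‖ ≤ ϱ → DifferentiableAt ℂ M σ) ∧ (∮ σ in C(z, ϱ), M σ) = I z) :
    keyhole x₀ r a b N = ∑ z ∈ S, I z := by
  classical
  -- subtracting the pulled-back principal parts `Q z` leaves removable singularities only
  have hpp : ∀ z ∈ S, ∃ (n : ℕ) (α : ℕ → ℂ) (h : ℂ → ℂ), AnalyticAt ℂ h z ∧
      (∀ᶠ σ in 𝓝[≠] z, M σ = ∑ k ∈ Finset.range n, α k * ((σ - z) ^ (k + 1))⁻¹ + h σ) ∧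
      (∑ k ∈ Finset.range n, α k * if k = 0 then 2 * Real.pi * Complex.I else 0) = I z := by
    intro z hz
    obtain ⟨n, α, h, hh, hev⟩ := exists_principalPart (hM z hz)
    obtain ⟨ϱ, hϱ, hd, hIz⟩ := hI z hz
    exact ⟨n, α, h, hh, hev, by rw [← hIz, circleIntegral_eq_of_principalPart hϱ hd hh hev]⟩
  choose! n α h hh hev hIz using hpp
  set Q : ℂ → ℂ → ℂ := fun z ζ => ∑ k ∈ Finset.range (n z),
    α z k * (Complex.exp ζ * ((Complex.exp ζ - z) ^ (k + 1))⁻¹) with hQ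
  have hQan : ∀ z ζ : ℂ, Complex.exp ζ ≠ z → AnalyticAt ℂ (Q z) ζ := fun z ζ hz => by
    simp only [hQ]
    refine Finset.analyticAt_fun_sum _ fun k _ => analyticAt_const.mul
      (analyticAt_cexp.mul (AnalyticAt.inv ?_ (pow_ne_zero _ (sub_ne_zero.2 hz))))
    exact (analyticAt_cexp.sub analyticAt_const).pow _
  set V : ℂ → ℂ := fun ζ => ∑ z ∈ S, Q z ζ with hV
  set G : ℂ → ℂ := fun ζ => N ζ - V ζ with hG
  have hGan : ∀ ζ ∈ keyholeRegion x₀ r a b, Complex.exp ζ ∉ S → AnalyticAt ℂ G ζ :=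
    fun ζ hζ hζS => (hN ζ hζ hζS).sub (Finset.analyticAt_fun_sum _ fun z hz =>
      hQan z ζ fun h => hζS (h ▸ hz))
  set G' : ℂ → ℂ := fun ζ => limUnder (𝓝[≠] ζ) G with hG'
  have hG'd : ∀ ζ ∈ keyholeRegion x₀ r a b, DifferentiableAt ℂ G' ζ := by
    intro ζ₀ hζ
    by_cases hζS : Complex.exp ζ₀ ∈ S
    · set z := Complex.exp ζ₀ with hz
      obtain ⟨him, -⟩ := eq_log_of_exp_eq (hS z hζS).1 hζ.2.2.1 rfl
      refine differentiableAt_limUnder (h := fun ζ => Complex.exp ζ * h z (Complex.exp ζ) -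
        ∑ w ∈ S.erase z, Q w ζ) ?_ ?_
      · refine (analyticAt_cexp.mul ((hh z hζS).fun_comp analyticAt_cexp)).sub ?_
        exact Finset.analyticAt_fun_sum _ fun w hw => hQan w ζ₀ (Finset.ne_of_mem_erase hw).symm
      · have h1 : Tendsto Complex.exp (𝓝[≠] ζ₀) (𝓝[≠] z) :=
          (Complex.hasDerivAt_exp ζ₀).tendsto_nhdsNE (Complex.exp_ne_zero _)
        have h2 : ∀ᶠ ζ : ℂ in 𝓝[≠] ζ₀, |ζ.im| < Real.pi :=
          nhdsWithin_le_nhds ((isOpen_lt (by fun_prop : Continuous fun ζ : ℂ => |ζ.im|)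
            continuous_const).mem_nhds him)
        filter_upwards [h1.eventually (hev z hζS), h2] with ζ h3 h4
        simp only [hG, hV]
        rw [hNM ζ h4, h3, ← Finset.add_sum_erase S _ hζS, mul_add, Finset.mul_sum]
        have h5 : Q z ζ = ∑ k ∈ Finset.range (n z), Complex.exp ζ *
            (α z k * ((Complex.exp ζ - z) ^ (k + 1))⁻¹) :=
          Finset.sum_congr rfl fun k _ => mul_left_comm _ _ _
        rw [h5]
        ring
    · exact differentiableAt_limUnder (hGan ζ₀ hζ hζS) (Eventually.of_forall fun _ => rfl)
  have hbS : ∀ ζ ∈ keyholeBoundary x₀ r a b, Complex.exp ζ ∉ S := fun ζ hζ hζS =>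
    (hS _ hζS).exp_ne hζ rfl
  have hQc : ∀ z ∈ S, ContinuousOn (Q z) (keyholeBoundary x₀ r a b) := fun z hz ζ hζ =>
    (hQan z ζ ((hS z hz).exp_ne hζ)).continuousAt.continuousWithinAt
  have h1 : keyhole x₀ r a b N = keyhole x₀ r a b (fun ζ => G' ζ + V ζ) := by
    refine keyhole_congr hr hrπ ha hb fun ζ hζ => ?_
    have h2 : G' ζ = G ζ := limUnder_eq_of_continuousAt (hGan ζ hζ.1 (hbS ζ hζ)).continuousAt
    simp only [h2, hG, sub_add_cancel]
  rw [h1, keyhole_add hr hrπ ha hb (fun ζ hζ => (hG'd ζ hζ.1).continuousAt.continuousWithinAt)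
    (continuousOn_finsetSum _ hQc), keyhole_eq_zero hr hrπ ha hb hG'd, zero_add,
    keyhole_sum hr hrπ ha hb S Q hQc]
  refine Finset.sum_congr rfl fun z hz => ?_
  rw [← hIz z hz, hQ, keyhole_sum hr hrπ ha hb _ _ fun k _ => ?_]
  · refine Finset.sum_congr rfl fun k _ => ?_
    rw [keyhole_const_mul, keyhole_pow_inv hr hrπ (hS z hz)]
  · exact fun ζ hζ => (continuousAt_const.mul (differentiableAt_exp_mul_pow_inv k
      ((hS z hz).exp_ne hζ)).continuousAt).continuousWithinAt

end Keyhole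

/-! ### The keyhole identity for the transform of the solution -/

section KeyholeIdentity

variable {α₁ α₂ c lam : ℝ}

/-- There are arbitrarily small squares about the two points over `-c` on whose boundaries `s W(s)`
is bounded by one and the same constant. -/
lemma exists_good_notch (hα : α₁ < α₂) (hc : 0 < c) : ∃ B : ℝ, ∀ r₁ : ℝ, 0 < r₁ →
    ∃ r : ℝ, 0 < r ∧ r < r₁ ∧ ∀ ζ : ℂ, max |ζ.re - Real.log c| (Real.pi - |ζ.im|) = r →
      |ζ.im| ≤ Real.pi →
      1 + Complex.exp (logRatio α₁ α₂ c lam ζ) ≠ 0 ∧ ‖logTransform α₁ α₂ c lam ζ‖ ≤ B := by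
  have hπ : |Real.pi| = Real.pi := abs_of_pos Real.pi_pos
  obtain ⟨A, r₀, hP⟩ := exists_isPoleChart_logRatio (lam := lam) hα hc hπ
  obtain ⟨δ, hδ, hδ1, h⟩ := hP.exists_good_radius
  refine ⟨(δ / 2)⁻¹, fun r₁ hr₁ => ?_⟩
  obtain ⟨r, hr, hrr, hgood⟩ := h r₁ hr₁
  have hupper : ∀ ζ : ℂ, 0 ≤ ζ.im → max |ζ.re - Real.log c| (Real.pi - |ζ.im|) = r →
      |ζ.im| ≤ Real.pi → 1 + Complex.exp (logRatio α₁ α₂ c lam ζ) ≠ 0 ∧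
        ‖logTransform α₁ α₂ c lam ζ‖ ≤ (δ / 2)⁻¹ := fun ζ h0 hζ hζπ => by
    have h1 := norm_one_add_exp_ge hδ1 (hgood (ζ - cutPoint c Real.pi) (by
      rw [Complex.sub_re, Complex.sub_im, cutPoint_re, cutPoint_im, abs_sub_comm ζ.im,
        abs_of_nonneg (by rw [abs_of_nonneg h0] at hζπ; linarith : 0 ≤ Real.pi - ζ.im)]
      rwa [abs_of_nonneg h0] at hζ))
    simp only [add_sub_cancel] at h1
    have h2 : 0 < ‖1 + Complex.exp (logRatio α₁ α₂ c lam ζ)‖ := lt_of_lt_of_le (by positivity) h1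
    refine ⟨norm_pos_iff.1 h2, ?_⟩
    rw [logTransform, norm_inv]
    gcongr
  refine ⟨r, hr, hrr, fun ζ hζ hζπ => ?_⟩
  rcases le_total 0 ζ.im with h0 | h0
  · exact hupper ζ h0 hζ hζπ
  · have h1 := hupper ((starRingEnd ℂ) ζ) (by simpa using h0) (by simpa using hζ) (by simpa using hζπ)
    rw [logTransform_conj, logRatio_conj, Complex.exp_conj, RCLike.norm_conj] at h1
    refine ⟨fun h2 => h1.1 ?_, h1.2⟩
    have h3 := congrArg (starRingEnd ℂ) h2
    simpa using h3

lemma analyticAt_logTransform {ζ : ℂ} (h : Complex.exp ζ + c ≠ 0)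
    (h1 : 1 + Complex.exp (logRatio α₁ α₂ c lam ζ) ≠ 0) :
    AnalyticAt ℂ (logTransform α₁ α₂ c lam) ζ :=
  (analyticOnNhd_one_add_exp ζ h).inv h1

/-- A good square notch contains or excludes every pole strictly, and the transform has no
singularity on the closed keyhole region apart from the poles inside. -/
lemma mem_region_cases (hc : 0 < c) (hlam : 0 < lam)
    (hcut : ∀ ρ : ℝ, 0 < ρ → ρ ≠ c → denom α₁ α₂ c lam (-(ρ : ℂ)) ≠ 0) {r a b : ℝ} (hr : 0 < r)
    (hgood : ∀ ζ : ℂ, max |ζ.re - Real.log c| (Real.pi - |ζ.im|) = r → |ζ.im| ≤ Real.pi →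
      1 + Complex.exp (logRatio α₁ α₂ c lam ζ) ≠ 0)
    (hpoles : ∀ z ∈ poles α₁ α₂ c lam, a < (Complex.log z).re ∧ (Complex.log z).re < b) {ζ : ℂ}
    (hζ : ζ ∈ keyholeRegion (Real.log c) r a b) : Complex.exp ζ + c ≠ 0 ∧
      (1 + Complex.exp (logRatio α₁ α₂ c lam ζ) = 0 → Complex.exp ζ ∈ poles α₁ α₂ c lam ∧
        InsideKeyhole (Real.log c) r a b (Complex.exp ζ)) := by
  obtain ⟨h1, h2, h3, h4⟩ := hζ
  have hne : Complex.exp ζ + c ≠ 0 := by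
    intro h0
    have h5 : ζ.re = Real.log c ∧ |ζ.im| = Real.pi := by
      rcases exp_add_eq_zero_of_abs_im_le hc h3 h0 with h | h
      · rw [h]; simp [abs_of_pos Real.pi_pos]
      · rw [h]; simp [abs_of_pos Real.pi_pos]
    rw [h5.1, h5.2, sub_self, abs_zero] at h4
    rcases h4 with h4 | h4 <;> linarith
  refine ⟨hne, fun h0 => ?_⟩
  have him : |ζ.im| < Real.pi := by
    refine lt_of_le_of_ne h3 fun h5 => ?_
    have h6 : ζ = cutPoint (Real.exp ζ.re) ζ.im := by
      rw [cutPoint, Real.log_exp, Complex.re_add_im]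
    have h7 : Real.exp ζ.re ≠ c := by
      intro h7
      apply hne
      rw [h6, exp_cutPoint (Real.exp_pos _) h5, h7]
      ring
    have h8 := one_add_exp_cutPoint_ne_zero hlam hcut (Real.exp_pos ζ.re) h7 h5
    rw [← h6] at h8
    exact h8 h0
  have hlog : Complex.log (Complex.exp ζ) = ζ := Complex.log_exp (abs_lt.1 him).1 (abs_lt.1 him).2.le
  have hslit : Complex.exp ζ ∈ Complex.slitPlane := by
    rw [Complex.mem_slitPlane_iff_arg]
    refine ⟨fun h => ?_, Complex.exp_ne_zero _⟩
    rw [← Complex.log_im, hlog] at h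
    rw [h, abs_of_pos Real.pi_pos] at him
    exact lt_irrefl _ him
  have hp : Complex.exp ζ ∈ poles α₁ α₂ c lam :=
    (mem_poles_iff hc hlam).2 ⟨hslit, by rwa [hlog]⟩
  have hab := hpoles _ hp
  refine ⟨hp, hslit, hab.1, hab.2, ?_⟩
  rw [hlog]
  -- a zero in the closed region that is not strictly inside lies on the boundary of a notch
  by_contra hcon
  push Not at hcon
  refine hgood ζ (le_antisymm (max_le hcon.1 (by linarith [hcon.2])) ?_) h3 h0
  rcases h4 with h4 | h4
  · exact h4.trans (le_max_left _ _)
  · exact le_trans (by linarith) (le_max_right _ _)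

lemma meromorphicAt_solutionTransform (hc : 0 < c) (hlam : 0 < lam) {z : ℂ}
    (hz : z ∈ Complex.slitPlane) : MeromorphicAt (solutionTransform α₁ α₂ c lam) z := by
  have hz0 := Complex.slitPlane_ne_zero hz
  have hne : Complex.exp (Complex.log z) + c ≠ 0 := by
    rw [Complex.exp_log hz0]; exact slitPlane_add_ne_zero hc hz
  have h1 : MeromorphicAt (fun s : ℂ => s⁻¹ * logTransform α₁ α₂ c lam (Complex.log s)) z := by
    refine (analyticAt_id.inv hz0).meromorphicAt.mul ?_
    have h2 : AnalyticAt ℂ (fun s => 1 + Complex.exp (logRatio α₁ α₂ c lam (Complex.log s))) z :=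
      (analyticOnNhd_one_add_exp (Complex.log z) hne).fun_comp (analyticAt_clog hz)
    exact h2.meromorphicAt.inv
  refine h1.congr (Filter.Eventually.filter_mono nhdsWithin_le_nhds ?_)
  filter_upwards [Complex.isOpen_slitPlane.mem_nhds hz] with s hs
  exact (solutionTransform_eq_logTransform hlam (Complex.slitPlane_ne_zero hs)
    (slitPlane_add_ne_zero hc hs)).symm

/-- The residue theorem for `W(σ) / (σ - s)` on a keyhole contour with a good notch. -/
lemma keyhole_logTransform (hα₁ : 0 < α₁) (hα : α₁ < α₂) (hc : 0 < c) (hlam : 0 < lam)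
    (hcut : ∀ ρ : ℝ, 0 < ρ → ρ ≠ c → denom α₁ α₂ c lam (-(ρ : ℂ)) ≠ 0) {ϱ : ℂ → ℝ}
    (hϱ : ∀ z ∈ poles α₁ α₂ c lam, 0 < ϱ z ∧ ϱ z ≤ 1 ∧ ∀ σ : ℂ, ‖σ - z‖ ≤ ϱ z →
      σ ∈ Complex.slitPlane ∧
        (σ ≠ z → 1 + Complex.exp (logRatio α₁ α₂ c lam (Complex.log σ)) ≠ 0))
    {s : ℂ} (hs0 : 0 < s.re) (hs : ∀ z ∈ poles α₁ α₂ c lam, z.re + 1 < s.re) {r a b : ℝ}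
    (hr : 0 < r) (hr1 : r < 1) (ha : a < Real.log c - r) (hb : Real.log c + r < b)
    (hgood : ∀ ζ : ℂ, max |ζ.re - Real.log c| (Real.pi - |ζ.im|) = r → |ζ.im| ≤ Real.pi →
      1 + Complex.exp (logRatio α₁ α₂ c lam ζ) ≠ 0)
    (hpoles : ∀ z ∈ poles α₁ α₂ c lam, a < (Complex.log z).re ∧ (Complex.log z).re < b)
    (hsab : a < (Complex.log s).re ∧ (Complex.log s).re < b) {F : Finset ℂ}
    (hF : ∀ z, z ∈ F ↔ z ∈ poles α₁ α₂ c lam ∧ InsideKeyhole (Real.log c) r a b z) :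
    (∀ ζ ∈ keyholeBoundary (Real.log c) r a b, AnalyticAt ℂ
      (fun ζ => logTransform α₁ α₂ c lam ζ / (Complex.exp ζ - s)) ζ) ∧
    keyhole (Real.log c) r a b (fun ζ => logTransform α₁ α₂ c lam ζ / (Complex.exp ζ - s)) =
      2 * Real.pi * Complex.I * solutionTransform α₁ α₂ c lam s +
        ∑ z ∈ F, ∮ σ in C(z, ϱ z), solutionTransform α₁ α₂ c lam σ / (σ - s) := by
  classical
  have hpi : (3 : ℝ) < Real.pi := Real.pi_gt_three
  have hsp : s ∉ poles α₁ α₂ c lam := fun h => by linarith [hs s h]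
  have hsF : s ∉ F := fun h => hsp ((hF s).1 h).1
  have hsslit : s ∈ Complex.slitPlane := Or.inl hs0
  have hsin : InsideKeyhole (Real.log c) r a b s := by
    refine ⟨hsslit, hsab.1, hsab.2, Or.inr ?_⟩
    rw [Complex.log_im]
    have := Complex.abs_arg_lt_pi_div_two_iff.2 (Or.inl hs0)
    linarith
  have hN : ∀ ζ ∈ keyholeRegion (Real.log c) r a b, Complex.exp ζ ∉ insert s F → AnalyticAt ℂ
      (fun ζ => logTransform α₁ α₂ c lam ζ / (Complex.exp ζ - s)) ζ := fun ζ hζ hζS => by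
    rw [Finset.mem_insert, not_or] at hζS
    obtain ⟨h1, h2⟩ := mem_region_cases hc hlam hcut hr hgood hpoles hζ
    refine (analyticAt_logTransform h1 fun h => hζS.2 ((hF _).2 (h2 h))).div
      (analyticAt_cexp.sub analyticAt_const) (sub_ne_zero.2 hζS.1)
  have hSin : ∀ z ∈ insert s F, InsideKeyhole (Real.log c) r a b z := fun z hz => by
    rcases Finset.mem_insert.1 hz with rfl | hz
    · exact hsin
    · exact ((hF z).1 hz).2
  refine ⟨fun ζ hζ => hN ζ hζ.1 fun h => (hSin _ h).exp_ne hζ rfl, ?_⟩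
  set I : ℂ → ℂ := fun z => if z = s then 2 * Real.pi * Complex.I * solutionTransform α₁ α₂ c lam s
    else ∮ σ in C(z, ϱ z), solutionTransform α₁ α₂ c lam σ / (σ - s) with hI
  have key := keyhole_eq_sum (N := fun ζ => logTransform α₁ α₂ c lam ζ / (Complex.exp ζ - s))
    (M := fun σ => solutionTransform α₁ α₂ c lam σ / (σ - s)) (I := I) hr (by linarith) ha hb
    hSin ?_ hN ?_ ?_
  · rw [key, Finset.sum_insert hsF]
    congr 1
    · simp [hI]
    · refine Finset.sum_congr rfl fun z hz => ?_
      simp only [hI]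
      rw [if_neg]
      rintro rfl
      exact hsF hz
  · intro ζ hζ
    have hlog : Complex.log (Complex.exp ζ) = ζ :=
      Complex.log_exp (abs_lt.1 hζ).1 (abs_lt.1 hζ).2.le
    have hslit : Complex.exp ζ ∈ Complex.slitPlane := by
      rw [Complex.mem_slitPlane_iff_arg]
      refine ⟨fun h => ?_, Complex.exp_ne_zero _⟩
      rw [← Complex.log_im, hlog] at h
      rw [h, abs_of_pos Real.pi_pos] at hζ
      exact lt_irrefl _ hζ
    rw [solutionTransform_eq_logTransform hlam (Complex.exp_ne_zero _)
      (slitPlane_add_ne_zero hc hslit), hlog, mul_div_assoc,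
      mul_inv_cancel_left₀ (Complex.exp_ne_zero _)]
  · intro z hz
    exact (meromorphicAt_solutionTransform hc hlam (hSin z hz).1).div
      (analyticAt_id.sub analyticAt_const).meromorphicAt
  · intro z hz
    rcases Finset.mem_insert.1 hz with rfl | hzF
    · obtain ⟨ϱ', hϱ0, -, hϱ'⟩ := exists_isolating_radius (lam := lam) hα₁ hα hc hlam hsslit
      have hd : ∀ σ : ℂ, ‖σ - z‖ ≤ ϱ' → DifferentiableAt ℂ (solutionTransform α₁ α₂ c lam) σ :=
        fun σ hσ => by
          refine differentiableAt_solutionTransform hc hlam (hϱ' σ hσ).1 ?_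
          by_cases hσz : σ = z
          · rw [hσz]
            exact fun h => hsp ((mem_poles_iff hc hlam).2 ⟨hsslit, h⟩)
          · exact (hϱ' σ hσ).2 hσz
      refine ⟨ϱ', hϱ0, fun σ hσ hσϱ => (hd σ hσϱ).div (by fun_prop) (sub_ne_zero.2 hσ), ?_⟩
      have h4 := Complex.circleIntegral_sub_inv_smul_of_differentiable_on_off_countable
        (R := ϱ') (c := z) (w := z) (f := solutionTransform α₁ α₂ c lam) countable_empty
        (Metric.mem_ball_self hϱ0)
        (fun σ hσ => (hd σ (mem_closedBall_iff_norm.1 hσ)).continuousAt.continuousWithinAt)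
        (fun σ hσ => hd σ (mem_ball_iff_norm.1 hσ.1).le)
      simp only [hI, if_true]
      rw [← smul_eq_mul, ← h4]
      refine circleIntegral.integral_congr hϱ0.le fun σ _ => ?_
      simp only [smul_eq_mul]
      rw [div_eq_mul_inv, mul_comm]
    · have hzp := ((hF z).1 hzF).1
      obtain ⟨h1, h2, h3⟩ := hϱ z hzp
      refine ⟨ϱ z, h1, fun σ hσ hσϱ => ?_, ?_⟩
      · refine (differentiableAt_solutionTransform hc hlam (h3 σ hσϱ).1 ((h3 σ hσϱ).2 hσ)).div
          (by fun_prop) (sub_ne_zero.2 fun h => ?_)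
        have h4 := Complex.re_le_norm (σ - z)
        rw [Complex.sub_re, h] at h4
        rw [h] at hσϱ
        linarith [hs z hzp]
      · simp only [hI]
        rw [if_neg]
        rintro rfl
        exact hsF hzF

end KeyholeIdentity

/-! ### Partial fraction expansion -/

section PartialFractions

lemma norm_hInt_le {f : ℂ → ℂ} {y p q C : ℝ} (hpq : p ≤ q)
    (h : ∀ x ∈ Icc p q, ‖f (x + y * Complex.I)‖ ≤ C) : ‖hInt f y p q‖ ≤ C * (q - p) := by
  have h1 := intervalIntegral.norm_integral_le_of_norm_le_const (a := p) (b := q) (C := C)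
    (f := fun x : ℝ => f (x + y * Complex.I)) fun x hx => by
      rw [uIoc_of_le hpq] at hx
      exact h x (Ioc_subset_Icc_self hx)
  rwa [abs_of_nonneg (sub_nonneg.2 hpq)] at h1

lemma norm_vInt_le {f : ℂ → ℂ} {x p q C : ℝ} (hpq : p ≤ q)
    (h : ∀ y ∈ Icc p q, ‖f (x + y * Complex.I)‖ ≤ C) : ‖vInt f x p q‖ ≤ C * (q - p) := by
  have h1 := intervalIntegral.norm_integral_le_of_norm_le_const (a := p) (b := q) (C := C)
    (f := fun y : ℝ => f (x + y * Complex.I)) fun y hy => by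
      rw [uIoc_of_le hpq] at hy
      exact h y (Ioc_subset_Icc_self hy)
  rw [abs_of_nonneg (sub_nonneg.2 hpq)] at h1
  rwa [vInt, norm_mul, Complex.norm_I, one_mul]

variable {α₁ α₂ c lam : ℝ}

lemma integrableOn_integrand_div (hα₁ : 0 < α₁) (hα : α₁ < α₂) (hα₂ : α₂ < 1) (hc : 0 < c)
    (hlam : 0 < lam) (hcut : ∀ ρ : ℝ, 0 < ρ → ρ ≠ c → denom α₁ α₂ c lam (-(ρ : ℂ)) ≠ 0) {s : ℂ}
    (hs : 0 < s.re) :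
    IntegrableOn (fun ρ : ℝ => integrand α₁ α₂ c lam 0 ρ / (s + ρ)) (Ioi 0) := by
  refine ((integrableOn_integrand_zero hα₁ hα hα₂ hc hlam hcut).norm.div_const s.re).mono' ?_ ?_
  · exact ((measurable_integrand 0).div (by fun_prop)).aestronglyMeasurable
  · refine (ae_restrict_iff' measurableSet_Ioi).2 (Eventually.of_forall fun ρ hρ => ?_)
    have hρ : 0 < ρ := hρ
    rw [norm_div]
    gcongr
    have h1 := Complex.re_le_norm (s + ρ)
    rw [Complex.add_re, Complex.ofReal_re] at h1
    linarith

/-- The jump of `T(ζ) / (e ^ ζ - s)` between the two sides of the cut, in terms of the integrand. -/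
lemma logTransform_div_jump (hlam : 0 < lam) (s : ℂ) {x : ℝ} (hx : x ≠ Real.log c) :
    logTransform α₁ α₂ c lam (x + (-Real.pi : ℝ) * Complex.I) /
        (Complex.exp (x + (-Real.pi : ℝ) * Complex.I) - s) -
      logTransform α₁ α₂ c lam (x + Real.pi * Complex.I) /
        (Complex.exp (x + Real.pi * Complex.I) - s) =
    -(Real.exp x • (integrand α₁ α₂ c lam 0 (Real.exp x) / (s + Real.exp x))) := by
  have hπ : |Real.pi| = Real.pi := abs_of_pos Real.pi_pos
  have hxc : Real.exp x ≠ c := fun h => hx (by rw [← h, Real.log_exp])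
  have h1 : ∀ ω : ℝ, (x + ω * Complex.I : ℂ) = cutPoint (Real.exp x) ω := fun ω => by
    rw [cutPoint, Real.log_exp]
  rw [h1, h1, exp_cutPoint (Real.exp_pos x) hπ, exp_cutPoint (Real.exp_pos x) ((abs_neg _).trans hπ),
    integrand_eq_jump hlam 0 (Real.exp_pos x) hxc, mul_zero, Real.exp_zero, Complex.ofReal_one,
    mul_one, Complex.real_smul]
  have h2 : ((Real.exp x : ℝ) : ℂ) ≠ 0 := Complex.ofReal_ne_zero.2 (Real.exp_pos x).ne'
  have h3 : -((Real.exp x : ℝ) : ℂ) - s = -(s + (Real.exp x : ℝ)) := by ring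
  rw [h3, div_neg, div_neg, neg_div, mul_neg, neg_neg, mul_div_assoc, mul_inv_cancel_left₀ h2]
  ring

lemma integrable_exp_smul_comp {h : ℝ → ℂ} (hh : IntegrableOn h (Ioi 0)) :
    Integrable fun x : ℝ => Real.exp x • h (Real.exp x) := by
  rw [← Real.range_exp, ← image_univ, integrableOn_image_iff_integrableOn_abs_deriv_smul
    (f' := Real.exp) MeasurableSet.univ (fun x _ => (Real.hasDerivAt_exp x).hasDerivWithinAt)
    Real.exp_injective.injOn, integrableOn_univ] at hh
  simpa only [abs_of_pos (Real.exp_pos _)] using hh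

lemma integral_exp_smul_comp (h : ℝ → ℂ) :
    ∫ x : ℝ, Real.exp x • h (Real.exp x) = ∫ ρ in Ioi 0, h ρ := by
  rw [← Real.range_exp, ← image_univ, integral_image_eq_integral_abs_deriv_smul
    (f' := Real.exp) MeasurableSet.univ (fun x _ => (Real.hasDerivAt_exp x).hasDerivWithinAt)
    Real.exp_injective.injOn, setIntegral_univ]
  simp only [abs_of_pos (Real.exp_pos _)]

lemma tendsto_integral_avoiding {J : ℝ → ℂ} (hJ : Integrable J) (x₀ : ℝ) {a b r : ℕ → ℝ}
    (ha : Tendsto a atTop atBot) (hb : Tendsto b atTop atTop) (hr : Tendsto r atTop (𝓝 0))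
    (har : ∀ n, a n ≤ x₀ - r n) (hbr : ∀ n, x₀ + r n ≤ b n) (hr0 : ∀ n, 0 < r n) :
    Tendsto (fun n => (∫ x in a n..(x₀ - r n), J x) + ∫ x in (x₀ + r n)..b n, J x) atTop
      (𝓝 (∫ x, J x)) := by
  set E : ℕ → Set ℝ := fun n => Ioc (a n) (x₀ - r n) ∪ Ioc (x₀ + r n) (b n) with hE
  have hEm : ∀ n, MeasurableSet (E n) := fun n => measurableSet_Ioc.union measurableSet_Ioc
  have e1 : ∀ n, (∫ x in a n..(x₀ - r n), J x) + (∫ x in (x₀ + r n)..b n, J x) =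
      ∫ x, (E n).indicator J x := fun n => by
    rw [intervalIntegral.integral_of_le (har n), intervalIntegral.integral_of_le (hbr n),
      integral_indicator (hEm n), setIntegral_union _ measurableSet_Ioc hJ.integrableOn
        hJ.integrableOn]
    rw [Set.disjoint_left]
    intro x hx hx'
    linarith [hx.2, hx'.1, hr0 n]
  simp only [e1]
  refine tendsto_integral_of_dominated_convergence (fun x => ‖J x‖)
    (fun n => (hJ.indicator (hEm n)).aestronglyMeasurable) hJ.norm
    (fun n => Eventually.of_forall fun x => norm_indicator_le_norm_self _ _) ?_
  have hne : ∀ᵐ x : ℝ, x ≠ x₀ := by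
    simp [ae_iff]
  filter_upwards [hne] with x hx
  refine tendsto_const_nhds.congr' ?_
  filter_upwards [ha.eventually_lt_atBot x, hb.eventually_ge_atTop x,
    hr.eventually (gt_mem_nhds (abs_pos.2 (sub_ne_zero.2 hx)))] with n h1 h2 h3
  rw [indicator_of_mem]
  rcases lt_or_gt_of_ne hx with h | h
  · left
    rw [abs_of_neg (by linarith)] at h3
    exact ⟨h1, by linarith⟩
  · right
    rw [abs_of_pos (by linarith)] at h3
    exact ⟨by linarith, h2⟩

/-- The contribution of the pole `z` to the partial fraction expansion, when `C(z, ϱ)` encloses no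
other singularity. -/
def poleTerm (α₁ α₂ c lam : ℝ) (z : ℂ) (ϱ : ℝ) (s : ℂ) : ℂ :=
  (2 * (Real.pi : ℂ) * Complex.I)⁻¹ * ∮ σ in C(z, ϱ), solutionTransform α₁ α₂ c lam σ / (s - σ)

lemma circleIntegral_eq_neg_poleTerm (z : ℂ) (ϱ : ℝ) (s : ℂ) :
    (∮ σ in C(z, ϱ), solutionTransform α₁ α₂ c lam σ / (σ - s)) =
      -(2 * Real.pi * Complex.I * poleTerm α₁ α₂ c lam z ϱ s) := by
  rw [poleTerm, mul_inv_cancel_left₀ Complex.two_pi_I_ne_zero, circleIntegral, circleIntegral,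
    ← intervalIntegral.integral_neg]
  refine intervalIntegral.integral_congr fun θ _ => ?_
  simp only [smul_eq_mul]
  rw [← neg_sub s, div_neg, mul_neg]

lemma norm_exp_sub_ge_of_re_nonpos {ζ s : ℂ} (h : Real.cos ζ.im ≤ 0) :
    s.re ≤ ‖Complex.exp ζ - s‖ := by
  have h1 := Complex.re_le_norm (s - Complex.exp ζ)
  rw [norm_sub_rev, Complex.sub_re, Complex.exp_re] at h1
  nlinarith [mul_nonneg (Real.exp_pos ζ.re).le (neg_nonneg.2 h)]

lemma cos_nonpos_of_le_abs {y r : ℝ} (hr : r < 1) (h1 : Real.pi - r ≤ |y|) (h2 : |y| ≤ Real.pi) :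
    Real.cos y ≤ 0 := by
  have := Real.pi_gt_three
  rw [← Real.cos_abs]
  exact Real.cos_nonpos_of_pi_div_two_le_of_le (by linarith) (by linarith)

/-- The two ends and the notches contribute little to the integral along the keyhole contour. -/
lemma norm_keyhole_sub_le {f : ℂ → ℂ} {x₀ r L C₁ C₂ C₃ : ℝ} (hr : 0 < r) (hr1 : r < 1)
    (h1 : ∀ ζ : ℂ, max |ζ.re - x₀| (Real.pi - |ζ.im|) = r → |ζ.im| ≤ Real.pi → ‖f ζ‖ ≤ C₁)
    (h2 : ∀ ζ : ℂ, ζ.re = L → |ζ.im| ≤ Real.pi → ‖f ζ‖ ≤ C₂)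
    (h3 : ∀ ζ : ℂ, ζ.re = -L → |ζ.im| ≤ Real.pi → ‖f ζ‖ ≤ C₃) :
    ‖keyhole x₀ r (-L) L f - ((hInt f (-Real.pi) (-L) (x₀ - r) - hInt f Real.pi (-L) (x₀ - r)) +
      (hInt f (-Real.pi) (x₀ + r) L - hInt f Real.pi (x₀ + r) L))‖ ≤
      8 * C₁ * r + 2 * Real.pi * (C₂ + C₃) := by
  have hpi := Real.pi_gt_three
  have hh : ∀ y : ℝ, |y| = Real.pi - r → ‖hInt f y (x₀ - r) (x₀ + r)‖ ≤ C₁ * (2 * r) := by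
    intro y hy
    refine (norm_hInt_le (by linarith) fun x hx => h1 _ ?_ ?_).trans (le_of_eq (by ring))
    · simp only [Complex.add_re, Complex.ofReal_re, Complex.mul_re, Complex.I_re, mul_zero,
        Complex.ofReal_im, Complex.I_im, mul_one, sub_self, add_zero, Complex.add_im,
        Complex.mul_im, zero_add, hy, sub_sub_cancel]
      exact max_eq_right (abs_le.2 ⟨by linarith [hx.1], by linarith [hx.2]⟩)
    · simp only [Complex.add_im, Complex.ofReal_im, Complex.mul_im, Complex.ofReal_re,
        Complex.I_im, mul_one, Complex.I_re, mul_zero, add_zero, zero_add]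
      linarith
  have hv : ∀ x : ℝ, |x - x₀| = r → ∀ p q : ℝ, q - p = r → (∀ y ∈ Icc p q, Real.pi - r ≤ |y| ∧
      |y| ≤ Real.pi) → ‖vInt f x p q‖ ≤ C₁ * r := by
    intro x hx p q hpq h
    refine (norm_vInt_le (by linarith) fun y hy => h1 _ ?_ ?_).trans (le_of_eq (by rw [hpq]))
    · simp only [Complex.add_re, Complex.ofReal_re, Complex.mul_re, Complex.I_re, mul_zero,
        Complex.ofReal_im, Complex.I_im, mul_one, sub_self, add_zero, Complex.add_im,
        Complex.mul_im, zero_add, hx]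
      exact max_eq_left (by linarith [(h y hy).1])
    · simp only [Complex.add_im, Complex.ofReal_im, Complex.mul_im, Complex.ofReal_re,
        Complex.I_im, mul_one, Complex.I_re, mul_zero, add_zero, zero_add]
      exact (h y hy).2
  have hlow : ∀ y ∈ Icc (-Real.pi) (-Real.pi + r), Real.pi - r ≤ |y| ∧ |y| ≤ Real.pi :=
    fun y hy => ⟨le_trans (by linarith [hy.2]) (neg_le_abs y), abs_le.2 ⟨hy.1, by linarith [hy.2]⟩⟩
  have hupp : ∀ y ∈ Icc (Real.pi - r) Real.pi, Real.pi - r ≤ |y| ∧ |y| ≤ Real.pi :=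
    fun y hy => ⟨hy.1.trans (le_abs_self y), abs_le.2 ⟨by linarith [hy.1], hy.2⟩⟩
  have hx1 : |x₀ - r - x₀| = r := by rw [sub_sub_cancel_left, abs_neg, abs_of_pos hr]
  have hx2 : |x₀ + r - x₀| = r := by rw [add_sub_cancel_left, abs_of_pos hr]
  -- the six edges of the two notches, of total length `8 r`, and the two ends
  have e1 := hh (-Real.pi + r) (by rw [abs_of_nonpos] <;> linarith)
  have e2 := hh (Real.pi - r) (by rw [abs_of_nonneg]; linarith)
  have e3 := hv _ hx1 (-Real.pi) (-Real.pi + r) (by ring) hlow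
  have e4 := hv _ hx1 (Real.pi - r) Real.pi (by ring) hupp
  have e5 := hv _ hx2 (-Real.pi) (-Real.pi + r) (by ring) hlow
  have e6 := hv _ hx2 (Real.pi - r) Real.pi (by ring) hupp
  have e7 : ‖vInt f L (-Real.pi) Real.pi‖ ≤ C₂ * (Real.pi - -Real.pi) :=
    norm_vInt_le (by linarith) fun y hy => h2 _ (by simp) (by simpa using abs_le.2 hy)
  have e8 : ‖vInt f (-L) (-Real.pi) Real.pi‖ ≤ C₃ * (Real.pi - -Real.pi) :=
    norm_vInt_le (by linarith) fun y hy => h3 _ (by simp) (by simpa using abs_le.2 hy)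
  have hk : keyhole x₀ r (-L) L f -
      ((hInt f (-Real.pi) (-L) (x₀ - r) - hInt f Real.pi (-L) (x₀ - r)) +
      (hInt f (-Real.pi) (x₀ + r) L - hInt f Real.pi (x₀ + r) L)) =
      (hInt f (-Real.pi + r) (x₀ - r) (x₀ + r) - hInt f (Real.pi - r) (x₀ - r) (x₀ + r)) +
      (vInt f L (-Real.pi) Real.pi - vInt f (-L) (-Real.pi) Real.pi) +
      (vInt f (x₀ - r) (-Real.pi) (-Real.pi + r) - vInt f (x₀ + r) (-Real.pi) (-Real.pi + r)) +
      (vInt f (x₀ - r) (Real.pi - r) Real.pi - vInt f (x₀ + r) (Real.pi - r) Real.pi) := by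
    unfold keyhole
    ring
  rw [hk]
  refine (norm_add_le _ _).trans ?_
  have n1 := norm_add_le ((hInt f (-Real.pi + r) (x₀ - r) (x₀ + r) -
    hInt f (Real.pi - r) (x₀ - r) (x₀ + r)) +
      (vInt f L (-Real.pi) Real.pi - vInt f (-L) (-Real.pi) Real.pi))
    (vInt f (x₀ - r) (-Real.pi) (-Real.pi + r) - vInt f (x₀ + r) (-Real.pi) (-Real.pi + r))
  have n2 := norm_add_le (hInt f (-Real.pi + r) (x₀ - r) (x₀ + r) -
    hInt f (Real.pi - r) (x₀ - r) (x₀ + r))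
    (vInt f L (-Real.pi) Real.pi - vInt f (-L) (-Real.pi) Real.pi)
  have n3 := norm_sub_le (hInt f (-Real.pi + r) (x₀ - r) (x₀ + r))
    (hInt f (Real.pi - r) (x₀ - r) (x₀ + r))
  have n4 := norm_sub_le (vInt f L (-Real.pi) Real.pi) (vInt f (-L) (-Real.pi) Real.pi)
  have n5 := norm_sub_le (vInt f (x₀ - r) (-Real.pi) (-Real.pi + r))
    (vInt f (x₀ + r) (-Real.pi) (-Real.pi + r))
  have n6 := norm_sub_le (vInt f (x₀ - r) (Real.pi - r) Real.pi)
    (vInt f (x₀ + r) (Real.pi - r) Real.pi)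
  linarith

end PartialFractions

section Expansion

variable {α₁ α₂ c lam : ℝ}

lemma abs_im_log_lt_pi {z : ℂ} (hz : z ∈ Complex.slitPlane) : |(Complex.log z).im| < Real.pi := by
  refine lt_of_le_of_ne (abs_log_im_le z) fun h => ?_
  have h0 := Complex.slitPlane_ne_zero hz
  have h1 := (eq_log_of_exp_eq hz (abs_log_im_le z) (Complex.exp_log h0)).1
  exact h1.ne h

/-- The cut part of the keyhole integral in terms of the integrand. -/
lemma hInt_sub_hInt_eq (hlam : 0 < lam) (s : ℂ) {p q : ℝ} (hpq : p ≤ q)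
    (hc : Real.log c ∉ Icc p q) {S : Set ℂ}
    (hcont : ContinuousOn (fun ζ => logTransform α₁ α₂ c lam ζ / (Complex.exp ζ - s)) S)
    (hS : ∀ y : ℝ, |y| = Real.pi → ∀ x ∈ Icc p q, (x + y * Complex.I : ℂ) ∈ S) :
    hInt (fun ζ => logTransform α₁ α₂ c lam ζ / (Complex.exp ζ - s)) (-Real.pi) p q -
      hInt (fun ζ => logTransform α₁ α₂ c lam ζ / (Complex.exp ζ - s)) Real.pi p q =
    ∫ x in p..q, -(Real.exp x • (integrand α₁ α₂ c lam 0 (Real.exp x) / (s + Real.exp x))) := by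
  have hπ : |Real.pi| = Real.pi := abs_of_pos Real.pi_pos
  rw [hInt, hInt, ← intervalIntegral.integral_sub
    (intervalIntegrable_hInt hcont hpq (hS _ ((abs_neg _).trans hπ)))
    (intervalIntegrable_hInt hcont hpq (hS _ hπ))]
  refine intervalIntegral.integral_congr fun x hx => ?_
  rw [uIcc_of_le hpq] at hx
  exact logTransform_div_jump hlam s fun h => hc (h ▸ hx)

/-- Partial fraction expansion of `W`, with the branch cut contributing a Stieltjes transform: the
limit of the residue theorem on keyhole contours whose notches shrink along good radii. -/
theorem solutionTransform_eq_tsum (hα₁ : 0 < α₁) (hα : α₁ < α₂) (hα₂ : α₂ < 1) (hc : 0 < c)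
    (hlam : 0 < lam) (hcut : ∀ ρ : ℝ, 0 < ρ → ρ ≠ c → denom α₁ α₂ c lam (-(ρ : ℂ)) ≠ 0)
    {ϱ : ℂ → ℝ} (hϱ : ∀ z ∈ poles α₁ α₂ c lam, 0 < ϱ z ∧ ϱ z ≤ 1 ∧ ∀ σ : ℂ, ‖σ - z‖ ≤ ϱ z →
      σ ∈ Complex.slitPlane ∧
        (σ ≠ z → 1 + Complex.exp (logRatio α₁ α₂ c lam (Complex.log σ)) ≠ 0))
    {s : ℂ} (hs0 : 0 < s.re) (hs : ∀ z ∈ poles α₁ α₂ c lam, z.re + 1 < s.re)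
    (hsum : Summable fun z : poles α₁ α₂ c lam => poleTerm α₁ α₂ c lam z (ϱ z) s) :
    solutionTransform α₁ α₂ c lam s =
      ∑' z : poles α₁ α₂ c lam, poleTerm α₁ α₂ c lam z (ϱ z) s -
      (2 * (Real.pi : ℂ) * Complex.I)⁻¹ *
        ∫ ρ in Ioi (0 : ℝ), integrand α₁ α₂ c lam 0 ρ / (s + ρ) := by
  classical
  obtain ⟨X, K, hX, hK, hright, hleft⟩ := exists_logTransform_ends hα₁ hα hc hlam
  obtain ⟨X', hX'⟩ := exists_norm_bounds_poles hα₁ hα hc hlam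
  obtain ⟨B, hB⟩ := exists_good_notch (lam := lam) hα hc
  have hr : ∀ n : ℕ, ∃ r : ℝ, 0 < r ∧ r < 1 / ((n : ℝ) + 1) ∧
      ∀ ζ : ℂ, max |ζ.re - Real.log c| (Real.pi - |ζ.im|) = r → |ζ.im| ≤ Real.pi →
      1 + Complex.exp (logRatio α₁ α₂ c lam ζ) ≠ 0 ∧ ‖logTransform α₁ α₂ c lam ζ‖ ≤ B :=
    fun n => hB _ (by positivity)
  choose r hr0 hrn hgood using hr
  have hr1 : ∀ n, r n < 1 := fun n => (hrn n).trans_le (by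
    rw [div_le_one (by positivity)]
    linarith [Nat.cast_nonneg (α := ℝ) n])
  have hrt : Tendsto r atTop (𝓝 0) := squeeze_zero (fun n => (hr0 n).le) (fun n => (hrn n).le)
    tendsto_one_div_add_atTop_nhds_zero_nat
  have hsne : s ≠ 0 := fun h => by rw [h, Complex.zero_re] at hs0; exact lt_irrefl _ hs0
  have hsn : 0 < ‖s‖ := norm_pos_iff.2 hsne
  set L : ℕ → ℝ := fun n => n + (X + |X'| + |Real.log ‖s‖| + 1) with hL
  have hLt : Tendsto L atTop atTop := tendsto_atTop_add_const_right _ _ tendsto_natCast_atTop_atTop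
  have hLX : ∀ n, X < L n ∧ X' < L n ∧ |Real.log ‖s‖| < L n := fun n => by
    have h1 := Nat.cast_nonneg (α := ℝ) n
    have h2 := abs_nonneg X'
    have h3 := abs_nonneg (Real.log ‖s‖)
    have h4 := abs_nonneg (Real.log c)
    have h5 := le_abs_self X'
    simp only [hL]
    exact ⟨by linarith, by linarith, by linarith⟩
  have hca := neg_abs_le (Real.log c)
  have hcb := le_abs_self (Real.log c)
  have hap : ∀ n, -L n < Real.log c - r n := fun n => by linarith [hLX n, hr1 n]
  have hbp : ∀ n, Real.log c + r n < L n := fun n => by linarith [hLX n, hr1 n]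
  have hpoles : ∀ n, ∀ z ∈ poles α₁ α₂ c lam,
      -L n < (Complex.log z).re ∧ (Complex.log z).re < L n := fun n z hz => by
    have hz0 := norm_pos_iff.2 (Complex.slitPlane_ne_zero hz.1)
    have h1 := hX' z hz
    rw [← Real.lt_log_iff_exp_lt hz0, ← Real.log_lt_iff_lt_exp hz0] at h1
    rw [Complex.log_re]
    exact ⟨by linarith [hLX n], by linarith [hLX n]⟩
  have hsL : ∀ n, -L n < (Complex.log s).re ∧ (Complex.log s).re < L n := fun n => by
    rw [Complex.log_re]
    exact abs_lt.1 (hLX n).2.2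
  have hfin : ∀ n, {z | z ∈ poles α₁ α₂ c lam ∧
      InsideKeyhole (Real.log c) (r n) (-L n) (L n) z}.Finite := fun n => by
    refine (finite_poles_far hα₁ hα hc hlam (hr0 n)).subset fun z hz => ?_
    have him := abs_lt.1 (abs_im_log_lt_pi hz.1.1)
    refine ⟨hz.1, ?_, ?_⟩
    · rcases hz.2.2.2.2 with h | h
      · have h1 := Complex.abs_re_le_norm (Complex.log z - cutPoint c Real.pi)
        rw [Complex.sub_re, cutPoint_re] at h1
        linarith
      · have h1 := Complex.abs_im_le_norm (Complex.log z - cutPoint c Real.pi)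
        rw [Complex.sub_im, cutPoint_im, abs_of_neg (by linarith)] at h1
        linarith [le_abs_self (Complex.log z).im]
    · rcases hz.2.2.2.2 with h | h
      · have h1 := Complex.abs_re_le_norm (Complex.log z - cutPoint c (-Real.pi))
        rw [Complex.sub_re, cutPoint_re] at h1
        linarith
      · have h1 := Complex.abs_im_le_norm (Complex.log z - cutPoint c (-Real.pi))
        rw [Complex.sub_im, cutPoint_im, abs_of_pos (by linarith)] at h1
        linarith [neg_abs_le (Complex.log z).im]
  set F : ℕ → Finset ℂ := fun n => (hfin n).toFinset with hF
  have hFmem : ∀ n z, z ∈ F n ↔ z ∈ poles α₁ α₂ c lam ∧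
      InsideKeyhole (Real.log c) (r n) (-L n) (L n) z := fun n z => by simp [hF]
  set N : ℂ → ℂ := fun ζ => logTransform α₁ α₂ c lam ζ / (Complex.exp ζ - s) with hN
  have hkey := fun n => keyhole_logTransform hα₁ hα hc hlam hcut hϱ hs0 hs (hr0 n) (hr1 n) (hap n)
    (hbp n) (fun ζ h1 h2 => (hgood n ζ h1 h2).1) (hpoles n) (hsL n) (hFmem n)
  -- the sum over the poles inside the contour
  have hpole : Tendsto (fun n => ∑ z ∈ F n, poleTerm α₁ α₂ c lam z (ϱ z) s) atTop
      (𝓝 (∑' z : poles α₁ α₂ c lam, poleTerm α₁ α₂ c lam z (ϱ z) s)) := by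
    have h1 : Tendsto (fun n => (F n).subtype (· ∈ poles α₁ α₂ c lam)) atTop atTop := by
      refine tendsto_atTop.2 fun T => ?_
      have h2 : ∀ z ∈ T, ∀ᶠ n in atTop, z ∈ (F n).subtype (· ∈ poles α₁ α₂ c lam) := fun z _ => by
        have him : 0 < Real.pi - |(Complex.log z).im| := sub_pos.2 (abs_im_log_lt_pi z.2.1)
        filter_upwards [hrt.eventually (gt_mem_nhds him)] with n hn
        rw [Finset.mem_subtype, hFmem]
        have h3 := hpoles n z z.2
        exact ⟨z.2, z.2.1, h3.1, h3.2, Or.inr (by linarith)⟩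
      filter_upwards [(Filter.eventually_all_finset T).2 h2] with n hn
      exact fun z hz => hn z hz
    refine (hsum.hasSum.comp h1).congr fun n => ?_
    simp only [Function.comp]
    exact Finset.sum_subtype_of_mem (fun z => poleTerm α₁ α₂ c lam z (ϱ z) s)
      fun z hz => ((hFmem n z).1 hz).1
  -- the cut
  set J : ℝ → ℂ := fun x =>
    -(Real.exp x • (integrand α₁ α₂ c lam 0 (Real.exp x) / (s + Real.exp x))) with hJ
  have hhi := integrableOn_integrand_div hα₁ hα hα₂ hc hlam hcut hs0
  have hJi : Integrable J := (integrable_exp_smul_comp hhi).neg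
  have hJint : ∫ x, J x = -∫ ρ in Ioi (0 : ℝ), integrand α₁ α₂ c lam 0 ρ / (s + ρ) := by
    rw [hJ, integral_neg,
      integral_exp_smul_comp fun ρ : ℝ => integrand α₁ α₂ c lam 0 ρ / (s + ρ)]
  have hcutpart := tendsto_integral_avoiding hJi (Real.log c)
    (tendsto_neg_atTop_atBot.comp hLt) hLt hrt (fun n => (hap n).le) (fun n => (hbp n).le) hr0
  rw [hJint] at hcutpart
  -- the ends and the notches
  have hrest : Tendsto (fun n => keyhole (Real.log c) (r n) (-L n) (L n) N -
      ((∫ x in -L n..(Real.log c - r n), J x) + ∫ x in (Real.log c + r n)..L n, J x)) atTop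
      (𝓝 0) := by
    have hb2 : Tendsto (fun n => (1 + K) / (Real.exp (L n) - ‖s‖)) atTop (𝓝 0) :=
      (tendsto_atTop_add_const_right _ _ (Real.tendsto_exp_atTop.comp hLt)).const_div_atTop _
    have he : Tendsto (fun n => Real.exp (-L n)) atTop (𝓝 0) :=
      Real.tendsto_exp_atBot.comp (tendsto_neg_atTop_atBot.comp hLt)
    have he2 : Tendsto (fun n => Real.exp (α₂ * -L n)) atTop (𝓝 0) :=
      Real.tendsto_exp_atBot.comp
        ((tendsto_neg_atTop_atBot.comp hLt).const_mul_atBot (hα₁.trans hα))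
    have hb3 : Tendsto (fun n => K * Real.exp (α₂ * -L n) / (‖s‖ - Real.exp (-L n))) atTop
        (𝓝 (K * 0 / (‖s‖ - 0))) := (he2.const_mul K).div (he.const_sub _) (by linarith)
    have hbound : Tendsto (fun n => 8 * (B / s.re) * r n + 2 * Real.pi *
        ((1 + K) / (Real.exp (L n) - ‖s‖) +
          K * Real.exp (α₂ * -L n) / (‖s‖ - Real.exp (-L n)))) atTop
        (𝓝 (8 * (B / s.re) * 0 + 2 * Real.pi * (0 + K * 0 / (‖s‖ - 0)))) :=
      (hrt.const_mul _).add ((hb2.add hb3).const_mul _)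
    simp only [mul_zero, zero_div, add_zero] at hbound
    refine squeeze_zero_norm (fun n => ?_) hbound
    have hedges := keyhole_edges (hr0 n) ((hr1 n).trans (by linarith [Real.pi_gt_three])) (hap n)
      (hbp n)
    have hcont : ContinuousOn N (keyholeBoundary (Real.log c) (r n) (-L n) (L n)) :=
      fun ζ hζ => ((hkey n).1 ζ hζ).continuousAt.continuousWithinAt
    have e1 := hInt_sub_hInt_eq hlam s (hap n).le (fun h => by linarith [h.2, hr0 n]) hcont hedges.1
    have e2 := hInt_sub_hInt_eq hlam s (hbp n).le (fun h => by linarith [h.1, hr0 n]) hcont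
      hedges.2.1
    simp only [hJ]
    rw [← e1, ← e2]
    have hsL' := hsL n
    rw [Complex.log_re, Real.log_lt_iff_lt_exp hsn, Real.lt_log_iff_exp_lt hsn] at hsL'
    refine norm_keyhole_sub_le (hr0 n) (hr1 n) (fun ζ h1 h2 => ?_) (fun ζ h1 h2 => ?_)
      fun ζ h1 h2 => ?_
    · simp only [hN]
      rw [norm_div]
      have h3 := (hgood n ζ h1 h2).2
      have h4 := norm_exp_sub_ge_of_re_nonpos (ζ := ζ) (s := s) (cos_nonpos_of_le_abs (hr1 n) (by
        linarith [le_max_right |ζ.re - Real.log c| (Real.pi - |ζ.im|)]) h2)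
      have h5 := (norm_nonneg _).trans h3
      gcongr
    · simp only [hN]
      rw [norm_div]
      have h3 := (hright ζ h2 (by rw [h1]; exact (hLX n).1.le)).2
      have h4 : K * Real.exp (-α₁ * ζ.re) ≤ K * 1 := by
        gcongr
        rw [Real.exp_le_one_iff, h1]
        nlinarith [hLX n, abs_nonneg (Real.log c)]
      have h5 : ‖logTransform α₁ α₂ c lam ζ‖ ≤ 1 + K := by
        have := norm_add_le (logTransform α₁ α₂ c lam ζ - 1) 1
        rw [sub_add_cancel, norm_one] at this
        linarith
      have h6 := norm_sub_norm_le (Complex.exp ζ) s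
      rw [Complex.norm_exp, h1] at h6
      have h7 : 0 < Real.exp (L n) - ‖s‖ := by linarith
      gcongr
    · simp only [hN]
      rw [norm_div]
      have h3 := (hleft ζ h2 (by rw [h1]; linarith [(hLX n).1])).2
      rw [h1] at h3
      have h6 := norm_sub_norm_le s (Complex.exp ζ)
      rw [Complex.norm_exp, h1, norm_sub_rev] at h6
      have h7 : 0 < ‖s‖ - Real.exp (-L n) := by linarith
      gcongr
  have hall := ((hrest.add hcutpart).div_const (2 * (Real.pi : ℂ) * Complex.I)).add hpole
  have hconst : ∀ n, (keyhole (Real.log c) (r n) (-L n) (L n) N -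
      ((∫ x in -L n..(Real.log c - r n), J x) + ∫ x in (Real.log c + r n)..L n, J x) +
      ((∫ x in -L n..(Real.log c - r n), J x) + ∫ x in (Real.log c + r n)..L n, J x)) /
        (2 * (Real.pi : ℂ) * Complex.I) + ∑ z ∈ F n, poleTerm α₁ α₂ c lam z (ϱ z) s =
      solutionTransform α₁ α₂ c lam s := fun n => by
    rw [sub_add_cancel, (hkey n).2]
    simp only [circleIntegral_eq_neg_poleTerm]
    rw [Finset.sum_neg_distrib, ← Finset.mul_sum, ← sub_eq_add_neg, ← mul_sub,
      mul_div_cancel_left₀ _ Complex.two_pi_I_ne_zero, sub_add_cancel]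
  have hlim := tendsto_nhds_unique (hall.congr hconst) tendsto_const_nhds
  rw [← hlim]
  ring

end Expansion

/-! ### The solution formula -/

section Formula

variable {α₁ α₂ c lam : ℝ}

lemma countable_poles (hα₁ : 0 < α₁) (hα : α₁ < α₂) (hc : 0 < c) (hlam : 0 < lam) :
    (poles α₁ α₂ c lam).Countable := by
  refine (countable_iUnion fun n : ℕ => (finite_poles_far hα₁ hα hc hlam
    (r := 1 / ((n : ℝ) + 1)) (by positivity)).countable).mono fun z hz => ?_
  obtain ⟨n, hn⟩ := exists_nat_one_div_lt (sub_pos.2 (abs_im_log_lt_pi hz.1))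
  have him := abs_lt.1 (abs_im_log_lt_pi hz.1)
  refine mem_iUnion.2 ⟨n, hz, ?_, ?_⟩
  · have h1 := Complex.abs_im_le_norm (Complex.log z - cutPoint c Real.pi)
    rw [Complex.sub_im, cutPoint_im, abs_of_neg (by linarith)] at h1
    linarith [le_abs_self (Complex.log z).im]
  · have h1 := Complex.abs_im_le_norm (Complex.log z - cutPoint c (-Real.pi))
    rw [Complex.sub_im, cutPoint_im, abs_of_pos (by linarith)] at h1
    linarith [neg_abs_le (Complex.log z).im]

/-- The right-hand side of the solution formula for the initial value `1`, with the sum extended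
over all poles. -/
def formula (α₁ α₂ c lam t : ℝ) : ℂ :=
  ∑' z : poles α₁ α₂ c lam, solutionResidue α₁ α₂ c lam t z -
    (2 * (Real.pi : ℂ) * Complex.I)⁻¹ * ∫ ρ in Ioi (0 : ℝ), integrand α₁ α₂ c lam t ρ

/-- Termwise Laplace transformation of a series with summable exponential bounds. -/
lemma hasLaplaceAt_tsum {ι : Type*} [Countable ι] {f : ι → ℝ → ℂ} {G : ι → ℂ} {C : ι → ℝ} {m : ℝ}
    {s : ℂ} (hs : m < s.re) (hC : Summable C) (hf : ∀ i, HasLaplaceAt (f i) s (G i))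
    (hb : ∀ i t, 0 ≤ t → ‖f i t‖ ≤ C i * Real.exp (m * t))
    (hc : ContinuousOn (fun t => ∑' i, f i t) (Ici 0)) :
    Summable G ∧ HasLaplaceAt (fun t => ∑' i, f i t) s (∑' i, G i) := by
  have hC0 : ∀ i, 0 ≤ C i := fun i => by
    have := (norm_nonneg _).trans (hb i 0 le_rfl)
    simpa using this
  have hexp : IntegrableOn (fun t : ℝ => Real.exp (-(s.re - m) * t)) (Ioi 0) :=
    integrableOn_exp_mul_Ioi (by linarith) 0
  have hle : ∀ (t : ℝ) (w : ℂ) (B : ℝ), ‖w‖ ≤ B * Real.exp (m * t) →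
      ‖Complex.exp (-s * (t : ℂ)) * w‖ ≤ B * Real.exp (-(s.re - m) * t) := fun t w B h => by
    rw [norm_mul, norm_exp_neg_mul]
    calc _ ≤ Real.exp (-s.re * t) * (B * Real.exp (m * t)) := by gcongr
      _ = B * (Real.exp (-s.re * t) * Real.exp (m * t)) := by ring
      _ = _ := by rw [← Real.exp_add]; congr 2; ring
  have hsumf : ∀ t : ℝ, 0 ≤ t → Summable fun i => ‖f i t‖ := fun t ht =>
    Summable.of_nonneg_of_le (fun i => norm_nonneg _) (fun i => hb i t ht) (hC.mul_right _)
  have hnorm : ∀ i, ∫ t in Ioi (0 : ℝ), ‖Complex.exp (-s * (t : ℂ)) * f i t‖ ≤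
      C i * ∫ t in Ioi (0 : ℝ), Real.exp (-(s.re - m) * t) := fun i => by
    rw [← integral_const_mul]
    exact setIntegral_mono_on (hf i).1.norm (hexp.const_mul _) measurableSet_Ioi
      fun t ht => hle t _ _ (hb i t (le_of_lt ht))
  have hsn : Summable fun i => ∫ t in Ioi (0 : ℝ), ‖Complex.exp (-s * (t : ℂ)) * f i t‖ :=
    Summable.of_nonneg_of_le (fun i => integral_nonneg fun t => norm_nonneg _) hnorm
      (hC.mul_right _)
  have h1 := hasSum_integral_of_summable_integral_norm (fun i => (hf i).1) hsn
  have h2 : ∀ i, ∫ t in Ioi (0 : ℝ), Complex.exp (-s * (t : ℂ)) * f i t = G i := fun i => (hf i).2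
  simp only [h2] at h1
  refine ⟨h1.summable, ?_, ?_⟩
  · refine (hexp.const_mul (∑' i, C i)).mono' ?_ ?_
    · exact ((by fun_prop : Continuous fun t : ℝ => Complex.exp (-s * (t : ℂ))).continuousOn.mul
        (hc.mono Ioi_subset_Ici_self)).aestronglyMeasurable measurableSet_Ioi
    · refine (ae_restrict_iff' measurableSet_Ioi).2 (Eventually.of_forall fun t ht => ?_)
      have ht : 0 < t := ht
      refine hle t _ _ ((norm_tsum_le_tsum_norm (hsumf t ht.le)).trans ?_)
      rw [← tsum_mul_right]
      exact (hsumf t ht.le).tsum_le_tsum (fun i => hb i t ht.le) (hC.mul_right _)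
  · rw [h1.tsum_eq]
    refine setIntegral_congr_fun measurableSet_Ioi fun t ht => ?_
    simp only [tsum_mul_left]

/-- The Laplace transform of the contribution of the cut is a Stieltjes transform. -/
lemma hasLaplaceAt_integral_integrand (hα₁ : 0 < α₁) (hα : α₁ < α₂) (hα₂ : α₂ < 1) (hc : 0 < c)
    (hlam : 0 < lam) (hcut : ∀ ρ : ℝ, 0 < ρ → ρ ≠ c → denom α₁ α₂ c lam (-(ρ : ℂ)) ≠ 0) {s : ℂ}
    (hs : 0 < s.re) :
    HasLaplaceAt (fun t => ∫ ρ in Ioi (0 : ℝ), integrand α₁ α₂ c lam t ρ) s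
      (∫ ρ in Ioi (0 : ℝ), integrand α₁ α₂ c lam 0 ρ / (s + ρ)) := by
  set H : ℝ → ℝ → ℂ := fun t ρ =>
    integrand α₁ α₂ c lam 0 ρ * Complex.exp (-(s + ρ) * t) with hH
  have e1 : ∀ t : ℝ, Complex.exp (-s * (t : ℂ)) * ∫ ρ in Ioi (0 : ℝ), integrand α₁ α₂ c lam t ρ =
      ∫ ρ in Ioi (0 : ℝ), H t ρ := by
    intro t
    rw [← integral_const_mul]
    congr 1
    ext ρ
    simp only [hH]
    rw [integrand_eq_mul_exp, Complex.ofReal_exp, neg_add, add_mul, Complex.exp_add]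
    push_cast
    ring
  have hexp : IntegrableOn (fun t : ℝ => Real.exp (-s.re * t)) (Ioi 0) :=
    integrableOn_exp_mul_Ioi (by linarith) 0
  have hi := integrableOn_integrand_zero hα₁ hα hα₂ hc hlam hcut
  have hint : Integrable (Function.uncurry H)
      ((volume.restrict (Ioi 0)).prod (volume.restrict (Ioi 0))) := by
    refine (hexp.mul_prod hi.norm).mono' ?_ ?_
    · refine Measurable.aestronglyMeasurable ?_
      simp only [Function.uncurry_def, hH]
      exact ((measurable_integrand 0).comp measurable_snd).mul (by fun_prop)
    · rw [Measure.prod_restrict]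
      refine (ae_restrict_iff' (measurableSet_Ioi.prod measurableSet_Ioi)).2
        (Eventually.of_forall fun p hp => ?_)
      have hp1 : 0 < p.1 := hp.1
      have hp2 : 0 < p.2 := hp.2
      simp only [Function.uncurry_def, hH]
      rw [norm_mul, Complex.norm_exp, mul_comm]
      gcongr
      simp only [neg_add_rev, Complex.mul_re, Complex.add_re, Complex.neg_re, Complex.ofReal_re,
        Complex.ofReal_im, mul_zero, sub_zero]
      nlinarith
  refine ⟨?_, ?_⟩
  · simp only [e1]
    exact hint.integral_prod_left
  · simp only [e1]
    rw [integral_integral_swap hint]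
    refine setIntegral_congr_fun measurableSet_Ioi fun ρ hρ => ?_
    have hρ : 0 < ρ := hρ
    have h5 : (-(s + ρ)).re < 0 := by
      rw [Complex.neg_re, Complex.add_re, Complex.ofReal_re]; linarith
    simp only [hH]
    rw [integral_const_mul, integral_exp_mul_complex_Ioi h5]
    simp only [Complex.ofReal_zero, mul_zero, Complex.exp_zero]
    rw [neg_div_neg_eq, mul_one_div]

lemma continuousOn_integral_integrand (hα₁ : 0 < α₁) (hα : α₁ < α₂) (hα₂ : α₂ < 1) (hc : 0 < c)
    (hlam : 0 < lam) (hcut : ∀ ρ : ℝ, 0 < ρ → ρ ≠ c → denom α₁ α₂ c lam (-(ρ : ℂ)) ≠ 0) :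
    ContinuousOn (fun t => ∫ ρ in Ioi (0 : ℝ), integrand α₁ α₂ c lam t ρ) (Ici 0) := by
  refine continuousOn_of_dominated (bound := fun ρ => ‖integrand α₁ α₂ c lam 0 ρ‖)
    (fun t _ => (measurable_integrand t).aestronglyMeasurable) (fun t ht => ?_)
    (integrableOn_integrand_zero hα₁ hα hα₂ hc hlam hcut).norm (Eventually.of_forall fun ρ => ?_)
  · exact (ae_restrict_iff' measurableSet_Ioi).2
      (Eventually.of_forall fun ρ hρ => norm_integrand_le_zero ht hρ)
  · rw [show (fun t => integrand α₁ α₂ c lam t ρ) = fun t => integrand α₁ α₂ c lam 0 ρ *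
      (Real.exp (-ρ * t) : ℝ) from funext fun t => integrand_eq_mul_exp t ρ]
    fun_prop

/-- The function given by the solution formula is continuous and its Laplace transform is `W`. -/
lemma continuousOn_formula_and_hasLaplaceAt (hα₁ : 0 < α₁) (hα : α₁ < α₂) (hα₂ : α₂ < 1)
    (hc : 0 < c) (hlam : 0 < lam)
    (hcut : ∀ ρ : ℝ, 0 < ρ → ρ ≠ c → denom α₁ α₂ c lam (-(ρ : ℂ)) ≠ 0) :
    (∀ t : ℝ, 0 ≤ t → Summable fun z : poles α₁ α₂ c lam => solutionResidue α₁ α₂ c lam t z) ∧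
    ContinuousOn (formula α₁ α₂ c lam) (Ici 0) ∧
    ∃ a : ℝ, ∀ s : ℂ, a < s.re →
      HasLaplaceAt (formula α₁ α₂ c lam) s (solutionTransform α₁ α₂ c lam s) := by
  obtain ⟨M, C, hM, hC, hb⟩ := exists_summable_bound hα₁ hα hc hlam
  have : Countable (poles α₁ α₂ c lam) := (countable_poles hα₁ hα hc hlam).to_subtype
  have hϱ : ∀ z ∈ poles α₁ α₂ c lam, ∃ ϱ : ℝ, 0 < ϱ ∧ ϱ ≤ 1 ∧ ∀ σ : ℂ, ‖σ - z‖ ≤ ϱ →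
      σ ∈ Complex.slitPlane ∧
        (σ ≠ z → 1 + Complex.exp (logRatio α₁ α₂ c lam (Complex.log σ)) ≠ 0) :=
    fun z hz => exists_isolating_radius hα₁ hα hc hlam hz.1
  choose! ϱ hϱ using hϱ
  have hC0 : ∀ z ∈ poles α₁ α₂ c lam, 0 ≤ C z := fun z hz => by
    have := (norm_nonneg _).trans (hb z hz 0 le_rfl)
    simpa using this
  have hcont : ContinuousOn (fun t => ∑' z : poles α₁ α₂ c lam, solutionResidue α₁ α₂ c lam t z)
      (Ici 0) := by
    intro t ht
    have h1 : ContinuousOn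
        (fun t => ∑' z : poles α₁ α₂ c lam, solutionResidue α₁ α₂ c lam t z) (Ico 0 (t + 1)) := by
      refine continuousOn_tsum (u := fun z : poles α₁ α₂ c lam =>
        C z * Real.exp (|M + 1| * (t + 1))) (fun z =>
        (continuous_solutionResidue hα₁ hα hc hlam z.2.1).continuousOn) (hC.mul_right _)
        fun z x hx => (hb z z.2 x hx.1).trans ?_
      gcongr
      · exact hC0 z z.2
      · exact hx.1
      · exact le_abs_self _
      · exact hx.2.le
    refine (h1 t ⟨ht, by linarith⟩).mono_of_mem_nhdsWithin ?_
    rw [← Ici_inter_Iio]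
    exact inter_mem_nhdsWithin _ (Iio_mem_nhds (by linarith))
  refine ⟨fun t ht => ?_, ?_, max (M + 1) 0, fun s hs => ?_⟩
  · exact Summable.of_norm_bounded (hC.mul_right _) fun z => hb z z.2 t ht
  · exact hcont.sub (continuousOn_const.mul
      (continuousOn_integral_integrand hα₁ hα hα₂ hc hlam hcut))
  · have hs1 : M + 1 < s.re := (le_max_left _ _).trans_lt hs
    have hs0 : 0 < s.re := (le_max_right _ _).trans_lt hs
    obtain ⟨hG, hL⟩ := hasLaplaceAt_tsum
      (f := fun (z : poles α₁ α₂ c lam) t => solutionResidue α₁ α₂ c lam t z)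
      (G := fun z : poles α₁ α₂ c lam => poleTerm α₁ α₂ c lam z (ϱ z) s) hs1 hC
      (fun z => hasLaplaceAt_solutionResidue hc hlam (hϱ z z.2).1 (hϱ z z.2).2.2 (by
        linarith [hM z z.2, (hϱ z z.2).2.1])) (fun z t ht => hb z z.2 t ht) hcont
    have h3 := hL.sub ((hasLaplaceAt_integral_integrand hα₁ hα hα₂ hc hlam hcut hs0).const_mul
      (2 * (Real.pi : ℂ) * Complex.I)⁻¹)
    rw [← solutionTransform_eq_tsum hα₁ hα hα₂ hc hlam hcut hϱ hs0 (fun z hz => by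
      linarith [hM z hz]) hG] at h3
    exact h3

/-- Every solution of the relaxation equation with transform `u₀ W` is given by the formula. -/
lemma IsSolution.eq_formula {u₀ : ℝ} {u : ℝ → ℝ} (hα₁ : 0 < α₁) (hα : α₁ < α₂) (hα₂ : α₂ < 1)
    (hc : 0 < c) (hlam : 0 < lam)
    (hcut : ∀ ρ : ℝ, 0 < ρ → ρ ≠ c → denom α₁ α₂ c lam (-(ρ : ℂ)) ≠ 0)
    (hu : IsSolution (expTransition α₁ α₂ c) lam u₀ u)
    (huL : HasLaplace u (fun s => u₀ * solutionTransform α₁ α₂ c lam s)) {t : ℝ} (ht : 0 ≤ t) :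
    (u t : ℂ) = u₀ * formula α₁ α₂ c lam t := by
  obtain ⟨-, hfc, a, ha⟩ := continuousOn_formula_and_hasLaplaceAt hα₁ hα hα₂ hc hlam hcut
  obtain ⟨a', ha'⟩ := huL
  have huc : ContinuousOn (fun t => (u t : ℂ)) (Ici 0) := by
    refine Complex.continuous_ofReal.comp_continuousOn fun t ht => ?_
    have ht : 0 ≤ t := ht
    have h1 := (hu.absolutelyContinuous (t + 1) (by linarith)).continuousOn
    rw [uIcc_of_le (by linarith)] at h1
    refine (h1 t ⟨ht, by linarith⟩).mono_of_mem_nhdsWithin ?_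
    rw [← Ici_inter_Iic]
    exact inter_mem_nhdsWithin _ (Iic_mem_nhds (by linarith))
  have hgc : ContinuousOn (fun t => (u₀ : ℂ) * formula α₁ α₂ c lam t) (Ici 0) :=
    continuousOn_const.mul hfc
  have h1 := eqOn_of_hasLaplaceAt (huc.mono Ioi_subset_Ici_self) (hgc.mono Ioi_subset_Ici_self)
    (max a a' + 1) (fun s => u₀ * solutionTransform α₁ α₂ c lam s)
    (fun s hs => ha' s (by rw [hs]; linarith [le_max_right a a']))
    (fun s hs => (ha s (by rw [hs]; linarith [le_max_left a a'])).const_mul _)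
  have h2 := h1.of_subset_closure huc hgc Ioi_subset_Ici_self (by rw [closure_Ioi])
  exact h2 ht

end Formula

end

end Scarpi

theorem mainTheorem2 (α₁ α₂ c lam u₀ : ℝ) (hα₁ : 0 < α₁) (hα : α₁ < α₂) (hα₂ : α₂ < 1)
    (hc : 0 < c) (hlam : 0 < lam)
    -- no singularity of the transform on the branch cut apart from `-c` and `0`
    (hcut : ∀ ρ : ℝ, 0 < ρ → ρ ≠ c → Scarpi.denom α₁ α₂ c lam (-(ρ : ℂ)) ≠ 0) :
    -- the kernel of the Scarpi derivative exists
    Scarpi.IsInverseLaplace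
        (Scarpi.kernelTransform (Scarpi.laplace (Scarpi.expTransition α₁ α₂ c)))
        (Scarpi.kernel (Scarpi.expTransition α₁ α₂ c)) ∧
    -- the integrand is bounded near `c`, except in one degenerate case
    (∀ t : ℝ, 0 ≤ t → c ≠ 1 ∨ lam * Real.exp (α₂ - α₁) ≠ 1 →
      ∃ δ > 0, ∃ M : ℝ, ∀ ρ : ℝ, 0 < ρ → |ρ - c| < δ →
        ‖Scarpi.integrand α₁ α₂ c lam t ρ‖ ≤ M) ∧
    -- the integral converges
    (∀ t : ℝ, 0 ≤ t → IntegrableOn (Scarpi.integrand α₁ α₂ c lam t) (Ioi 0)) ∧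
    -- a vertical line to the right of all the poles exists
    (∃ s₀ : ℝ, 0 < s₀ ∧ ∀ z ∈ Scarpi.poles α₁ α₂ c lam, z.re < s₀) ∧
    -- the unique solution
    ∃ u : ℝ → ℝ,
      Scarpi.IsSolution (Scarpi.expTransition α₁ α₂ c) lam u₀ u ∧
      (∀ v : ℝ → ℝ, Scarpi.IsSolution (Scarpi.expTransition α₁ α₂ c) lam u₀ v →
        EqOn v u (Ici 0)) ∧
      Scarpi.HasLaplace u (fun s => u₀ * Scarpi.solutionTransform α₁ α₂ c lam s) ∧
      ∀ s₀ : ℝ, 0 < s₀ → (∀ z ∈ Scarpi.poles α₁ α₂ c lam, z.re < s₀) →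
        ∀ᶠ R : ℝ in atTop, ∀ᶠ ε : ℝ in 𝓝[>] 0, ∀ t : ℝ, 0 ≤ t →
          Summable (fun z : ↥(Scarpi.poles α₁ α₂ c lam ∩ Scarpi.contourInterior s₀ R ε) =>
            Scarpi.solutionResidue α₁ α₂ c lam t z) ∧
          (u t : ℂ) = u₀ / (2 * Real.pi * Complex.I) *
            (Scarpi.residueTerm α₁ α₂ c lam s₀ R ε t -
              ∫ ρ in Ioi (0 : ℝ), Scarpi.integrand α₁ α₂ c lam t ρ) := by
  have hα₁' : α₁ < 1 := hα.trans hα₂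
  obtain ⟨X, hX⟩ := Scarpi.exists_norm_bounds_poles hα₁ hα hc hlam
  obtain ⟨u, hu, huL⟩ := Scarpi.exists_isSolution (α₂ := α₂) u₀ hα₁ hα₁' hc hlam
  refine ⟨Scarpi.isInverseLaplace_kernel hα₁' hc, fun t ht h => ?_,
    fun t ht => Scarpi.integrableOn_integrand hα₁ hα hα₂ hc hlam hcut ht,
    ⟨Real.exp X, Real.exp_pos X, fun z hz => (Complex.re_le_norm z).trans_lt (hX z hz).2⟩,
    u, hu, fun v hv => Scarpi.IsSolution.eqOn hα₁ hα₁' hc hlam hu hv, huL, fun s₀ _ hs₀ => ?_⟩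
  · obtain ⟨δ, hδ, M, hM⟩ := Scarpi.exists_norm_integrand_le_near hα hc hlam h
    exact ⟨δ, hδ, M, hM t ht⟩
  · filter_upwards [eventually_ge_atTop (Real.exp X)] with R hR
    filter_upwards [Ioo_mem_nhdsGT (Real.exp_pos (-X))] with ε hε t ht
    -- all the poles lie in the annulus `e ^ (-X) < ‖z‖ < e ^ X`, hence inside the contour
    have hinside : Scarpi.poles α₁ α₂ c lam ∩ Scarpi.contourInterior s₀ R ε =
        Scarpi.poles α₁ α₂ c lam := inter_eq_left.2 fun z hz =>
      ⟨hz.1, hs₀ z hz, hε.2.trans (hX z hz).1,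
        fun _ => (Complex.abs_im_le_norm z).trans_lt ((hX z hz).2.trans_le hR),
        fun _ => (hX z hz).2.trans_le hR⟩
    rw [Scarpi.residueTerm, hinside]
    refine ⟨(Scarpi.continuousOn_formula_and_hasLaplaceAt hα₁ hα hα₂ hc hlam hcut).1 t ht, ?_⟩
    rw [hu.eq_formula hα₁ hα hα₂ hc hlam hcut huL ht, Scarpi.formula]
    have := Complex.two_pi_I_ne_zero
    field_simp
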